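/- Let $l,m\ge 0$ and place the elements $1,\dots,lm$ in a table with $m$ rows of length $l$. Let $B_{lm}$ be the Boolean algebra of all subsets of the table, and let $S_l\wr S_m$ be the group of permutations that permute the entries within each row and then permute the rows wholesale. It acts on the order complex $\Delta(B_{lm})$, whose faces are the chains $\hat 0<u_0<\dots<u_i<\hat 1$ (the empty face included); the faces of $\Delta(B_{lm})/S_l\wr S_m$ are the orbits of these faces, ordered by: $x\le y$ if some representative of $x$ is contained in some representative of $y$. The facets are the orbits of the saturated chains. *Words.* Represent a facet $F$ by a saturated chain $C$, and let $w_p\in\{1,\dots,m\}$ be the row of the element that is added between ranks $p-1$ and $p$ ($1\le p\le lm$). Choose $C$ in standard form: whenever a row is chosen for the first time, it is the smallest row not yet chosen. Let $c_u(R)$ be the number of $p\le u$ with $w_p=R$. *Similarity.* All rows are similar at rank $0$. A similarity block starting at rank $u_0$ consists of distinct rows $R_1,\dots,R_t$ that are similar at rank $u_0$ and have equal counts $c_{u_0}(R_i)$, and of a number $s\ge1$, such that the $st$ consecutive entries of $w$ after rank $u_0$ are $R_1$ ($s$ times), then $R_2$ ($s$ times), and so on up to $R_t$ ($s$ times). A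 set $K$ of rows is similar at rank $u$ if every entry $w_p\in K$ with $p\le u$ lies in some similarity block whose set of rows contains $K$ (this block may continue beyond rank $u$). The recursion is on the rank. *Evolving row order.* From an initial order $\sigma_0$ of the rows, in one-line notation, obtain $\sigma_{u+1}$ from $\sigma_u$ by moving the row $R=w_{u+1}$ in front of all rows $R'$ such that $\{R,R'\}$ is similar at rank $u$ and $c_u(R')=c_u(R)$ (so the rows that precede $R$ in a current similarity block are not passed); that is, $R$ is placed immediately before the first such $R'$ if one of them is in front of $R$, and stays otherwise. Let $\sigma_{final}$ be the last order $\sigma_{lm}$ obtained from $\sigma_0=$ identity. Then let the order evolve by the same rule again, starting from $\sigma_0=\sigma_{final}$ (wrap-around), and let $\rho_u(j)$ be the place of row $j$ in the resulting order at rank $u$. *Descents in the relative transpose order.* For $0\le u\le lm-2$, let $j_1=w_{u+1}$, $j_2=w_{u+2}$, $i_1=c_{u+1}(j_1)$, $i_2=c_{u+2}(j_2)$. The rank $u+1$ is a descent if $i_1>i_2$, or if $i_1=i_2$ and $\rho_u(j_1)>\rho_u(j_2)$. **Theorem.** For each facet $F$ of $\Delta(B_{lm})/S_l\wr S_m$,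 let $G(F)$ be the face of $F$ (the orbit of a subchain of $C$) that consists of the ranks at which $F$ has a descent. Then $G(F)$ is well defined (it exists and does not depend on the choice of the chain $C$ in standard form), and the assignment $F\mapsto G(F)$ is a partitioning of $\Delta(B_{lm})/S_l\wr S_m$: for every facet $F$ we have $G(F)\le F$ and the interval $[G(F),F]$ is a Boolean algebra, and every face of $\Delta(B_{lm})/S_l\wr S_m$ lies in $[G(F),F]$ for exactly one facet $F$. -/

import Mathlib

open Finset

namespace WreathComplex

/-! ### The quotient complex -/

/-- The subsets of the `l * m` entries of a table with `m` rows of length `l`; these are the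
elements of the Boolean algebra `B_{lm}`. -/
abbrev Subsets (l m : ℕ) : Type := Finset (Fin m × Fin l)

/-- The wreath product `S_l ≀ S_m` inside the symmetric group on the `l * m` table entries:
permute the entries within each row, and then permute the rows wholesale. -/
def wreath (l m : ℕ) : Subgroup (Equiv.Perm (Fin m × Fin l)) where
  carrier := {g | ∃ (π : Equiv.Perm (Fin m)) (τ : Fin m → Equiv.Perm (Fin l)),
    ∀ r c, g (r, c) = (π r, τ r c)}
  mul_mem' := by
    rintro g h ⟨π, τ, hg⟩ ⟨π', τ', hh⟩
    exact ⟨π * π', fun r => τ (π' r) * τ' r, fun r c => by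
      simp [Equiv.Perm.mul_apply, hg, hh]⟩
  one_mem' := ⟨1, fun _ => 1, fun r c => by simp⟩
  inv_mem' := by
    rintro g ⟨π, τ, hg⟩
    refine ⟨π⁻¹, fun r => (τ (π⁻¹ r))⁻¹, fun r c => ?_⟩
    rw [Equiv.Perm.inv_eq_iff_eq, hg]
    simp

/-- A face of the order complex `Δ(B_{lm})`: a chain `∅ < u₀ < ⋯ < uᵢ < univ` of the Boolean
algebra, given by its set of proper elements (the empty face is included). -/
structure Face (l m : ℕ) where
  elems : Finset (Subsets l m)
  chain : IsChain (· ⊆ ·) (elems : Set (Subsets l m))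
  bot_notMem : ∅ ∉ elems
  top_notMem : Finset.univ ∉ elems

@[ext] theorem Face.ext {l m : ℕ} {a b : Face l m} (h : a.elems = b.elems) : a = b := by
  cases a; cases b; simp_all

/-- The image of a face under a permutation of the ground set. -/
def Face.map {l m : ℕ} (g : Equiv.Perm (Fin m × Fin l)) (a : Face l m) : Face l m where
  elems := a.elems.image (fun u => u.image g)
  chain := by
    intro x hx y hy _
    simp only [coe_image, Set.mem_image, mem_coe] at hx hy
    obtain ⟨u, hu, rfl⟩ := hx
    obtain ⟨v, hv, rfl⟩ := hy
    rcases a.chain.total hu hv with h | h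
    · exact Or.inl (image_subset_image h)
    · exact Or.inr (image_subset_image h)
  bot_notMem := by
    intro h
    obtain ⟨u, hu, hu'⟩ := mem_image.1 h
    rw [image_eq_empty] at hu'
    exact a.bot_notMem (hu' ▸ hu)
  top_notMem := by
    intro h
    obtain ⟨u, hu, hu'⟩ := mem_image.1 h
    have : u = univ := by
      refine eq_univ_iff_forall.2 fun x => ?_
      obtain ⟨y, hy, hyx⟩ := mem_image.1 (hu' ▸ mem_univ (g x))
      exact g.injective hyx ▸ hy
    exact a.top_notMem (this ▸ hu)

instance (l m : ℕ) : MulAction (wreath l m) (Face l m) where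
  smul g a := a.map g.1
  one_smul a := by
    apply Face.ext
    change a.elems.image (fun u => u.image fun x => x) = _
    simp
  mul_smul g h a := by
    apply Face.ext
    change a.elems.image (fun u => u.image fun x => g.1 (h.1 x)) =
      (a.elems.image (fun u => u.image h.1)).image (fun u => u.image g.1)
    rw [image_image]
    refine image_congr fun u _ => ?_
    simp only [Function.comp, image_image]
    rfl

theorem smul_elems {l m : ℕ} (g : wreath l m) (a : Face l m) :
    (g • a).elems = a.elems.image (fun u => u.image g.1) := rfl

theorem card_smul_elems {l m : ℕ} (g : wreath l m) (a : Face l m) :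
    #(g • a).elems = #a.elems :=
  card_image_of_injective _ (image_injective g.1.injective)

theorem smul_elems_subset {l m : ℕ} (g : wreath l m) {a b : Face l m} (h : a.elems ⊆ b.elems) :
    (g • a).elems ⊆ (g • b).elems :=
  image_subset_image h

/-- The faces of the quotient complex `Δ(B_{lm}) / (S_l ≀ S_m)`: orbits of faces. -/
def QFace (l m : ℕ) : Type := MulAction.orbitRel.Quotient (wreath l m) (Face l m)

/-- The orbit of a face. -/
def Face.orbit {l m : ℕ} (a : Face l m) : QFace l m :=
  (Quotient.mk (MulAction.orbitRel (wreath l m) (Face l m)) a)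

theorem Face.orbit_eq_iff {l m : ℕ} {a b : Face l m} :
    a.orbit = b.orbit ↔ ∃ g : wreath l m, g • b = a :=
  Quotient.eq (r := MulAction.orbitRel (wreath l m) (Face l m))

/-- The face poset of the quotient complex: one orbit is a face of another if this holds for
suitable representatives. -/
instance (l m : ℕ) : PartialOrder (QFace l m) where
  le x y := ∃ a b : Face l m, a.orbit = x ∧ b.orbit = y ∧ a.elems ⊆ b.elems
  le_refl x := by
    obtain ⟨a, rfl⟩ := Quotient.exists_rep x
    exact ⟨a, a, rfl, rfl, Subset.rfl⟩
  le_trans x y z := by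
    rintro ⟨a, b, rfl, rfl, hab⟩ ⟨b', c, hb, rfl, hbc⟩
    obtain ⟨g, rfl⟩ := Face.orbit_eq_iff.1 hb
    exact ⟨g • a, c, Face.orbit_eq_iff.2 ⟨g, rfl⟩, rfl, (smul_elems_subset g hab).trans hbc⟩
  le_antisymm x y := by
    rintro ⟨a, b, rfl, rfl, hab⟩ ⟨b', a', hb, ha, hba⟩
    obtain ⟨g, rfl⟩ := Face.orbit_eq_iff.1 hb
    obtain ⟨h, rfl⟩ := Face.orbit_eq_iff.1 ha
    have hc := card_le_card hba
    rw [card_smul_elems, card_smul_elems] at hc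
    exact congrArg Face.orbit (Face.ext (eq_of_subset_of_card_le hab hc))

/-- A partitioning of a complex with face poset `P`: each facet (maximal face) `F` is assigned a
face `G F`, in such a way that the intervals `[G F, F]` are Boolean algebras and the set of all
faces is their disjoint union. -/
structure IsPartitioning {P : Type*} [PartialOrder P] (G : {F : P // IsMax F} → P) : Prop where
  le : ∀ F, G F ≤ F.1
  boolean : ∀ F, ∃ k : ℕ, Nonempty (Set.Icc (G F) F.1 ≃o Finset (Fin k))
  existsUnique : ∀ x : P, ∃! F, x ∈ Set.Icc (G F) F.1

/-! ### Row similarity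

A saturated chain is recorded by the word `w`, where `w p` is the row from which the covering
relation from rank `p` to rank `p + 1` takes its new element. -/

/-- How often row `r` has been chosen below rank `u`. -/
def rowCount {n m : ℕ} (w : Fin n → Fin m) (u : ℕ) (r : Fin m) : ℕ :=
  #{p : Fin n | (p : ℕ) < u ∧ w p = r}

/-- The part of the definition of a similarity block that does not involve similarity:
the distinct rows `R 0, …, R (t - 1)` have been chosen equally often at rank `u₀`, and the
covering relations after rank `u₀` choose `R 0` for `s` times, then `R 1` for `s` times, and so
on, up to `R (t - 1)`. -/
def IsBlock {n m : ℕ} (w : Fin n → Fin m) (u₀ s : ℕ) {t : ℕ} (R : Fin t ↪ Fin m) : Prop :=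
  (∀ i j, rowCount w u₀ (R i) = rowCount w u₀ (R j)) ∧
  ∀ i : Fin t, ∀ j < s, ∃ h : u₀ + i * s + j < n, w ⟨u₀ + i * s + j, h⟩ = R i

/-- The rows in `K` are similar at rank `u`: each choice of a row of `K` below rank `u` is part of
a similarity block whose rows include all of `K`. A similarity block is a block whose rows are
similar at its starting rank `u₀`; it may continue beyond rank `u`. -/
def Similar {n m : ℕ} (w : Fin n → Fin m) (u : ℕ) (K : Finset (Fin m)) : Prop :=
  ∀ p : Fin n, (p : ℕ) < u → w p ∈ K →
    ∃ (u₀ : Fin (p + 1)) (s t : ℕ) (R : Fin t ↪ Fin m),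
      (p : ℕ) < u₀ + t * s ∧ K ⊆ univ.map R ∧ IsBlock w u₀ s R ∧ Similar w u₀ (univ.map R)
termination_by u
decreasing_by omega

/-! ### The evolving row order and the descents -/

/-- Row `x` is currently similar to the row `R`, and the two have been chosen equally often (so
that `x` is not one of the rows that precede `R` in a current similarity block). -/
def Tied {n m : ℕ} (w : Fin n → Fin m) (u : ℕ) (R x : Fin m) : Prop :=
  Similar w u {R, x} ∧ rowCount w u x = rowCount w u R

open Classical in
/-- Move the row `R` to the place in front of the first of the rows that are tied with it
(`R` stays if none of these is in front of it). -/
noncomputable def moveFront {n m : ℕ} (w : Fin n → Fin m) (u : ℕ) (R : Fin m)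
    (L : List (Fin m)) : List (Fin m) :=
  L.takeWhile (fun x => ¬ (x = R ∨ Tied w u R x)) ++
    R :: (L.dropWhile (fun x => ¬ (x = R ∨ Tied w u R x))).erase R

/-- The row order at each rank, written in one-line notation, when the order `init` evolves by
moving each inserted row in front of the rows tied with it. -/
noncomputable def evolve {n m : ℕ} (w : Fin n → Fin m) (init : List (Fin m)) :
    ℕ → List (Fin m)
  | 0 => init
  | u + 1 => if h : u < n then moveFront w u (w ⟨u, h⟩) (evolve w init u) else evolve w init u

/-- The eventual row order, for the evolution that starts at the identity. -/
noncomputable def finalOrder {n m : ℕ} (w : Fin n → Fin m) : List (Fin m) :=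
  evolve w (List.finRange m) n

/-- The renormalized place of row `j` at rank `u`: its place in the row order at rank `u`, when the
evolution wraps around, that is, starts from the eventual row order. -/
noncomputable def rho {n m : ℕ} (w : Fin n → Fin m) (u : ℕ) (j : Fin m) : ℕ :=
  (evolve w (finalOrder w) u).idxOf j

/-- Rank `u + 1` is a descent in the relative transpose order: the label `(i₁, ρ j₁)` of the
covering relation from rank `u` to `u + 1` exceeds the label `(i₂, ρ j₂)` of the next one
lexicographically, where `i` counts how often the row has been chosen, including the current
choice, and `ρ` is taken at rank `u` for both labels. -/
def IsDescent {n m : ℕ} (w : Fin n → Fin m) (u : ℕ) (h : u + 1 < n) : Prop :=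
  let j₁ := w ⟨u, by omega⟩
  let j₂ := w ⟨u + 1, h⟩
  let i₁ := rowCount w (u + 1) j₁
  let i₂ := rowCount w (u + 2) j₂
  i₂ < i₁ ∨ (i₁ = i₂ ∧ rho w u j₂ < rho w u j₁)

open Classical in
/-- The set of ranks at which a word has a descent. -/
noncomputable def descentRanks {n m : ℕ} (w : Fin n → Fin m) : Finset ℕ :=
  {k ∈ Finset.range n | ∃ (u : ℕ) (h : u + 1 < n), k = u + 1 ∧ IsDescent w u h}

/-- A word is in standard form if a new row is always the earliest row not yet chosen. -/
def IsStandard {n m : ℕ} (w : Fin n → Fin m) : Prop :=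
  ∀ p, ∀ r < w p, ∃ q < p, w q = r

/-! ### Saturated chains and the assignment of minimal faces -/

/-- The element of rank `k` in the saturated chain which inserts the table entries in the order
`e 0, e 1, …`. -/
def level {l m : ℕ} (e : Fin (l * m) ≃ Fin m × Fin l) (k : ℕ) : Subsets l m :=
  univ.filter fun x => (e.symm x : ℕ) < k

theorem card_level {l m : ℕ} (e : Fin (l * m) ≃ Fin m × Fin l) {k : ℕ} (hk : k ≤ l * m) :
    #(level e k) = k := by
  have : level e k = (univ.filter fun p : Fin (l * m) => (p : ℕ) < k).map e.toEmbedding := by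
    ext x
    simp [level]
  rw [this, card_map, Fin.card_filter_val_lt]
  omega

/-- The face of `Δ(B_{lm})` consisting of the proper elements of this saturated chain whose ranks
lie in `S`. -/
def chainFace {l m : ℕ} (e : Fin (l * m) ≃ Fin m × Fin l) (S : Finset ℕ) : Face l m where
  elems := {k ∈ S | 0 < k ∧ k < l * m}.image (level e)
  chain := by
    intro x hx y hy _
    simp only [coe_image, Set.mem_image] at hx hy
    obtain ⟨a, _, rfl⟩ := hx
    obtain ⟨b, _, rfl⟩ := hy
    rcases le_total a b with h | h
    · exact Or.inl fun z hz => by simp only [level, mem_filter_univ] at hz ⊢; omega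
    · exact Or.inr fun z hz => by simp only [level, mem_filter_univ] at hz ⊢; omega
  bot_notMem := by
    intro h
    obtain ⟨k, hk, hk'⟩ := mem_image.1 h
    rw [mem_filter] at hk
    have := card_level e hk.2.2.le
    rw [hk', card_empty] at this
    omega
  top_notMem := by
    intro h
    obtain ⟨k, hk, hk'⟩ := mem_image.1 h
    rw [mem_filter] at hk
    have := card_level e hk.2.2.le
    rw [hk', card_univ, Fintype.card_prod, Fintype.card_fin, Fintype.card_fin, mul_comm] at this
    omega

/-- `G` is the minimal face assigned to the facet `F`: for a saturated chain which represents `F`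
and whose rows are numbered in standard form, `G` is the face of `F` that consists of the ranks
of the descents. -/
def IsMinimalFace {l m : ℕ} (F G : QFace l m) : Prop :=
  ∃ e : Fin (l * m) ≃ Fin m × Fin l,
    IsStandard (fun p => (e p).1) ∧
    F = (chainFace e (Finset.range (l * m))).orbit ∧
    G = (chainFace e (descentRanks fun p => (e p).1)).orbit

end WreathComplex

/-! Up to a renumbering of the rows, the orbit of a chain is determined by the row counts at its
ranks. So the theorem amounts to this: given a set `S` of ranks and the row counts of some chain at
these ranks, there is, up to a permutation of the rows, exactly one word with these counts whose
descents all lie in `S` (`exists_word`, `exists_perm_of_descentRanks_subset`).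

Between consecutive ranks of `S` the labels must increase weakly. Hence the choices fall into phases
that are determined by the counts alone: a phase collects the rows that are chosen for the `i`-th
time, for one `i`, between the same two ranks of `S`. Having no descent inside a phase means that
its rows are listed in the order at its start (`isSorted_of_desc`, `IsSorted.mem_of_desc`). For a
fixed initial order there is exactly one such word. The difficulty is the wrap-around, which asks
that the initial order be the one the word itself produces. As every row is chosen at some point,
the final order does not depend on the initial one (`evL_init`), so the problem is to find the
orders that the evolution along their sorted word returns to themselves: fixed points.

The relation "similar and equally often chosen" is recast as the inductive relation `Tie`. It is
transitive because blocks that end together are nested and blocks that share an end letter can be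
glued (`Tie.trans`).

Letters that have occurred in the same phases (`SameVec`) ought to be interchangeable. Accordingly,
two sorted words with the same phases should have the same ties at each phase start, and orders that
differ only within classes of such letters. Blocks with segments of length one carry over from one
word to the other. Longer segments carry over unless the first letter of the block was one of
several interchangeable letters of its phase; this obstruction is a `Pattern`. A pattern separates
its letters for good: they are never tied again, and the letter that went last in its phase stays in
front of the other (`Separates.bef`). So it does harm only if the initial order says the opposite,
and without such a conflict (`NoBad`) the comparison holds (`agree_of_noBad`).

In a fixed point there is no conflict, since the order at the end is the order at the beginning
(`noBad_of_fixed`). Restarting from the final order removes the conflicts of at least one more phase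
(`NoBad.succ_of_evL`), so finitely many rounds lead to a fixed point (`exists_isSorted_fixed`). Two
fixed points agree outside the classes, so the order-preserving bijection between them preserves all
phases and carries one word to the other (`exists_equiv_of_fixed`). -/

set_option linter.unusedSectionVars false

namespace WreathComplex

variable {α : Type*}

/-! ### Counting letters in infinite words -/

open Classical in
/-- The number of occurrences of the letter `r` before position `u`. -/
noncomputable def cnt (w : ℕ → α) (u : ℕ) (r : α) : ℕ := Nat.count (fun p => w p = r) u

theorem cnt_zero (w : ℕ → α) (r : α) : cnt w 0 r = 0 := by simp [cnt]

theorem cnt_succ_self (w : ℕ → α) (u : ℕ) : cnt w (u + 1) (w u) = cnt w u (w u) + 1 := by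
  simp [cnt, Nat.count_succ]

theorem cnt_succ_ne {w : ℕ → α} {u : ℕ} {r : α} (h : w u ≠ r) : cnt w (u + 1) r = cnt w u r := by
  simp [cnt, Nat.count_succ, h]

theorem cnt_mono (w : ℕ → α) {u u' : ℕ} (h : u ≤ u') (r : α) : cnt w u r ≤ cnt w u' r := by
  classical
  unfold cnt
  convert Nat.count_monotone (fun p => w p = r) h

theorem cnt_untouched {w : ℕ → α} {u u' : ℕ} {r : α} (h : u ≤ u')
    (hw : ∀ p, u ≤ p → p < u' → w p ≠ r) : cnt w u' r = cnt w u r := by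
  induction u', h using Nat.le_induction with
  | base => rfl
  | succ k hk ih =>
    rw [cnt_succ_ne (hw k hk k.lt_succ_self), ih fun p h1 h2 => hw p h1 (h2.trans k.lt_succ_self)]

theorem cnt_run {w : ℕ → α} {u s : ℕ} {r : α} (hw : ∀ p, u ≤ p → p < u + s → w p = r) :
    cnt w (u + s) r = cnt w u r + s := by
  induction s with
  | zero => rfl
  | succ k ih =>
    have h1 := hw (u + k) (by omega) (by omega)
    have h2 := cnt_succ_self w (u + k)
    rw [h1] at h2
    rw [← add_assoc, h2, ih fun p h1 h2 => hw p h1 (by omega), add_assoc]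

theorem cnt_lt_of_mem {w : ℕ → α} {u u' p : ℕ} {r : α} (h1 : u ≤ p) (h2 : p < u') (h : w p = r) :
    cnt w u r < cnt w u' r := by
  subst h
  have := cnt_succ_self w p
  have := cnt_mono w h1 (w p)
  have := cnt_mono w (Nat.succ_le_of_lt h2) (w p)
  simp only [Nat.succ_eq_add_one] at this
  omega

/-! ### Blocks -/

/-- From position `v` on, the word consists of `s` copies of each of the distinct letters
`R 0, …, R (t - 1)`, in this order. -/
structure Blk (w : ℕ → α) (v s t : ℕ) (R : ℕ → α) : Prop where
  pos : 0 < s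
  apply : ∀ i < t, ∀ j < s, w (v + i * s + j) = R i
  inj : ∀ i < t, ∀ j < t, R i = R j → i = j

namespace Blk

variable {w : ℕ → α} {v s t : ℕ} {R : ℕ → α}

theorem exists_seg (_ : Blk w v s t R) {p : ℕ} (h1 : v ≤ p) (h2 : p < v + t * s) :
    ∃ i < t, v + i * s ≤ p ∧ p < v + i * s + s := by
  obtain ⟨k, rfl⟩ := Nat.exists_eq_add_of_le h1
  have hs : 0 < s := Nat.pos_of_ne_zero (by rintro rfl; simp at h2)
  refine ⟨k / s, (Nat.div_lt_iff_lt_mul hs).2 (by omega), ?_, ?_⟩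
  · have := Nat.div_mul_le_self k s
    omega
  · have := Nat.lt_div_mul_add (a := k) hs
    omega

theorem seg (h : Blk w v s t R) {i p : ℕ} (hi : i < t) (h1 : v + i * s ≤ p)
    (h2 : p < v + i * s + s) : w p = R i := by
  obtain ⟨k, rfl⟩ := Nat.exists_eq_add_of_le h1
  exact h.apply i hi k (by omega)

theorem mul_le {i t s : ℕ} (h : i < t) : i * s + s ≤ t * s := by
  rw [← Nat.succ_mul]
  exact Nat.mul_le_mul_right s h

theorem exists_letter (h : Blk w v s t R) {p : ℕ} (h1 : v ≤ p) (h2 : p < v + t * s) :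
    ∃ i < t, w p = R i := by
  obtain ⟨i, hi, h3, h4⟩ := h.exists_seg h1 h2
  exact ⟨i, hi, h.seg hi h3 h4⟩

theorem pos_of_letter (h : Blk w v s t R) {p i : ℕ} (h1 : v ≤ p) (h2 : p < v + t * s)
    (hi : i < t) (hp : w p = R i) : v + i * s ≤ p ∧ p < v + i * s + s := by
  obtain ⟨j, hj, h3, h4⟩ := h.exists_seg h1 h2
  rw [h.inj i hi j hj (hp ▸ h.seg hj h3 h4)]
  exact ⟨h3, h4⟩

theorem ne_of_forall_ne (h : Blk w v s t R) {z : α} (hz : ∀ i < t, R i ≠ z) {p : ℕ} (h1 : v ≤ p)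
    (h2 : p < v + t * s) : w p ≠ z := by
  obtain ⟨i, hi, h3⟩ := h.exists_letter h1 h2
  exact h3 ▸ hz i hi

theorem ne_before (h : Blk w v s t R) {i p : ℕ} (hi : i < t) (h1 : v ≤ p) (h2 : p < v + i * s) :
    w p ≠ R i := fun hp => by
  have := mul_le (s := s) hi
  have := h.pos_of_letter h1 (by omega) hi hp
  omega

theorem ne_after (h : Blk w v s t R) {i p : ℕ} (hi : i < t) (h1 : v + i * s + s ≤ p)
    (h2 : p < v + t * s) : w p ≠ R i := fun hp => by
  have := h.pos_of_letter (by omega) h2 hi hp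
  omega

theorem take (h : Blk w v s t R) {k : ℕ} (hk : k ≤ t) : Blk w v s k R :=
  ⟨h.pos, fun i hi => h.apply i (hi.trans_le hk),
    fun i hi j hj => h.inj i (hi.trans_le hk) j (hj.trans_le hk)⟩

theorem drop (h : Blk w v s t R) (k : ℕ) :
    Blk w (v + k * s) s (t - k) fun i => R (k + i) := by
  refine ⟨h.pos, fun i hi j hj => ?_, fun i hi j hj e => ?_⟩
  · rw [← h.apply (k + i) (by omega) j hj, Nat.add_mul, add_assoc v]
  · have := h.inj _ (by omega) _ (by omega) e
    omega

theorem cnt_end (h : Blk w v s t R) {i : ℕ} (hi : i < t) :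
    cnt w (v + t * s) (R i) = cnt w v (R i) + s := by
  have := mul_le (s := s) hi
  rw [cnt_untouched (u := v + i * s + s) (by omega) fun p h1 h2 => h.ne_after hi h1 h2,
    cnt_run fun p h1 h2 => h.seg hi h1 h2,
    cnt_untouched (u := v) (by omega) fun p h1 h2 => h.ne_before hi h1 h2]

theorem cnt_seg (h : Blk w v s t R) {i k : ℕ} (hi : i < t) (hk : k ≤ t) :
    cnt w (v + k * s) (R i) = cnt w v (R i) + if i < k then s else 0 := by
  split_ifs with hik
  · exact (h.take hk).cnt_end hik
  · refine cnt_untouched (by omega) fun p h1 h2 => h.ne_before hi h1 (h2.trans_le ?_)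
    have := Nat.mul_le_mul_right s (not_lt.1 hik)
    omega

theorem congr {w' : ℕ → α} (h : Blk w v s t R) (hw : ∀ p < v + t * s, w p = w' p) :
    Blk w' v s t R := by
  refine ⟨h.pos, fun i hi j hj => ?_, h.inj⟩
  have := mul_le (s := s) hi
  rw [← hw _ (by omega), h.apply i hi j hj]

end Blk

/-! ### Ties -/

/-- Two letters are tied at rank `u` if they have been chosen equally often, and each stretch in
which their numbers differ belongs to a block of mutually tied letters. -/
inductive Tie (w : ℕ → α) : ℕ → α → α → Prop
  | refl (u : ℕ) (x : α) : Tie w u x x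
  | zero (x y : α) : Tie w 0 x y
  | step {u : ℕ} {x y : α} (hx : w u ≠ x) (hy : w u ≠ y) (h : Tie w u x y) : Tie w (u + 1) x y
  | block {v s t u i j : ℕ} {R : ℕ → α} (hb : Blk w v s t R)
      (h : ∀ i < t, ∀ j < t, Tie w v (R i) (R j)) (hu : u = v + t * s) (hi : i < t) (hj : j < t) :
      Tie w u (R i) (R j)

/-- A block of mutually tied letters. -/
structure TBlk (w : ℕ → α) (v s t : ℕ) (R : ℕ → α) : Prop extends Blk w v s t R where
  tie : ∀ i < t, ∀ j < t, Tie w v (R i) (R j)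

theorem TBlk.tie_end {w : ℕ → α} {v s t : ℕ} {R : ℕ → α} (h : TBlk w v s t R) {i j : ℕ}
    (hi : i < t) (hj : j < t) : Tie w (v + t * s) (R i) (R j) :=
  Tie.block h.toBlk h.tie rfl hi hj

namespace Tie

variable {w : ℕ → α} {u : ℕ} {x y z : α}

theorem symm (h : Tie w u x y) : Tie w u y x := by
  induction h with
  | refl u x => exact refl u x
  | zero x y => exact zero y x
  | step hx hy _ ih => exact step hy hx ih
  | block hb _ hu hi hj ih => exact block hb (fun i hi j hj => ih j hj i hi) hu hj hi

theorem cnt_eq (h : Tie w u x y) : cnt w u x = cnt w u y := by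
  induction h with
  | refl u x => rfl
  | zero x y => simp [cnt_zero]
  | step hx hy _ ih => rw [cnt_succ_ne hx, cnt_succ_ne hy, ih]
  | @block v s t u i j R hb _ hu hi hj ih =>
    rw [hu, hb.cnt_end hi, hb.cnt_end hj, ih i hi j hj]

theorem of_untouched {u' : ℕ} (huu : u ≤ u') (hx : ∀ p, u ≤ p → p < u' → w p ≠ x)
    (hy : ∀ p, u ≤ p → p < u' → w p ≠ y) (h : Tie w u x y) : Tie w u' x y := by
  induction u', huu using Nat.le_induction with
  | base => exact h
  | succ k hk ih =>
    exact step (hx k hk k.lt_succ_self) (hy k hk k.lt_succ_self)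
      (ih (fun p h1 h2 => hx p h1 (by omega)) fun p h1 h2 => hy p h1 (by omega))

/-- Only the block clause needs an argument. The letter at `u` is the last letter of the block, so
`x` and `y` are earlier ones. Without its last segment the block still ties them, and they are
untouched from then on. -/
theorem of_succ (hx : w u ≠ x) (hy : w u ≠ y) (h : Tie w (u + 1) x y) : Tie w u x y := by
  generalize hu' : u + 1 = u' at h
  cases h with
  | refl => exact refl _ _
  | zero => omega
  | step _ _ h => cases hu'; exact h
  | @block v s t _ i j R hb h hu hi hj =>
    obtain ⟨t, rfl⟩ : ∃ k, t = k + 1 := ⟨t - 1, by omega⟩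
    have hs := hb.pos
    rw [Nat.succ_mul] at hu
    have hw : ∀ p, v + t * s ≤ p → p < u + 1 → w p = R t := fun p h1 h2 =>
      hb.seg t.lt_succ_self h1 (by omega)
    have hlast := hw u (by omega) (by omega)
    have key : ∀ i < t + 1, w u ≠ R i → i < t := fun i hi hne => by
      by_contra hc
      exact hne (by rw [hlast, show i = t by omega])
    have hi' := key i hi hx
    have hj' := key j hj hy
    refine of_untouched (u := v + t * s) (by omega) ?_ ?_
      (block (hb.take t.le_succ) (fun i hi j hj => h i (by omega) j (by omega)) rfl hi' hj')
    · intro p h1 h2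
      rw [hw p h1 (by omega), ← hlast]
      exact hx
    · intro p h1 h2
      rw [hw p h1 (by omega), ← hlast]
      exact hy

theorem to_untouched {u' : ℕ} (huu : u ≤ u') (hx : ∀ p, u ≤ p → p < u' → w p ≠ x)
    (hy : ∀ p, u ≤ p → p < u' → w p ≠ y) (h : Tie w u' x y) : Tie w u x y := by
  induction u', huu using Nat.le_induction with
  | base => exact h
  | succ k hk ih =>
    exact ih (fun p h1 h2 => hx p h1 (by omega)) (fun p h1 h2 => hy p h1 (by omega))
      (of_succ (hx k hk k.lt_succ_self) (hy k hk k.lt_succ_self) h)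

end Tie

/-! ### Blocks of mutually tied letters -/

namespace TBlk

variable {w : ℕ → α} {v s t : ℕ} {R : ℕ → α}

theorem take (h : TBlk w v s t R) {k : ℕ} (hk : k ≤ t) : TBlk w v s k R :=
  ⟨h.toBlk.take hk, fun i hi j hj => h.tie i (hi.trans_le hk) j (hj.trans_le hk)⟩

theorem tie_mid (h : TBlk w v s t R) {i j k : ℕ} (hi : i < t) (hj : j < t) (hk : k ≤ i)
    (hk' : k ≤ j) : Tie w (v + k * s) (R i) (R j) := by
  have h1 := Nat.mul_le_mul_right s hk
  have h2 := Nat.mul_le_mul_right s hk'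
  exact Tie.of_untouched (u := v) (by omega)
    (fun p hp1 hp2 => h.ne_before hi hp1 (by omega))
    (fun p hp1 hp2 => h.ne_before hj hp1 (by omega)) (h.tie i hi j hj)

theorem drop (h : TBlk w v s t R) (k : ℕ) :
    TBlk w (v + k * s) s (t - k) fun i => R (k + i) :=
  ⟨h.toBlk.drop k, fun i hi j hj => h.tie_mid (by omega) (by omega) (by omega) (by omega)⟩

/-- The last segment of a block is preceded by a letter whose number exceeds that of the last
letter by the length of the segment. -/
theorem last_seg (h : TBlk w v s t R) (ht : 2 ≤ t) :
    1 ≤ v + (t - 1) * s ∧ w (v + (t - 1) * s - 1) ≠ R (t - 1) ∧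
    cnt w (v + (t - 1) * s) (w (v + (t - 1) * s - 1)) =
      cnt w (v + (t - 1) * s) (R (t - 1)) + s := by
  obtain ⟨t, rfl⟩ : ∃ k, t = k + 2 := ⟨t - 2, by omega⟩
  have hs := h.pos
  have e : t + 2 - 1 = t + 1 := rfl
  rw [e]
  have e2 : (t + 1) * s = t * s + s := Nat.succ_mul _ _
  have hw : w (v + (t + 1) * s - 1) = R t := h.seg (by omega) (by omega) (by omega)
  refine ⟨by omega, ?_, ?_⟩
  · rw [hw]
    intro e
    have := h.inj _ (by omega) _ (by omega) e
    omega
  · rw [hw, h.cnt_seg (by omega) (by omega), h.cnt_seg (by omega) (by omega),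
      (h.tie t (by omega) (t + 1) (by omega)).cnt_eq]
    simp

theorem last_run (h : TBlk w v s t R) (ht : 1 ≤ t) {p : ℕ} (h1 : v + (t - 1) * s ≤ p)
    (h2 : p < v + t * s) : w p = R (t - 1) := by
  obtain ⟨t, rfl⟩ : ∃ k, t = k + 1 := ⟨t - 1, by omega⟩
  rw [Nat.succ_mul] at h2
  exact h.seg (by omega) h1 (by simp only [Nat.add_sub_cancel]; omega)

/-- A run of a letter contains the end of at most one block with this last letter. -/
theorem end_unique {v' s' t' : ℕ} {R' : ℕ → α} (h : TBlk w v s t R) (h' : TBlk w v' s' t' R')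
    (ht : 2 ≤ t) (ht' : 2 ≤ t') (hR : R (t - 1) = R' (t' - 1))
    (hle : v + t * s ≤ v' + t' * s')
    (hw : ∀ p, v + t * s ≤ p → p < v' + t' * s' → w p = R (t - 1)) :
    s = s' ∧ v + t * s = v' + t' * s' := by
  obtain ⟨a1, a2, a3⟩ := h.last_seg ht
  obtain ⟨b1, b2, b3⟩ := h'.last_seg ht'
  have r1 : ∀ p, v + (t - 1) * s ≤ p → p < v' + t' * s' → w p = R (t - 1) := fun p h1 h2 => by
    rcases lt_or_ge p (v + t * s) with h3 | h3
    · exact h.last_run (by omega) h1 h3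
    · exact hw p h3 h2
  have r2 : ∀ p, v' + (t' - 1) * s' ≤ p → p < v' + t' * s' → w p = R (t - 1) := fun p h1 h2 =>
    hR ▸ h'.last_run (by omega) h1 h2
  have e1 : (t - 1) * s + s = t * s := by
    rw [← Nat.succ_mul]; congr 1; omega
  have e2 : (t' - 1) * s' + s' = t' * s' := by
    rw [← Nat.succ_mul]; congr 1; omega
  have hs := h.pos
  have hs' := h'.pos
  -- Each last segment is preceded by a different letter, so both begin where the run begins. The
  -- excess of that preceding letter is then both `s` and `s'`.
  have hb : v + (t - 1) * s = v' + (t' - 1) * s' := by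
    rcases lt_trichotomy (v + (t - 1) * s) (v' + (t' - 1) * s') with h3 | h3 | h3
    · exact absurd (hR ▸ r1 _ (by omega) (by omega)) b2
    · exact h3
    · exact absurd (r2 _ (by omega) (by omega)) a2
  rw [hb, hR] at a3
  omega

end TBlk

/-! ### Transitivity of ties -/

namespace Tie

variable {w : ℕ → α} {u : ℕ} {x y z : α}

/-- Letters that are tied right after one of them was chosen are the first and last letters of
a block. -/
theorem exists_block (hxy : x ≠ y) (hy : w u = y) (h : Tie w (u + 1) x y) :
    ∃ v s t R, TBlk w v s t R ∧ 2 ≤ t ∧ u + 1 = v + t * s ∧ R 0 = x ∧ R (t - 1) = y := by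
  generalize hu' : u + 1 = u' at h
  cases h with
  | refl => exact absurd rfl hxy
  | zero => omega
  | step _ h _ => cases hu'; exact absurd hy h
  | @block v s t _ i j R hb h hu hi hj =>
    have hT : TBlk w v s t R := ⟨hb, h⟩
    have hs := hb.pos
    have e1 : (t - 1) * s + s = t * s := by
      rw [← Nat.succ_mul]; congr 1; omega
    have hj' : j = t - 1 := by
      refine hb.inj j hj (t - 1) (by omega) ?_
      rw [← hy]
      exact hT.last_run (by omega) (by omega) (by omega)
    subst hj'
    have hij : i < t - 1 := by
      rcases Nat.lt_or_ge i (t - 1) with h | h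
      · exact h
      · exact absurd (by rw [show i = t - 1 by omega]) hxy
    refine ⟨_, s, t - i, _, hT.drop i, by omega, ?_, by simp, ?_⟩
    · have : i * s + (t - i) * s = t * s := by rw [← Nat.add_mul]; congr 1; omega
      omega
    · congr 1
      omega

/-- If `z` is outside the block, its tie with `R 0` goes back to the end of the first segment and
comes from a block `Q` from `z` to `R 0` that ends there. Glued along the letter `R 0`, the blocks
`Q` and `R` form one block from `z` to `R (t - 1)`. -/
theorem trans_of_block {v s t : ℕ} {R : ℕ → α} (ih : ∀ u' < u + 1, ∀ x y z,
      Tie w u' x y → Tie w u' y z → Tie w u' x z)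
    (hb : TBlk w v s t R) (ht : 2 ≤ t) (hu : u + 1 = v + t * s) (hz : Tie w (u + 1) (R 0) z)
    (hzu : w u ≠ z) : Tie w (u + 1) (R (t - 1)) z := by
  have hs := hb.pos
  by_cases hzR : ∃ i < t, R i = z
  · obtain ⟨i, hi, rfl⟩ := hzR
    exact hu ▸ hb.tie_end (by omega) hi
  push Not at hzR
  have e1 : v + s ≤ u + 1 := by
    have := Blk.mul_le (s := s) (show 0 < t by omega); omega
  have hmid : Tie w (v + s) (R 0) z := by
    refine to_untouched e1 (fun p h1 h2 => ?_) (fun p h1 h2 => ?_) hz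
    · exact hb.ne_after (by omega) (by omega) (by omega)
    · exact hb.ne_of_forall_ne hzR (by omega) (by omega)
  have hy : w (v + s - 1) = R 0 := hb.seg (i := 0) (by omega) (by omega) (by omega)
  obtain ⟨v1, s1, t1, Q, hQ, ht1, he1, hQ0, hQ1⟩ :=
    exists_block (u := v + s - 1) (fun e => hzR 0 (by omega) e.symm) hy
      (by rw [Nat.sub_add_cancel (by omega)]; exact hmid.symm)
  rw [Nat.sub_add_cancel (by omega)] at he1
  have hlen : (t1 - 1) * s1 + s1 = t1 * s1 := by
    rw [← Nat.succ_mul]; congr 1; omega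
  obtain ⟨a1, a2, a3⟩ := hQ.last_seg ht1
  -- the two runs of the common letter have equal lengths
  have hss : s1 = s := by
    rcases lt_trichotomy s1 s with h | h | h
    · refine absurd ?_ a2
      rw [hQ1]
      exact hb.seg (i := 0) (by omega) (by omega) (by omega)
    · exact h
    -- The run of `R 0` starts before `v`. Its tie with `R (t - 1)` at `v` then gives a block ending
    -- at `v`, in the same run as the end of `Q`.
    · exfalso
      have hyv : w (v - 1) = R 0 := hQ1 ▸ hQ.last_run (by omega) (by omega) (by omega)
      have hv1 : 1 ≤ v := by omega
      have hne : R (t - 1) ≠ R 0 := fun e => by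
        have := hb.inj _ (by omega) _ (by omega) e
        omega
      obtain ⟨v2, s2, t2, P, hP, ht2, he2, hP0, hP1⟩ := exists_block (u := v - 1) hne hyv
        (by rw [Nat.sub_add_cancel hv1]; exact hb.tie _ (by omega) _ (by omega))
      rw [Nat.sub_add_cancel hv1] at he2
      have := hP.end_unique hQ ht2 ht1 (by rw [hP1, hQ1]) (by omega) fun p h1 h2 => by
        rw [hP1]
        exact hb.seg (i := 0) (by omega) (by omega) (by omega)
      omega
  subst hss
  have hv : v = v1 + (t1 - 1) * s1 := by omega
  -- At `v` the earlier letters of `Q` are one segment ahead of `R 0`, while the letters of `R` are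
  -- level with it.
  have hcQ : ∀ i < t1 - 1, ∀ j < t, Q i ≠ R j := fun i hi j hj e => by
    have c1 := hQ.cnt_seg (i := i) (k := t1 - 1) (by omega) (by omega)
    have c2 := hQ.cnt_seg (i := t1 - 1) (k := t1 - 1) (by omega) (by omega)
    rw [if_pos hi, ← hv] at c1
    rw [if_neg (lt_irrefl _), ← hv, hQ1] at c2
    have c3 := (hb.tie j hj 0 (by omega)).cnt_eq
    have c4 := (hQ.tie i (by omega) (t1 - 1) (by omega)).cnt_eq
    rw [hQ1] at c4
    rw [← e] at c3
    omega
  have htie : ∀ j < t, ∀ i < t1, Tie w v1 (R j) (Q i) := fun j hj i hi => by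
    refine ih v1 (by omega) _ (R 0) _ ?_ (hQ1 ▸ hQ.tie (t1 - 1) (by omega) i hi)
    refine to_untouched (u' := v) (by omega) (fun p h1 h2 => ?_) (fun p h1 h2 => ?_)
      (hb.tie j hj 0 (by omega))
    all_goals
      obtain ⟨k, hk, h3⟩ := (hQ.take (Nat.sub_le t1 1)).exists_letter h1 (by omega)
      rw [h3]
      exact hcQ k hk _ (by omega)
  refine hu ▸ ?_
  -- The glued block; the shared letter `R 0` is listed once, as part of `R`.
  let P : ℕ → α := fun i => if i < t1 - 1 then Q i else R (i - (t1 - 1))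
  have hPQ : ∀ i < t1, P i = Q i := fun i hi => by
    by_cases h : i < t1 - 1
    · simp [P, h]
    · simp only [P, h, if_false]
      rw [show i = t1 - 1 by omega, hQ1, Nat.sub_self]
  have hPcase : ∀ i < t1 - 1 + t, (i < t1 - 1 ∧ P i = Q i) ∨
      ∃ j < t, i = t1 - 1 + j ∧ P i = R j := fun i hi => by
    by_cases h : i < t1 - 1
    · exact Or.inl ⟨h, by simp [P, h]⟩
    · exact Or.inr ⟨i - (t1 - 1), by omega, by omega, by simp [P, h]⟩
  have hP : TBlk w v1 s1 (t1 - 1 + t) P := by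
    refine ⟨⟨hs, fun i hi j hj => ?_, fun i hi j hj e => ?_⟩, fun i hi j hj => ?_⟩
    · rcases hPcase i hi with ⟨h1, h2⟩ | ⟨k, hk, rfl, h2⟩
      · rw [h2, hQ.apply i (by omega) j hj]
      · rw [h2, ← hb.apply k hk j hj, hv, Nat.add_mul]
        congr 1
        omega
    · rcases hPcase i hi with ⟨h1, h2⟩ | ⟨k, hk, rfl, h2⟩ <;>
      rcases hPcase j hj with ⟨h3, h4⟩ | ⟨k', hk', rfl, h4⟩ <;> rw [h2, h4] at e
      · exact hQ.inj _ (by omega) _ (by omega) e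
      · exact absurd e (hcQ _ h1 _ hk')
      · exact absurd e.symm (hcQ _ h3 _ hk)
      · rw [hb.inj _ hk _ hk' e]
    · rcases hPcase i hi with ⟨h1, h2⟩ | ⟨k, hk, rfl, h2⟩ <;>
      rcases hPcase j hj with ⟨h3, h4⟩ | ⟨k', hk', rfl, h4⟩ <;> rw [h2, h4]
      · exact hQ.tie _ (by omega) _ (by omega)
      · exact (htie _ hk' _ (by omega)).symm
      · exact htie _ hk _ (by omega)
      · exact ih v1 (by omega) _ _ _ (htie k hk 0 (by omega)) (htie k' hk' 0 (by omega)).symm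
  have hend := hP.tie_end (i := t1 - 1 + (t - 1)) (j := 0) (by omega) (by omega)
  rw [hPQ 0 (by omega), hQ0] at hend
  have hlast : P (t1 - 1 + (t - 1)) = R (t - 1) := by simp [P]
  rw [hlast] at hend
  have : v1 + (t1 - 1 + t) * s1 = v + t * s1 := by rw [Nat.add_mul]; omega
  rwa [this] at hend

/-- By induction on the rank, according to which letter was chosen last. For an outer letter this is
`trans_of_block`. For the middle letter, two blocks end with it at the same place, so they have the
same segment length and one contains the other. -/
theorem trans (h1 : Tie w u x y) (h2 : Tie w u y z) : Tie w u x z := by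
  induction u using Nat.strong_induction_on generalizing x y z with
  | _ u ih =>
  by_cases hxy : x = y
  · exact hxy ▸ h2
  by_cases hyz : y = z
  · exact hyz ▸ h1
  by_cases hxz : x = z
  · exact hxz ▸ refl _ _
  rcases u with _ | u
  · exact zero _ _
  have ih' : ∀ u' < u + 1, ∀ x y z, Tie w u' x y → Tie w u' y z → Tie w u' x z :=
    fun u' h x y z h1 h2 => ih u' h h1 h2
  by_cases hx : w u = x
  · obtain ⟨v, s, t, R, hb, ht, hu, rfl, h4⟩ := exists_block (Ne.symm hxy) hx h1.symm
    have := trans_of_block ih' hb ht hu h2 (hx ▸ hxz)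
    rwa [h4] at this
  by_cases hz : w u = z
  · obtain ⟨v, s, t, R, hb, ht, hu, rfl, h4⟩ := exists_block hyz hz h2
    have := trans_of_block ih' hb ht hu h1.symm (hz ▸ Ne.symm hxz)
    rw [h4] at this
    exact this.symm
  by_cases hy : w u = y
  · obtain ⟨v, s, t, R, hb, ht, hu, h3, h4⟩ := exists_block hxy hy h1
    obtain ⟨v', s', t', R', hb', ht', hu', h3', h4'⟩ := exists_block (Ne.symm hyz) hy h2.symm
    obtain ⟨rfl, -⟩ := hb.end_unique hb' ht ht' (by rw [h4, h4']) (by omega) (by omega)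
    have hs := hb.pos
    -- the longer one of the two blocks contains all three letters
    have key : ∀ {v t v' t' : ℕ} {R R' : ℕ → α}, TBlk w v s t R → 2 ≤ t' → Blk w v' s t' R' →
        t' ≤ t → v + t * s = v' + t' * s → R' 0 = R (t - t') := by
      intro v t v' t' R R' hb ht' hb' hle he
      have h1 := hb.apply (t - t') (by omega) 0 hs
      have h2 := hb'.apply 0 (by omega) 0 hs
      have : (t - t') * s + t' * s = t * s := by rw [← Nat.add_mul]; congr 1; omega
      rw [← h1, ← h2]
      congr 1
      omega
    rcases le_total t' t with hle | hle
    · have e := key hb ht' hb'.toBlk hle (by omega)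
      rw [hu, ← h3, ← h3', e]
      exact hb.tie_end (by omega) (by omega)
    · have e := key hb' ht hb.toBlk hle (by omega)
      rw [hu', ← h3, ← h3', e]
      exact hb'.tie_end (by omega) (by omega)
  · exact step hx hz (ih u u.lt_succ_self (of_succ hx hy h1) (of_succ hy hz h2))

theorem congr {w' : ℕ → α} (hw : ∀ p < u, w p = w' p) (h : Tie w u x y) : Tie w' u x y := by
  induction h with
  | refl u x => exact refl u x
  | zero x y => exact zero x y
  | @step u x y hx hy _ ih =>
    exact step (hw u (by omega) ▸ hx) (hw u (by omega) ▸ hy) (ih fun p hp => hw p (by omega))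
  | @block v s t u i j R hb _ hu hi hj ih =>
    exact block (hb.congr fun p hp => hw p (by omega))
      (fun i hi j hj => ih i hi j hj fun p hp => hw p (by omega)) hu hi hj

theorem map {β : Type*} {f : α → β} (hf : Function.Injective f) (h : Tie w u x y) :
    Tie (fun p => f (w p)) u (f x) (f y) := by
  induction h with
  | refl u x => exact refl _ _
  | zero x y => exact zero _ _
  | step hx hy _ ih => exact step (hf.ne hx) (hf.ne hy) ih
  | @block v s t u i j R hb _ hu hi hj ih =>
    exact block (R := fun i => f (R i)) ⟨hb.pos, fun i hi j hj => congrArg f (hb.apply i hi j hj),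
      fun i hi j hj e => hb.inj i hi j hj (hf e)⟩ ih hu hi hj

end Tie

end WreathComplex

namespace WreathComplex

variable {α : Type*}

/-! ### Ties and row similarity -/

theorem exists_last {P : ℕ → Prop} {u p : ℕ} (hp : p < u) (hP : P p) :
    ∃ q < u, P q ∧ ∀ k, q < k → k < u → ¬ P k := by
  classical
  refine ⟨Nat.findGreatest P (u - 1), ?_, Nat.findGreatest_spec (m := p) (by omega) hP,
    fun k h1 h2 => Nat.findGreatest_is_greatest h1 (by omega)⟩
  have := Nat.findGreatest_le (P := P) (u - 1)
  omega

section

variable {n m : ℕ} {w : Fin n → Fin m} {e : ℕ → Fin m}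

theorem rowCount_eq_cnt (he : ∀ p : Fin n, e p = w p) {u : ℕ} (hu : u ≤ n) (r : Fin m) :
    rowCount w u r = cnt e u r := by
  classical
  have : cnt e u r = #{p ∈ range u | e p = r} := by
    unfold cnt
    convert Nat.count_eq_card_filter_range (fun p => e p = r) u
  rw [this, rowCount]
  refine card_bij (fun p _ => (p : ℕ)) (fun p hp => ?_) (fun p _ q _ h => Fin.ext h)
    fun p hp => ?_
  · simp only [mem_filter, mem_univ, true_and, mem_range] at hp ⊢
    exact ⟨hp.1, (he p).trans hp.2⟩
  · simp only [mem_filter, mem_range] at hp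
    exact ⟨⟨p, by omega⟩, by simpa using ⟨hp.1, (he ⟨p, by omega⟩) ▸ hp.2⟩, rfl⟩

theorem IsBlock.blk (he : ∀ p : Fin n, e p = w p) {v s t : ℕ} {R : Fin t ↪ Fin m}
    (h : IsBlock w v s R) (hs : 0 < s) {R' : ℕ → Fin m} (hR : ∀ i : Fin t, R' i = R i) :
    Blk e v s t R' := by
  refine ⟨hs, fun i hi j hj => ?_, fun i hi j hj hij => ?_⟩
  · obtain ⟨h1, h2⟩ := h.2 ⟨i, hi⟩ j hj
    rw [hR ⟨i, hi⟩, ← h2, ← he]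
  · rw [hR ⟨i, hi⟩, hR ⟨j, hj⟩] at hij
    exact congrArg Fin.val (R.injective hij)

theorem Blk.isBlock (he : ∀ p : Fin n, e p = w p) {v s t : ℕ} {R : ℕ → Fin m}
    (h : TBlk e v s t R) (hn : v + t * s ≤ n) :
    IsBlock w v s ⟨fun i : Fin t => R i,
      fun i j hij => Fin.ext (h.inj i i.2 j j.2 hij)⟩ := by
  refine ⟨fun i j => ?_, fun i j hj => ?_⟩
  · rw [rowCount_eq_cnt he (by omega), rowCount_eq_cnt he (by omega)]
    exact (h.tie i i.2 j j.2).cnt_eq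
  · have := Blk.mul_le (s := s) i.2
    refine ⟨by omega, ?_⟩
    rw [← he]
    exact h.apply i i.2 j hj

/-- Consider the last choice of one of the two letters, say of `y`, and its similarity block. Equal
counts force `x` to precede `y` in the block and the segment of `y` to be complete, so the block cut
off after `y` ties them. -/
theorem Tie.of_similar (he : ∀ p : Fin n, e p = w p) {u : ℕ} (hu : u ≤ n) {K : Finset (Fin m)}
    (h : Similar w u K) (hc : ∀ x ∈ K, ∀ y ∈ K, cnt e u x = cnt e u y) :
    ∀ x ∈ K, ∀ y ∈ K, Tie e u x y := by
  induction u using Nat.strong_induction_on generalizing K with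
  | _ u ih =>
  have key : ∀ x ∈ K, ∀ y ∈ K, x ≠ y → ∀ p < u, e p = y →
      (∀ k, p < k → k < u → ¬ (e k = x ∨ e k = y)) → Tie e u x y := by
    intro x hx y hy hxy p hp hpy hlast
    rw [Similar] at h
    obtain ⟨u₀, s, t, R, h1, h2, h3, h4⟩ := h ⟨p, by omega⟩ hp (by rw [← he, hpy]; exact hy)
    have hu₀ := u₀.2
    generalize (u₀ : ℕ) = v at *
    simp only at h1 hu₀
    have hs : 0 < s := Nat.pos_of_ne_zero (by rintro rfl; omega)
    have ht : 0 < t := Nat.pos_of_ne_zero (by rintro rfl; omega)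
    let R' : ℕ → Fin m := fun i => if h : i < t then R ⟨i, h⟩ else R ⟨0, ht⟩
    have hR : ∀ i : Fin t, R' i = R i := fun i => by simp [R']
    have hb := h3.blk he hs hR
    have hvn : v ≤ n := by omega
    have htie := ih v (by omega) hvn h4 (by
      intro x hx y hy
      obtain ⟨i, -, rfl⟩ := mem_map.1 hx
      obtain ⟨j, -, rfl⟩ := mem_map.1 hy
      rw [← rowCount_eq_cnt he hvn, ← rowCount_eq_cnt he hvn]
      exact h3.1 i j)
    have hT : TBlk e v s t R' := ⟨hb, fun i hi j hj => by
      rw [hR ⟨i, hi⟩, hR ⟨j, hj⟩]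
      exact htie _ (mem_map_of_mem _ (mem_univ _)) _ (mem_map_of_mem _ (mem_univ _))⟩
    obtain ⟨i, -, hi⟩ := mem_map.1 (h2 hx)
    obtain ⟨j, -, hj⟩ := mem_map.1 (h2 hy)
    replace hi : R' i = x := (hR i).trans hi
    replace hj : R' j = y := (hR j).trans hj
    have hcc := hc x hx y hy
    have c1 : ∀ z, z = x ∨ z = y → cnt e u z = cnt e (p + 1) z := fun z hz =>
      cnt_untouched hp fun k h1 h2 hk => hlast k h1 h2 (by rcases hz with rfl | rfl <;> simp [hk])
    rw [c1 x (Or.inl rfl), c1 y (Or.inr rfl)] at hcc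
    obtain ⟨p1, p2⟩ := hb.pos_of_letter (by omega) h1 j.2 (hpy.trans hj.symm)
    have hij : (i : ℕ) ≠ j := fun hij => hxy (by rw [← hi, ← hj, hij])
    have cy : cnt e (p + 1) y = cnt e v y + (p + 1 - (v + j * s)) := by
      have : p + 1 = v + j * s + (p + 1 - (v + j * s)) := by omega
      rw [this, cnt_run (fun q h1 h2 => hj ▸ hb.seg j.2 h1 (by omega)), ← hj, hb.cnt_seg j.2 j.2.le]
      simp
    have cx : cnt e (p + 1) x = cnt e v x + if (i : ℕ) < j then s else 0 := by
      rw [← hi, ← hb.cnt_seg i.2 j.2.le]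
      refine cnt_untouched (by omega) fun q h1 h2 => ?_
      rw [hb.seg j.2 h1 (by omega)]
      intro e'
      exact hij (hb.inj _ i.2 _ j.2 e'.symm)
    have cv := (hT.tie i i.2 j j.2).cnt_eq
    rw [hi, hj] at cv
    have hlt : (i : ℕ) < j := by
      by_contra hc
      rw [if_neg hc] at cx
      omega
    rw [if_pos hlt] at cx
    have hend := (hT.take (k := j + 1) j.2).tie_end (i := i) (j := j) (by omega) (by omega)
    rw [hi, hj] at hend
    -- Equal counts: `y` has caught up with the `s` copies of `x`, so `p` is the end of its segment.
    have e1 : v + (j + 1 : ℕ) * s = p + 1 := by rw [Nat.succ_mul]; omega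
    rw [e1] at hend
    exact hend.of_untouched (by omega) (fun k h1 h2 hk => hlast k h1 h2 (Or.inl hk))
      (fun k h1 h2 hk => hlast k h1 h2 (Or.inr hk))
  intro x hx y hy
  by_cases hxy : x = y
  · exact hxy ▸ Tie.refl _ _
  by_cases hex : ∃ p < u, e p = x ∨ e p = y
  · obtain ⟨p, hp, hP⟩ := hex
    obtain ⟨q, hq, hQ, hlast⟩ := exists_last (P := fun p => e p = x ∨ e p = y) hp hP
    rcases hQ with hQ | hQ
    · exact (key y hy x hx (Ne.symm hxy) q hq hQ fun k h1 h2 h3 => hlast k h1 h2 h3.symm).symm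
    · exact key x hx y hy hxy q hq hQ hlast
  · push Not at hex
    exact (Tie.zero x y).of_untouched (Nat.zero_le u) (fun p _ hp => (hex p hp).1)
      fun p _ hp => (hex p hp).2

/-- After the last choice of a letter of `K`, its ties with the others come from blocks that end
there. They have the same segment length, so the longest contains all of `K`. -/
theorem Tie.similar (he : ∀ p : Fin n, e p = w p) {u : ℕ} (hu : u ≤ n) {K : Finset (Fin m)}
    (h : ∀ x ∈ K, ∀ y ∈ K, Tie e u x y) : Similar w u K := by
  induction u using Nat.strong_induction_on generalizing K with
  | _ u ih =>
  rw [Similar]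
  intro p hp hpK
  -- A single row has no partner to supply a block; one choice is a block by itself.
  by_cases hK : K = {w p}
  · refine ⟨⟨p, by omega⟩, 1, 1, ⟨fun _ => w p, fun i j _ => Subsingleton.elim i j⟩, by simp,
      fun z hz => mem_map.2 ⟨0, mem_univ _, ((mem_singleton.1 (hK ▸ hz) : z = w p)).symm⟩,
      ⟨fun i j => rfl, fun i j hj => ?_⟩, ih p hp p.2.le ?_⟩
    · obtain rfl : i = 0 := Subsingleton.elim _ _
      obtain rfl : j = 0 := by omega
      exact ⟨by simp, by simp; rfl⟩
    · intro x hx y hy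
      simp only [univ_unique, map_singleton, mem_singleton] at hx hy
      rw [hx, hy]
      exact Tie.refl _ _
  obtain ⟨q, hq, hQ, hlast⟩ := exists_last (P := fun p => e p ∈ K) hp (by rw [he]; exact hpK)
  have hpq : (p : ℕ) ≤ q := by
    by_contra hc
    exact hlast p (by omega) hp (by rw [he]; exact hpK)
  have hne : (K.erase (e q)).Nonempty := by
    rw [nonempty_iff_ne_empty, Ne, erase_eq_empty_iff, not_or]
    refine ⟨ne_empty_of_mem hQ, fun h => hK ?_⟩
    rw [h] at hpK ⊢
    rw [mem_singleton.1 hpK]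
  have hblk : ∀ y ∈ K.erase (e q), ∃ v s t R, TBlk e v s t R ∧ 2 ≤ t ∧ q + 1 = v + t * s ∧
      R 0 = y ∧ R (t - 1) = e q := fun y hy => by
    obtain ⟨h1, h2⟩ := mem_erase.1 hy
    refine Tie.exists_block h1 rfl (Tie.to_untouched (u' := u) (by omega) ?_ ?_ (h y h2 _ hQ))
    · exact fun k h3 h4 h5 => hlast k (by omega) h4 (h5 ▸ h2)
    · exact fun k h3 h4 h5 => hlast k (by omega) h4 (h5 ▸ hQ)
  choose! v s t R hT ht hend h0 hl using hblk
  obtain ⟨y, hy, hmax⟩ := exists_max_image _ t hne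
  have hcover : ∀ z ∈ K, ∃ i < t y, R y i = z := by
    intro z hz
    by_cases hzq : z = e q
    · exact ⟨t y - 1, by have := ht y hy; omega, by rw [hl y hy, hzq]⟩
    have hz' := mem_erase.2 ⟨hzq, hz⟩
    refine ⟨t y - t z, by have := ht z hz'; have := ht y hy; omega, ?_⟩
    have h1 := hmax z hz'
    have h2 := ht z hz'
    have h3 := hend z hz'
    have h4 := hend y hy
    obtain ⟨h5, -⟩ := (hT z hz').end_unique (hT y hy) h2 (ht y hy)
      (by rw [hl z hz', hl y hy]) (by omega) (by omega)
    have hs := (hT y hy).pos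
    have h6 := (hT y hy).apply (t y - t z) (by omega) 0 hs
    have h7 := (hT z hz').apply 0 (by omega) 0 (by omega)
    refine h6.symm.trans (Eq.trans ?_ (h7.trans (h0 z hz')))
    congr 1
    have : (t y - t z) * s y + t z * s z = t y * s y := by
      rw [h5, ← Nat.add_mul]; congr 1; omega
    omega
  have htie := (hT y hy).tie
  have hb := Blk.isBlock he (hT y hy) (by rw [← hend y hy]; omega)
  have hpos : 0 < t y * s y := Nat.mul_pos (by have := ht y hy; omega) (hT y hy).pos
  have hvq := hend y hy
  set E : Fin (t y) ↪ Fin m := ⟨fun i : Fin (t y) => R y i,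
      fun i j hij => Fin.ext ((hT y hy).inj i i.2 j j.2 hij)⟩ with hE
  have hKE : K ⊆ univ.map E := fun z hz => by
    obtain ⟨i, hi, hiz⟩ := hcover z hz
    exact mem_map.2 ⟨⟨i, hi⟩, mem_univ _, hiz⟩
  have hsim : Similar w (v y) (univ.map E) := by
    refine ih _ (by omega) (by omega) ?_
    intro a ha b hb
    obtain ⟨i, -, rfl⟩ := mem_map.1 ha
    obtain ⟨j, -, rfl⟩ := mem_map.1 hb
    exact htie i i.2 j j.2
  -- Choices before the block are covered by the similarity of its rows at its start, as these rows
  -- include `K`.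
  rcases Nat.lt_or_ge p (v y) with hlt | hge
  · have hsim' := hsim
    rw [Similar] at hsim'
    obtain ⟨u₀, s', t', R', g1, g2, g3, g4⟩ := hsim' p hlt (hKE hpK)
    exact ⟨u₀, s', t', R', g1, hKE.trans g2, g3, g4⟩
  · exact ⟨⟨v y, by omega⟩, s y, t y, E, by simp only; omega, hKE, hb, hsim⟩

theorem tied_iff_tie (he : ∀ p : Fin n, e p = w p) {u : ℕ} (hu : u ≤ n) {R x : Fin m} :
    Tied w u R x ↔ Tie e u R x := by
  rw [Tied, rowCount_eq_cnt he hu, rowCount_eq_cnt he hu]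
  constructor
  · rintro ⟨h1, h2⟩
    refine Tie.of_similar he hu h1 ?_ R (by simp) x (by simp)
    simp only [mem_insert, mem_singleton]
    rintro a (rfl | rfl) b (rfl | rfl) <;> simp [h2]
  · intro h
    refine ⟨Tie.similar he hu ?_, h.cnt_eq.symm⟩
    simp only [mem_insert, mem_singleton]
    rintro a (rfl | rfl) b (rfl | rfl)
    exacts [Tie.refl _ _, h, h.symm, Tie.refl _ _]

end

end WreathComplex

namespace WreathComplex

variable {α : Type*} [DecidableEq α]

/-! ### Moving an element of a list forward -/

open Classical in
/-- Move `R` in front of the first element of the list that satisfies `P`. -/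
noncomputable def mv (P : α → Prop) (R : α) (L : List α) : List α :=
  L.takeWhile (fun x => ¬ P x) ++ R :: (L.dropWhile (fun x => ¬ P x)).erase R

/-- The list contains each element of the type exactly once. -/
structure IsOrd (L : List α) : Prop where
  nodup : L.Nodup
  mem : ∀ x, x ∈ L

section mv

variable {P : α → Prop} {R : α} {L : List α}

/-- As `R` satisfies `P` itself, the first such element is `R` or in front of `R`; `B` is the
stretch that `R` jumps over. -/
theorem mv_decomp (hR : R ∈ L) (hP : P R) : ∃ A B C, L = A ++ (B ++ R :: C) ∧
    mv P R L = A ++ R :: (B ++ C) ∧ (∀ x ∈ A, ¬ P x) ∧ (B = [] ∨ ∃ b B', P b ∧ B = b :: B') := by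
  classical
  have hA : ∀ x ∈ L.takeWhile (fun x => ¬ P x), ¬ P x := fun x hx => by
    simpa using List.mem_takeWhile_imp hx
  have hsplit := List.takeWhile_append_dropWhile (p := fun x => decide (¬ P x)) (l := L)
  have hRd : R ∈ L.dropWhile (fun x => ¬ P x) := by
    rw [← hsplit, List.mem_append] at hR
    exact hR.resolve_left fun h => hA R h hP
  obtain ⟨B, C, hB, hBC, hE⟩ := List.exists_erase_eq hRd
  refine ⟨_, B, C, by rw [← hBC, hsplit], ?_, hA, ?_⟩
  · rw [mv, ← hE]
  · rcases B with _ | ⟨b, B'⟩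
    · exact Or.inl rfl
    · have := List.head?_dropWhile_not (fun x => decide (¬ P x)) L
      rw [hBC] at this
      exact Or.inr ⟨b, B', by simpa using this, rfl⟩

theorem mv_perm (hR : R ∈ L) (hP : P R) : (mv P R L).Perm L := by
  obtain ⟨A, B, C, rfl, hm, -, -⟩ := mv_decomp hR hP
  rw [hm]
  exact List.Perm.append_left _ List.perm_middle.symm

theorem IsOrd.mv (hL : IsOrd L) (hP : P R) : IsOrd (mv P R L) :=
  ⟨(mv_perm (hL.mem R) hP).nodup_iff.2 hL.nodup,
    fun x => (mv_perm (hL.mem R) hP).mem_iff.2 (hL.mem x)⟩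

/-- Place bookkeeping: `A` and `C` stay, `R` jumps over `B`, and `B` shifts by one. -/
theorem mv_loc {A B C : List α} (hL : (A ++ (B ++ R :: C)).Nodup) (z : α)
    (hz : z ∈ A ++ (B ++ R :: C)) :
    (z ∈ A ∧ ∃ k < A.length, (A ++ (B ++ R :: C)).idxOf z = k ∧
      (A ++ R :: (B ++ C)).idxOf z = k) ∨
    (z = R ∧ (A ++ (B ++ R :: C)).idxOf z = A.length + B.length ∧
      (A ++ R :: (B ++ C)).idxOf z = A.length) ∨
    (z ≠ R ∧ ∃ k < B.length, (A ++ (B ++ R :: C)).idxOf z = A.length + k ∧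
      (A ++ R :: (B ++ C)).idxOf z = A.length + 1 + k) ∨
    (z ≠ R ∧ ∃ k, (A ++ (B ++ R :: C)).idxOf z = A.length + B.length + 1 + k ∧
      (A ++ R :: (B ++ C)).idxOf z = A.length + B.length + 1 + k) := by
  by_cases hA : z ∈ A
  · exact Or.inl ⟨hA, _, List.idxOf_lt_length_of_mem hA, List.idxOf_append_of_mem hA,
      List.idxOf_append_of_mem hA⟩
  right
  rw [List.idxOf_append_of_notMem hA, List.idxOf_append_of_notMem hA]
  have hL2 := (List.nodup_append.1 hL).2.1
  have hRB : R ∉ B := fun h => (List.nodup_append.1 hL2).2.2 R h R (by simp) rfl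
  by_cases hzR : z = R
  · subst hzR
    left
    rw [List.idxOf_append_of_notMem hRB, List.idxOf_cons_self, List.idxOf_cons_self]
    exact ⟨rfl, rfl, rfl⟩
  right
  have hne : R ≠ z := fun h => hzR h.symm
  rw [List.idxOf_cons_ne _ hne]
  by_cases hB : z ∈ B
  · left
    rw [List.idxOf_append_of_mem hB, List.idxOf_append_of_mem hB]
    exact ⟨hzR, _, List.idxOf_lt_length_of_mem hB, rfl, by omega⟩
  · right
    rw [List.idxOf_append_of_notMem hB, List.idxOf_append_of_notMem hB, List.idxOf_cons_ne _ hne]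
    exact ⟨hzR, C.idxOf z, by omega, by omega⟩

theorem mv_idxOf_lt_of_ne (hL : IsOrd L) (hP : P R) {x y : α} (hx : x ≠ R) (hy : y ≠ R) :
    (mv P R L).idxOf x < (mv P R L).idxOf y ↔ L.idxOf x < L.idxOf y := by
  obtain ⟨A, B, C, rfl, hm, -, -⟩ := mv_decomp (hL.mem R) hP
  rw [hm]
  rcases mv_loc hL.nodup x (hL.mem x) with ⟨-, k, h1, h2, h3⟩ | ⟨h, -⟩ | ⟨-, k, h1, h2, h3⟩ |
    ⟨-, k, h2, h3⟩ <;>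
  rcases mv_loc hL.nodup y (hL.mem y) with ⟨-, k', g1, g2, g3⟩ | ⟨g, -⟩ | ⟨-, k', g1, g2, g3⟩ |
    ⟨-, k', g2, g3⟩ <;>
  first | exact absurd h hx | exact absurd g hy | omega

theorem mv_idxOf_lt_self (hL : IsOrd L) (hP : P R) {y : α} (hy : y ≠ R) :
    (mv P R L).idxOf R < (mv P R L).idxOf y ↔ ∃ z, P z ∧ L.idxOf z ≤ L.idxOf y := by
  obtain ⟨A, B, C, rfl, hm, hA, hB⟩ := mv_decomp (hL.mem R) hP
  rw [hm]
  have hRi : (A ++ (B ++ R :: C)).idxOf R = A.length + B.length ∧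
      (A ++ R :: (B ++ C)).idxOf R = A.length := by
    rcases mv_loc hL.nodup R (hL.mem R) with ⟨h, -⟩ | ⟨-, h⟩ | ⟨h, -⟩ | ⟨h, -⟩
    · exact absurd hP (hA R h)
    · exact h
    · exact absurd rfl h
    · exact absurd rfl h
  have hfirst : ∃ z, P z ∧ (A ++ (B ++ R :: C)).idxOf z = A.length := by
    rcases hB with rfl | ⟨b, B', hb, rfl⟩
    · exact ⟨R, hP, by simpa using hRi.1⟩
    · refine ⟨b, hb, ?_⟩
      rw [List.idxOf_append_of_notMem fun h => hA b h hb]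
      simp
  constructor
  · intro h
    obtain ⟨z, hz, hz'⟩ := hfirst
    refine ⟨z, hz, ?_⟩
    rcases mv_loc hL.nodup y (hL.mem y) with ⟨-, k', g1, g2, g3⟩ | ⟨g, -⟩ | ⟨-, k', g1, g2, g3⟩ |
      ⟨-, k', g2, g3⟩ <;> first | exact absurd g hy | omega
  · rintro ⟨z, hz, hz'⟩
    have : A.length ≤ (A ++ (B ++ R :: C)).idxOf z := by
      rw [List.idxOf_append_of_notMem fun h => hA z h hz]
      omega
    rcases mv_loc hL.nodup y (hL.mem y) with ⟨-, k', g1, g2, g3⟩ | ⟨g, -⟩ | ⟨-, k', g1, g2, g3⟩ |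
      ⟨-, k', g2, g3⟩ <;> first | exact absurd g hy | omega

theorem mv_map {β : Type*} [DecidableEq β] {f : α → β} (hf : Function.Injective f) {Q : β → Prop}
    (hQ : ∀ x, Q (f x) ↔ P x) : mv Q (f R) (L.map f) = (mv P R L).map f := by
  classical
  unfold mv
  rw [List.takeWhile_map, List.dropWhile_map, List.map_append, List.map_cons, List.map_erase hf]
  congr! 3
  · funext x
    simp [hQ]
  · congr 2
    funext x
    simp [hQ]

end mv

/-! ### The evolving order -/

/-- The order at rank `u`, when it starts with `I` and each chosen letter is moved in front of the
letters tied with it. -/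
noncomputable def evL (w : ℕ → α) (I : List α) : ℕ → List α
  | 0 => I
  | u + 1 => mv (Tie w u (w u)) (w u) (evL w I u)

theorem evL_isOrd (w : ℕ → α) {I : List α} (hI : IsOrd I) (u : ℕ) : IsOrd (evL w I u) := by
  induction u with
  | zero => exact hI
  | succ u ih => exact ih.mv (Tie.refl _ _)

/-- The letter `x` precedes `y` in the order at rank `u`. -/
def Bef (w : ℕ → α) (I : List α) (u : ℕ) (x y : α) : Prop :=
  (evL w I u).idxOf x < (evL w I u).idxOf y

namespace Bef

variable {w : ℕ → α} {I : List α} {u : ℕ} {x y z : α}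

theorem irrefl (w : ℕ → α) (I : List α) (u : ℕ) (x : α) : ¬ Bef w I u x x := lt_irrefl _

theorem ne (h : Bef w I u x y) : x ≠ y := by
  rintro rfl
  exact irrefl _ _ _ _ h

theorem trans (h : Bef w I u x y) (h' : Bef w I u y z) : Bef w I u x z := lt_trans h h'

theorem asymm (h : Bef w I u x y) : ¬ Bef w I u y x := lt_asymm h

theorem total (w : ℕ → α) (hI : IsOrd I) (u : ℕ) (h : x ≠ y) : Bef w I u x y ∨ Bef w I u y x :=
  lt_or_gt_of_ne fun e => h ((List.idxOf_inj ((evL_isOrd w hI u).mem x)).1 e)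

theorem not_iff (w : ℕ → α) (hI : IsOrd I) (u : ℕ) (h : x ≠ y) :
    ¬ Bef w I u x y ↔ Bef w I u y x :=
  ⟨fun h' => (total w hI u h).resolve_left h', asymm⟩

theorem succ_of_ne (hI : IsOrd I) (hx : w u ≠ x) (hy : w u ≠ y) :
    Bef w I (u + 1) x y ↔ Bef w I u x y :=
  mv_idxOf_lt_of_ne (evL_isOrd w hI u) (Tie.refl _ _) hx.symm hy.symm

/-- The letter `x` takes the place of the first letter tied with it, possibly itself, so what
matters is whether that place is at or before the place of `y`. -/
theorem succ_self (hI : IsOrd I) (hx : w u = x) (hy : x ≠ y) :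
    Bef w I (u + 1) x y ↔ ∃ z, Tie w u x z ∧ (z = y ∨ Bef w I u z y) := by
  subst hx
  have hL := evL_isOrd w hI u
  refine (mv_idxOf_lt_self hL (Tie.refl _ _) hy.symm).trans (exists_congr fun z =>
    and_congr_right fun _ => ?_)
  rw [Nat.le_iff_lt_or_eq, or_comm, List.idxOf_inj (hL.mem z)]
  rfl

theorem succ_self' (hI : IsOrd I) (hx : w u = x) (hy : x ≠ y) :
    Bef w I (u + 1) y x ↔ ∀ z, Tie w u x z → Bef w I u y z := by
  rw [← not_iff w hI _ hy, succ_self hI hx hy]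
  push Not
  refine forall_congr' fun z => imp_congr_right fun _ => ⟨fun ⟨h1, h2⟩ => ?_, fun h => ?_⟩
  · exact (not_iff w hI u h1).1 h2
  · exact ⟨h.ne.symm, h.asymm⟩

theorem untouched (hI : IsOrd I) {u' : ℕ} (huu : u ≤ u') (hx : ∀ p, u ≤ p → p < u' → w p ≠ x)
    (hy : ∀ p, u ≤ p → p < u' → w p ≠ y) : Bef w I u' x y ↔ Bef w I u x y := by
  induction u', huu using Nat.le_induction with
  | base => rfl
  | succ k hk ih =>
    rw [succ_of_ne hI (hx k hk k.lt_succ_self) (hy k hk k.lt_succ_self),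
      ih (fun p h1 h2 => hx p h1 (by omega)) fun p h1 h2 => hy p h1 (by omega)]

end Bef

theorem IsOrd.ext {L L' : List α} (hL : IsOrd L) (hL' : IsOrd L')
    (h : ∀ x y, L.idxOf x < L.idxOf y → L'.idxOf x < L'.idxOf y) : L = L' := by
  have hp : ∀ {L : List α}, IsOrd L → L.Pairwise fun x y => L.idxOf x < L.idxOf y := by
    intro L hL
    rw [List.pairwise_iff_getElem]
    intro i j hi hj hij
    rwa [hL.nodup.idxOf_getElem, hL.nodup.idxOf_getElem]
  refine List.Perm.eq_of_pairwise (fun a b _ _ h1 h2 => absurd h1 (lt_asymm h2))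
    ((hp hL).imp (h _ _)) (hp hL') ?_
  rw [List.perm_ext_iff_of_nodup hL.nodup hL'.nodup]
  exact fun a => ⟨fun _ => hL'.mem a, fun _ => hL.mem a⟩

theorem evL_congr {w w' : ℕ → α} {u : ℕ} (h : ∀ p < u, w p = w' p) (I : List α) :
    evL w I u = evL w' I u := by
  induction u with
  | zero => rfl
  | succ u ih =>
    have h' : ∀ p < u, w p = w' p := fun p hp => h p (by omega)
    have : Tie w u (w u) = Tie w' u (w u) := by
      funext x
      exact propext ⟨Tie.congr h', Tie.congr fun p hp => (h' p hp).symm⟩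
    rw [evL, evL, ih h', ← h u (by omega), this]

theorem evL_map {β : Type*} [DecidableEq β] (f : α ≃ β) (w : ℕ → α) (I : List α) (u : ℕ) :
    evL (fun p => f (w p)) (I.map f) u = (evL w I u).map f := by
  induction u with
  | zero => rfl
  | succ u ih =>
    rw [evL, evL, ih]
    refine mv_map f.injective fun x => ⟨fun h => ?_, Tie.map f.injective⟩
    simpa using Tie.map f.symm.injective h

/-- The relative order of letters at least one of which has been chosen does not depend on the
initial order, and the letters that have been chosen precede the others. -/
theorem bef_init_aux {w : ℕ → α} {I J : List α} (hI : IsOrd I) (hJ : IsOrd J) (u : ℕ) :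
    (∀ x y, 0 < cnt w u x → 0 < cnt w u y → (Bef w I u x y ↔ Bef w J u x y)) ∧
    ∀ x y, 0 < cnt w u x → cnt w u y = 0 → Bef w I u x y ∧ Bef w J u x y := by
  have hfresh : ∀ {w : ℕ → α} {u : ℕ} {x y : α}, cnt w u x = 0 → cnt w u y = 0 →
      Tie w u x y := fun {w u x y} hx hy => by
    refine (Tie.zero x y).of_untouched (Nat.zero_le u) (fun p _ h2 h3 => ?_) fun p _ h2 h3 => ?_
    · have := cnt_lt_of_mem (Nat.zero_le p) h2 h3
      omega
    · have := cnt_lt_of_mem (Nat.zero_le p) h2 h3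
      omega
  induction u with
  | zero => simp [cnt_zero]
  | succ u ih =>
    obtain ⟨ih1, ih2⟩ := ih
    have main : ∀ y, w u ≠ y → 0 < cnt w u y →
        (Bef w I (u + 1) (w u) y ↔ Bef w J (u + 1) (w u) y) := fun y hy hcy => by
      rw [Bef.succ_self hI rfl hy, Bef.succ_self hJ rfl hy]
      refine exists_congr fun z => and_congr_right fun hz => ?_
      -- A tied letter not yet chosen is behind `y` in both orders and so plays no role.
      rcases Nat.eq_zero_or_pos (cnt w u z) with hcz | hcz
      · obtain ⟨h1, h2⟩ := ih2 y z hcy hcz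
        have hne : z ≠ y := h1.ne.symm
        simp [hne, h1.asymm, h2.asymm]
      · rw [ih1 z y hcz hcy]
    refine ⟨fun x y hx hy => ?_, fun x y hx hy => ?_⟩
    · by_cases hxy : x = y
      · subst hxy
        simp [Bef.irrefl]
      by_cases hux : w u = x
      · subst hux
        exact main y hxy (by rwa [cnt_succ_ne hxy] at hy)
      by_cases huy : w u = y
      · subst huy
        have := main x hux (by rwa [cnt_succ_ne hux] at hx)
        rw [← Bef.not_iff w hI _ hux, ← Bef.not_iff w hJ _ hux, this]
      · rw [cnt_succ_ne hux] at hx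
        rw [cnt_succ_ne huy] at hy
        rw [Bef.succ_of_ne hI hux huy, Bef.succ_of_ne hJ hux huy, ih1 x y hx hy]
    · have huy : w u ≠ y := by
        rintro rfl
        rw [cnt_succ_self] at hy
        omega
      rw [cnt_succ_ne huy] at hy
      by_cases hux : w u = x
      · subst hux
        rw [Bef.succ_self hI rfl huy, Bef.succ_self hJ rfl huy]
        rcases Nat.eq_zero_or_pos (cnt w u (w u)) with hc | hc
        · exact ⟨⟨y, hfresh hc hy, Or.inl rfl⟩, ⟨y, hfresh hc hy, Or.inl rfl⟩⟩
        · obtain ⟨h1, h2⟩ := ih2 _ y hc hy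
          exact ⟨⟨w u, Tie.refl _ _, Or.inr h1⟩, ⟨w u, Tie.refl _ _, Or.inr h2⟩⟩
      · rw [cnt_succ_ne hux] at hx
        rw [Bef.succ_of_ne hI hux huy, Bef.succ_of_ne hJ hux huy]
        exact ih2 x y hx hy

/-- This turns the wrap-around condition into a fixed-point condition: once all letters have been
chosen, the final order may be computed from any initial order. -/
theorem evL_init {w : ℕ → α} {I J : List α} (hI : IsOrd I) (hJ : IsOrd J) {u : ℕ}
    (h : ∀ x, 0 < cnt w u x) : evL w I u = evL w J u :=
  (evL_isOrd w hI u).ext (evL_isOrd w hJ u) fun x y =>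
    ((bef_init_aux hI hJ u).1 x y (h x) (h y)).1

theorem evolve_eq_evL {n m : ℕ} {w : Fin n → Fin m} {e : ℕ → Fin m}
    (he : ∀ p : Fin n, e p = w p) (I : List (Fin m)) {u : ℕ} (hu : u ≤ n) :
    evolve w I u = evL e I u := by
  induction u with
  | zero => rfl
  | succ u ih =>
    have hu' : u < n := hu
    rw [evolve, dif_pos hu', ih hu'.le, evL, ← he ⟨u, hu'⟩]
    have : Tie e u (e u) = fun x => x = e u ∨ Tied w u (e u) x := by
      funext x
      rw [tied_iff_tie he hu'.le]
      exact propext ⟨Or.inr, by rintro (rfl | h); exacts [Tie.refl _ _, h]⟩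
    rw [this]
    unfold moveFront mv
    congr!

end WreathComplex

namespace WreathComplex

variable {α : Type*} [DecidableEq α]

/-! ### Separated letters keep their relative order -/

/-- At rank `u₀` the letters `a` and `a'` are tied. The word continues with `q ≥ 1` copies of `a`
and more than `q` copies of another letter `b`, which has been chosen one time less than `a`
before. As a consequence `a` and `a'` are never tied again. -/
structure Separates (w : ℕ → α) (u₀ q : ℕ) (a a' b : α) : Prop where
  tie : Tie w u₀ a a'
  ne : a ≠ a'
  pos : 1 ≤ q
  run : ∀ p, u₀ ≤ p → p < u₀ + q → w p = a
  run' : ∀ p, u₀ + q ≤ p → p < u₀ + 2 * q + 1 → w p = b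
  ne_left : b ≠ a
  ne_right : b ≠ a'
  cnt_add_one : cnt w u₀ b + 1 = cnt w u₀ a

namespace Separates

variable {w : ℕ → α} {u₀ q : ℕ} {a a' b : α} (h : Separates w u₀ q a a' b)
include h

/-- Consider the block behind the first new tie. It cannot start after `u₀`, since its letters are
tied at its start. If it starts at or before `u₀`, the tie at `u₀` excludes `a` as last letter and
puts the start at `u₀` otherwise; then the `q` copies of `a` fix the segment length, and the run of
`b` is too long for a segment. -/
theorem not_tie {u : ℕ} (hu : u₀ < u) : ¬ Tie w u a a' := by
  induction u using Nat.strong_induction_on with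
  | _ u ih =>
  intro ht
  obtain ⟨p, hp, hP, hlast⟩ := exists_last (P := fun p => w p = a ∨ w p = a') hu
    (Or.inl (h.run u₀ le_rfl (by have := h.pos; omega)))
  have hpos := h.pos
  have hup : u₀ ≤ p := by
    by_contra hc
    exact hlast u₀ (by omega) hu (Or.inl (h.run u₀ le_rfl (by omega)))
  have ht' : Tie w (p + 1) a a' := ht.to_untouched hp
    (fun k h1 h2 h3 => hlast k h1 h2 (Or.inl h3)) fun k h1 h2 h3 => hlast k h1 h2 (Or.inr h3)
  have hc0 := h.tie.cnt_eq
  rcases hP with hP | hP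
  · obtain ⟨v, s, t, R, hb, h2t, he, hR0, hR1⟩ := Tie.exists_block h.ne.symm hP ht'.symm
    have hs := hb.pos
    have e1 : (t - 1) * s + s = t * s := by
      rw [← Nat.succ_mul]; congr 1; omega
    have htv := hb.tie (t - 1) (by omega) 0 (by omega)
    rw [hR0, hR1] at htv
    rcases lt_or_ge u₀ v with hv | hv
    · have : 2 * s ≤ t * s := Nat.mul_le_mul_right s h2t
      exact ih v (by omega) hv htv
    obtain ⟨p1, p2⟩ := hb.pos_of_letter (p := u₀) (i := t - 1) hv (by omega) (by omega)
      (by rw [hR1]; exact h.run u₀ le_rfl (by omega))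
    have c1 := hb.cnt_seg (i := 0) (k := t - 1) (by omega) (by omega)
    have c2 := hb.cnt_seg (i := t - 1) (k := t - 1) (by omega) (by omega)
    rw [if_pos (by omega), hR0] at c1
    rw [if_neg (by omega), hR1] at c2
    have c3 : cnt w u₀ a' = cnt w (v + (t - 1) * s) a' := cnt_untouched p1 fun k h1 h2 => by
      rw [hb.seg (i := t - 1) (by omega) h1 (by omega), hR1]
      exact h.ne
    have c4 : cnt w (v + (t - 1) * s + (u₀ - (v + (t - 1) * s))) a = _ :=
      cnt_run fun k h1 h2 => by
        rw [hb.seg (i := t - 1) (by omega) h1 (by omega), hR1]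
    rw [Nat.add_sub_cancel' p1] at c4
    have := htv.cnt_eq
    omega
  · obtain ⟨v, s, t, R, hb, h2t, he, hR0, hR1⟩ := Tie.exists_block h.ne hP ht'
    have hs := hb.pos
    have e2 : 2 * s ≤ t * s := Nat.mul_le_mul_right s h2t
    have htv := hb.tie 0 (by omega) (t - 1) (by omega)
    rw [hR0, hR1] at htv
    rcases lt_or_ge u₀ v with hv | hv
    · exact ih v (by omega) hv htv
    obtain ⟨p1, p2⟩ := hb.pos_of_letter (p := u₀) (i := 0) hv (by omega) (by omega)
      (by rw [hR0]; exact h.run u₀ le_rfl (by omega))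
    rw [Nat.zero_mul, Nat.add_zero] at p1 p2
    have c3 : cnt w u₀ a' = cnt w v a' := cnt_untouched p1 fun k h1 h2 => by
      rw [hb.seg (i := 0) (by omega) (by omega) (by omega), hR0]
      exact h.ne
    have c4 : cnt w (v + (u₀ - v)) a = _ :=
      cnt_run fun k h1 h2 => by
        rw [hb.seg (i := 0) (by omega) (by omega) (by omega), hR0]
    rw [Nat.add_sub_cancel' p1] at c4
    have := htv.cnt_eq
    -- The letters are tied at both `v` and `u₀`, which leaves no room for a choice of `a` in
    -- between. The segment length is then `q`, and the `q + 1` copies of `b` overflow the second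
    -- segment: `b` is `a'`, or it is the third letter as well.
    obtain rfl : v = u₀ := by omega
    have hq1 : s ≤ q := by
      by_contra hc
      have h1 := hb.seg (i := 0) (p := v + q) (by omega) (by omega) (by omega)
      rw [h.run' _ le_rfl (by omega), hR0] at h1
      exact h.ne_left h1
    have hq2 : q ≤ s := by
      by_contra hc
      have h1 := hb.apply 1 (by omega) 0 hs
      rw [h.run _ (by omega) (by omega), ← hR0] at h1
      have := hb.inj _ (by omega) _ (by omega) h1
      omega
    obtain rfl : s = q := by omega
    have h1 := hb.apply 1 (by omega) 0 hs
    rw [h.run' _ (by omega) (by omega)] at h1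
    have h3t : 3 ≤ t := by
      by_contra hc
      obtain rfl : t = 2 := by omega
      exact h.ne_right (h1.trans hR1)
    have h2 := hb.apply 2 (by omega) 0 hs
    rw [h.run' _ (by omega) (by omega), h1] at h2
    have := hb.inj _ (by omega) _ (by omega) h2
    omega

/-- Counts leave only the rank after the first copy of `b`. A block from `a'` to `b` ending there
has at least two entries, so it contains the preceding `a` and ties it with `a'`. -/
theorem not_tie' {v : ℕ} (hv : u₀ + q ≤ v) (hv' : v ≤ u₀ + 2 * q + 1) : ¬ Tie w v b a' := by
  intro ht
  have hpos := h.pos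
  have c1 : cnt w (u₀ + q) b = cnt w u₀ b := cnt_untouched (by omega) fun p h1 h2 => by
    rw [h.run p h1 h2]; exact h.ne_left.symm
  have c2 : cnt w (u₀ + q + (v - (u₀ + q))) b = _ := cnt_run fun p h1 h2 =>
    h.run' p h1 (by omega)
  rw [Nat.add_sub_cancel' hv] at c2
  have c3 : cnt w v a' = cnt w u₀ a' := cnt_untouched (by omega) fun p h1 h2 => by
    rcases lt_or_ge p (u₀ + q) with h3 | h3
    · rw [h.run p h1 h3]; exact h.ne
    · rw [h.run' p h3 (by omega)]; exact h.ne_right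
  have c4 := ht.cnt_eq
  have c5 := h.tie.cnt_eq
  have c6 := h.cnt_add_one
  obtain rfl : v = u₀ + q + 1 := by omega
  obtain ⟨v', s, t, R, hb, h2t, he, hR0, hR1⟩ := Tie.exists_block h.ne_right.symm
    (h.run' (u₀ + q) le_rfl (by omega)) ht.symm
  have e2 : 2 * s ≤ t * s := Nat.mul_le_mul_right s h2t
  have hs := hb.pos
  obtain ⟨i, hi, hi'⟩ := hb.exists_letter (p := u₀ + q - 1) (by omega) (by omega)
  rw [h.run _ (by omega) (by omega)] at hi'
  have := hb.tie_end hi (j := 0) (by omega)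
  rw [hR0, ← hi', ← he] at this
  exact h.not_tie (by omega) this

theorem block_ge {v s t k : ℕ} {R : ℕ → α} (hb : TBlk w v s t R) (hk : k < t) (hR : R k = a')
    (he : u₀ + 2 * q + 1 < v + t * s) : (∀ i < t, R i ≠ a) ∧ u₀ + 2 * q + 1 ≤ v := by
  have hpos := h.pos
  have ha : ∀ i < t, R i ≠ a := fun i hi hia => by
    have := hb.tie_end hi hk
    rw [hia, hR] at this
    exact h.not_tie (by omega) this
  refine ⟨ha, ?_⟩
  by_contra hc
  have hv : u₀ + q ≤ v := by
    by_contra hc'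
    exact hb.ne_of_forall_ne ha (p := u₀ + q - 1) (by omega) (by omega)
      (h.run _ (by omega) (by omega))
  have h1 := hb.apply 0 (by omega) 0 hb.pos
  rw [h.run' _ (by omega) (by omega)] at h1
  have h2 := hb.tie 0 (by omega) k hk
  rw [← h1, hR] at h2
  exact h.not_tie' hv (by omega) h2

/-- The first copy of `y` passes only letters tied with `a'`, which are behind `a`. A later copy
passes `z` only if a block from `z` to `y` has just ended. That block avoids `a` and `a'`, so at its
start `z` is tied with `a'`, and induction applies to the segment of `z`. -/
theorem bef_run {I : List α} (hI : IsOrd I) {v s : ℕ} {y : α} (hv : u₀ + 2 * q + 1 ≤ v)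
    (hinv : ∀ u, u₀ + 2 * q + 1 ≤ u → u ≤ v → ∀ z, Tie w u a' z → Bef w I u a z)
    (hy : y ≠ a') (ht : Tie w v y a') (hw : ∀ p, v ≤ p → p < v + s → w p = y) :
    Bef w I (v + s) a y := by
  induction v using Nat.strong_induction_on generalizing y s with
  | _ v ih =>
  have hpos := h.pos
  have hya : y ≠ a := fun e => h.not_tie (by omega) (e ▸ ht)
  induction s with
  | zero => exact hinv v hv le_rfl y ht.symm
  | succ s ihs =>
    have ihs' := ihs fun p h1 h2 => hw p h1 (by omega)
    rw [← add_assoc, Bef.succ_self' hI (hw (v + s) (by omega) (by omega)) hya]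
    intro z hz
    by_cases hzy : z = y
    · exact hzy ▸ ihs'
    rcases Nat.eq_zero_or_pos s with rfl | hs
    · exact hinv v hv le_rfl z (ht.symm.trans hz)
    obtain ⟨v', s', t, R, hb, h2t, he, hR0, hR1⟩ := Tie.exists_block (u := v + s - 1) hzy
      (hw _ (by omega) (by omega)) (by rw [Nat.sub_add_cancel (by omega)]; exact hz.symm)
    rw [Nat.sub_add_cancel (by omega)] at he
    have hs' := hb.pos
    have e1 : (t - 1) * s' + s' = t * s' := by
      rw [← Nat.succ_mul]; congr 1; omega
    obtain ⟨b1, b2, -⟩ := hb.last_seg h2t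
    have hle : v' + (t - 1) * s' ≤ v := by
      by_contra hc
      exact b2 (by rw [hR1]; exact hw _ (by omega) (by omega))
    -- Otherwise `y` was chosen right before `v`, and its tie with `a'` at `v` gives an earlier
    -- block end in the same run.
    have heq : v' + (t - 1) * s' = v := by
      by_contra hne
      have hyv : w (v - 1) = y := by
        rw [← hR1]
        exact hb.last_run (by omega) (by omega) (by omega)
      obtain ⟨v₂, s₂, t₂, Q, hQ, h2t₂, he₂, hQ0, hQ1⟩ := Tie.exists_block (u := v - 1)
        hy.symm hyv (by rw [Nat.sub_add_cancel (by omega)]; exact ht.symm)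
      rw [Nat.sub_add_cancel (by omega)] at he₂
      have := hQ.end_unique hb h2t₂ h2t (by rw [hQ1, hR1]) (by omega) fun p h1 h2 => by
        rw [hQ1]; exact hw p (by omega) (by omega)
      omega
    obtain rfl : s' = s := by omega
    -- At `v`, where `a'` is tied with `y`, it would already be one segment ahead.
    have ha' : ∀ i < t, R i ≠ a' := fun i hi hia => by
      have hit : i ≠ t - 1 := by
        rintro rfl
        exact hy (hR1.symm.trans hia)
      have c1 := hb.cnt_seg (i := i) (k := t - 1) hi (by omega)
      have c2 := hb.cnt_seg (i := t - 1) (k := t - 1) (by omega) (by omega)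
      rw [if_pos (by omega), heq, hia] at c1
      rw [if_neg (by omega), heq, hR1] at c2
      have c3 := (hb.tie i hi (t - 1) (by omega)).cnt_eq
      rw [hia, hR1] at c3
      have := ht.cnt_eq
      omega
    have htv' : Tie w v' y a' := by
      refine ht.to_untouched (by omega) (fun p h1 h2 => ?_) fun p h1 h2 => ?_
      · rw [← hR1]
        exact hb.ne_before (by omega) h1 (by omega)
      · exact hb.ne_of_forall_ne ha' h1 (by omega)
    -- If `a` were in the block, its segment would start at `u₀` and have length `q`. The following
    -- run of `b` then fits neither into one segment, as it has `q + 1` copies, nor into the last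
    -- one, as that starts at `v`, after the run.
    have ha : ∀ i < t, R i ≠ a := fun i hi hia => by
      have hit : i ≠ t - 1 := by
        rintro rfl
        exact hya (hR1.symm.trans hia)
      have htva : Tie w v' a y := by
        rw [← hia, ← hR1]
        exact hb.tie _ hi _ (by omega)
      have hv'u : v' ≤ u₀ := by
        by_contra hc
        exact h.not_tie (by omega) (htva.trans htv')
      obtain ⟨p1, p2⟩ := hb.pos_of_letter (p := u₀) hv'u (by omega) hi
        (by rw [hia]; exact h.run _ le_rfl (by omega))
      have c1 := (htva.trans htv').cnt_eq
      have c2 := h.tie.cnt_eq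
      have c3 : cnt w u₀ a' = cnt w v' a' := cnt_untouched hv'u fun p h1 h2 =>
        hb.ne_of_forall_ne ha' h1 (by omega)
      have c4 := hb.cnt_seg (i := i) (k := i) hi (by omega)
      rw [if_neg (by omega), hia] at c4
      have c5 : cnt w (v' + i * s' + (u₀ - (v' + i * s'))) a = _ := cnt_run fun p h1 h2 => by
        rw [hb.seg hi h1 (by omega), hia]
      rw [Nat.add_sub_cancel' p1] at c5
      have hu : u₀ = v' + i * s' := by omega
      have e2 : (i + 1) * s' = i * s' + s' := Nat.succ_mul _ _
      have e3 : (i + 1) * s' ≤ (t - 1) * s' := Nat.mul_le_mul_right _ (by omega)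
      have hq1 : s' ≤ q := by
        by_contra hc
        have h1 := hb.seg (p := u₀ + q) hi (by omega) (by omega)
        rw [h.run' _ le_rfl (by omega), hia] at h1
        exact h.ne_left h1
      have hnext := hb.seg (i := i + 1) (p := u₀ + s') (by omega) (by omega) (by omega)
      have hq2 : q ≤ s' := by
        by_contra hc
        rw [h.run _ (by omega) (by omega), ← hia] at hnext
        have := hb.inj _ (by omega) _ (by omega) hnext
        omega
      obtain rfl : s' = q := by omega
      have e4 : (i + 2) * s' = (i + 1) * s' + s' := Nat.succ_mul _ _
      rcases Nat.lt_or_ge (i + 1) (t - 1) with hlt | hge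
      · have e5 : (i + 2) * s' ≤ (t - 1) * s' := Nat.mul_le_mul_right _ (by omega)
        have hnext2 := hb.seg (i := i + 2) (p := u₀ + 2 * s') (by omega) (by omega) (by omega)
        rw [h.run' _ (by omega) (by omega)] at hnext hnext2
        have := hb.inj _ (by omega) _ (by omega) (hnext.symm.trans hnext2)
        omega
      · have : i + 1 = t - 1 := by omega
        rw [this] at e2 e3
        omega
    have hv'1 : u₀ + 2 * q + 1 ≤ v' := by
      by_contra hc
      have hv'2 : u₀ + q ≤ v' := by
        by_contra hc'
        exact hb.ne_of_forall_ne ha (p := u₀ + q - 1) (by omega) (by omega)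
          (h.run _ (by omega) (by omega))
      have h1 := hb.apply 0 (by omega) 0 hs'
      rw [h.run' _ (by omega) (by omega)] at h1
      have h2 := hb.tie 0 (by omega) (t - 1) (by omega)
      rw [← h1, hR1] at h2
      exact h.not_tie' hv'2 (by omega) (h2.trans htv')
    have hzv' : Tie w v' z a' := by
      have h2 := hb.tie 0 (by omega) (t - 1) (by omega)
      rw [hR0, hR1] at h2
      exact h2.trans htv'
    have e2 : s' ≤ (t - 1) * s' := Nat.le_mul_of_pos_left _ (by omega)
    have := ih v' (by omega) hv'1 (fun u h1 h2 => hinv u h1 (by omega)) (hR0 ▸ ha' 0 (by omega))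
      hzv' (s := s') fun p h1 h2 => by
        rw [← hR0]; exact hb.seg (i := 0) (by omega) (by omega) (by omega)
    rw [Bef.untouched hI (u := v' + s') (by omega)]
    · exact this
    · exact fun p h1 h2 => hb.ne_of_forall_ne ha (by omega) (by omega)
    · intro p h1 h2
      rw [← hR0]
      exact hb.ne_after (by omega) (by omega) (by omega)

/-- The claim `bef` is strengthened to all letters tied with `a'`, since these are the ones that
`a'` jumps over. A letter can also become tied with `a'` anew, at the end of a block that starts or
ends with `a'`; such a block lies entirely after the separation. -/
theorem bef_of_tie {I : List α} (hI : IsOrd I) {u : ℕ} (hu : u₀ + 2 * q + 1 ≤ u) :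
    ∀ z, Tie w u a' z → Bef w I u a z := by
  have hpos := h.pos
  induction u using Nat.strong_induction_on with
  | _ u ih =>
  rcases hu.eq_or_lt with rfl | hu
  · intro z hz
    have hza : z ≠ a := fun e => h.not_tie (by omega) (e ▸ hz.symm)
    have hzb : z ≠ b := fun e => h.not_tie' (by omega) le_rfl (e ▸ hz.symm)
    have hz0 : Tie w u₀ a' z := by
      refine hz.to_untouched (by omega) (fun p h1 h2 => ?_) fun p h1 h2 => ?_ <;>
      rcases lt_or_ge p (u₀ + q) with h3 | h3
      · rw [h.run p h1 h3]; exact h.ne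
      · rw [h.run' p h3 h2]; exact h.ne_right
      · rw [h.run p h1 h3]; exact hza.symm
      · rw [h.run' p h3 h2]; exact hzb.symm
    have key : ∀ k < q, Bef w I (u₀ + k + 1) a z := fun k hk => by
      induction k with
      | zero =>
        rw [Bef.succ_self hI (h.run _ (by omega) (by omega)) hza.symm]
        exact ⟨z, h.tie.trans hz0, Or.inl rfl⟩
      | succ k ihk =>
        rw [Bef.succ_self hI (h.run _ (by omega) (by omega)) hza.symm]
        exact ⟨a, Tie.refl _ _, Or.inr (ihk (by omega))⟩
    have := key (q - 1) (by omega)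
    rw [show u₀ + (q - 1) + 1 = u₀ + q by omega] at this
    rw [Bef.untouched hI (u := u₀ + q) (by omega)]
    · exact this
    · exact fun p h1 h2 => by rw [h.run' p h1 h2]; exact h.ne_left
    · exact fun p h1 h2 => by rw [h.run' p h1 h2]; exact hzb.symm
  obtain ⟨u, rfl⟩ : ∃ k, u = k + 1 := ⟨u - 1, by omega⟩
  intro z hz
  have hinv := ih u (by omega) (by omega)
  have hza : z ≠ a := fun e => h.not_tie (by omega) (e ▸ hz.symm)
  by_cases huz : w u = z
  · by_cases hza' : z = a'
    · subst hza'
      rw [Bef.succ_self' hI huz hza]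
      exact hinv
    obtain ⟨v, s, t, R, hb, h2t, he, hR0, hR1⟩ := Tie.exists_block (Ne.symm hza') huz hz
    obtain ⟨ha, hv⟩ := h.block_ge hb (k := 0) (by omega) hR0 (by omega)
    have hs := hb.pos
    have e1 : (t - 1) * s + s = t * s := by
      rw [← Nat.succ_mul]; congr 1; omega
    have hvz : Tie w v a' z := by
      rw [← hR0, ← hR1]
      exact hb.tie _ (by omega) _ (by omega)
    have e2 : s ≤ (t - 1) * s := Nat.le_mul_of_pos_left _ (by omega)
    have hmove : ∀ y, (∀ p, v ≤ p → p < v + (t - 1) * s → w p ≠ y) → Bef w I v a y →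
        Bef w I (v + (t - 1) * s) a y := fun y hy h1 =>
      (Bef.untouched hI (by omega) (fun p h1 h2 => hb.ne_of_forall_ne ha h1 (by omega)) hy).2 h1
    have hzb : ∀ p, v ≤ p → p < v + (t - 1) * s → w p ≠ z := fun p h1 h2 => by
      rw [← hR1]
      exact hb.ne_before (by omega) h1 h2
    -- Only the first copy of `z` passes other letters. Those tied with `z` at that point are
    -- untouched since `v`, so they were tied with `a'` there. A tie after a further copy would mean
    -- a second block end in the same run.
    have key : ∀ k, k < s → Bef w I (v + (t - 1) * s + (k + 1)) a z := fun k hk => by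
      induction k with
      | zero =>
        rw [Nat.zero_add, Bef.succ_self' hI (by
          rw [hb.last_run (by omega) le_rfl (by omega), hR1]) hza]
        intro y hy
        by_cases hyz : y = z
        · exact hyz ▸ hmove z hzb (ih v (by omega) hv z hvz)
        by_cases hyR : ∃ i < t - 1, R i = y
        · obtain ⟨i, hi, rfl⟩ := hyR
          have c1 := hb.cnt_seg (i := i) (k := t - 1) (by omega) (by omega)
          have c2 := hb.cnt_seg (i := t - 1) (k := t - 1) (by omega) (by omega)
          rw [if_pos (by omega)] at c1
          rw [if_neg (by omega), hR1] at c2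
          have c3 := (hb.tie i (by omega) (t - 1) (by omega)).cnt_eq
          rw [hR1] at c3
          have := hy.cnt_eq
          omega
        push Not at hyR
        have hyb : ∀ p, v ≤ p → p < v + (t - 1) * s → w p ≠ y := fun p h1 h2 =>
          (hb.toBlk.take (Nat.sub_le t 1)).ne_of_forall_ne hyR h1 h2
        have := hy.to_untouched (u := v) (by omega) hzb hyb
        exact hmove y hyb (ih v (by omega) hv y (hvz.trans this))
      | succ k ihk =>
        rw [← add_assoc, Bef.succ_self' hI (by
          rw [hb.last_run (by omega) (by omega) (by omega), hR1]) hza]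
        intro y hy
        by_cases hyz : y = z
        · exact hyz ▸ ihk (by omega)
        exfalso
        obtain ⟨v₂, s₂, t₂, Q, hQ, h2t₂, he₂, hQ0, hQ1⟩ := Tie.exists_block
          (u := v + (t - 1) * s + k) hyz
          (by rw [hb.last_run (by omega) (by omega) (by omega), hR1]) hy.symm
        have := hQ.end_unique hb h2t₂ h2t (by rw [hQ1, hR1]) (by omega) fun p h1 h2 => by
          rw [hQ1, ← hR1]; exact hb.last_run (by omega) (by omega) (by omega)
        omega
    have := key (s - 1) (by omega)
    rwa [show v + (t - 1) * s + (s - 1 + 1) = u + 1 by omega] at this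
  by_cases hua' : w u = a'
  · obtain ⟨v, s, t, R, hb, h2t, he, hR0, hR1⟩ := Tie.exists_block (fun e => huz (hua'.trans e.symm))
      hua' hz.symm
    obtain ⟨ha, hv⟩ := h.block_ge hb (k := t - 1) (by omega) hR1 (by omega)
    have hs := hb.pos
    have e2 : 2 * s ≤ t * s := Nat.mul_le_mul_right s h2t
    have hza' : z ≠ a' := fun e => huz (hua'.trans e.symm)
    have htv := hb.tie 0 (by omega) (t - 1) (by omega)
    rw [hR0, hR1] at htv
    have := h.bef_run hI hv (fun k h1 h2 => ih k (by omega) h1) hza' htv (s := s) fun p h1 h2 => by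
      rw [← hR0]; exact hb.seg (i := 0) (by omega) (by omega) (by omega)
    rw [Bef.untouched hI (u := v + s) (by omega)]
    · exact this
    · exact fun p h1 h2 => hb.ne_of_forall_ne ha (by omega) (by omega)
    · intro p h1 h2
      rw [← hR0]
      exact hb.ne_after (by omega) (by omega) (by omega)
  have h1 := hinv z (hz.of_succ hua' huz)
  by_cases hua : w u = a
  · rw [Bef.succ_self hI hua hza.symm]
    exact ⟨a, Tie.refl _ _, Or.inr h1⟩
  · exact (Bef.succ_of_ne hI hua huz).2 h1

theorem bef {I : List α} (hI : IsOrd I) {u : ℕ} (hu : u₀ + 2 * q + 1 ≤ u) : Bef w I u a a' :=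
  h.bef_of_tie hI hu a' (Tie.refl _ _)

end Separates

end WreathComplex

namespace WreathComplex

variable {α : Type*} [DecidableEq α]

/-! ### Words that are sorted phase by phase -/

/-- The starting position of phase `k`. -/
def phaseStart (T : ℕ → Finset α) (k : ℕ) : ℕ := ∑ j ∈ range k, #(T j)

/-- The number of phases before phase `k` in which the letter `x` occurs. -/
def mult (T : ℕ → Finset α) (k : ℕ) (x : α) : ℕ := #{j ∈ range k | x ∈ T j}

/-- The two letters occur in the same phases before phase `k`. -/
def SameVec (T : ℕ → Finset α) (k : ℕ) (x y : α) : Prop := ∀ j < k, x ∈ T j ↔ y ∈ T j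

/-- The phases `T 0, …, T (N - 1)` are nonempty, and the letters of each of them have occurred
equally often before. -/
structure IsPhases (T : ℕ → Finset α) (N : ℕ) : Prop where
  nonempty : ∀ k < N, (T k).Nonempty
  level : ∀ k < N, ∀ x ∈ T k, ∀ y ∈ T k, mult T k x = mult T k y

/-- The word lists the letters of the successive phases, those of each phase being sorted by the
order at the start of the phase. -/
structure IsSorted (T : ℕ → Finset α) (N : ℕ) (w : ℕ → α) (I : List α) : Prop where
  isOrd : IsOrd I
  mem : ∀ k < N, ∀ i < #(T k), w (phaseStart T k + i) ∈ T k
  sorted : ∀ k < N, ∀ i j, i < j → j < #(T k) →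
    Bef w I (phaseStart T k) (w (phaseStart T k + i)) (w (phaseStart T k + j))

theorem phaseStart_succ (T : ℕ → Finset α) (k : ℕ) :
    phaseStart T (k + 1) = phaseStart T k + #(T k) := sum_range_succ _ _

theorem phaseStart_mono (T : ℕ → Finset α) {j k : ℕ} (h : j ≤ k) :
    phaseStart T j ≤ phaseStart T k :=
  sum_le_sum_of_subset (range_mono h)

theorem exists_phase (T : ℕ → Finset α) {k p : ℕ} (h : p < phaseStart T k) :
    ∃ j < k, ∃ i < #(T j), p = phaseStart T j + i := by
  induction k with
  | zero => simp [phaseStart] at h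
  | succ k ih =>
    rcases lt_or_ge p (phaseStart T k) with h1 | h1
    · obtain ⟨j, hj, hi⟩ := ih h1
      exact ⟨j, by omega, hi⟩
    · rw [phaseStart_succ] at h
      exact ⟨k, by omega, p - phaseStart T k, by omega, by omega⟩

theorem mult_succ (T : ℕ → Finset α) (k : ℕ) (x : α) :
    mult T (k + 1) x = mult T k x + if x ∈ T k then 1 else 0 := by
  unfold mult
  rw [range_add_one, filter_insert]
  split_ifs with h
  · rw [card_insert_of_notMem (by simp)]
  · rfl

namespace SameVec

variable {T : ℕ → Finset α} {k : ℕ} {x y z : α}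

theorem refl (T : ℕ → Finset α) (k : ℕ) (x : α) : SameVec T k x x := fun _ _ => Iff.rfl

theorem symm (h : SameVec T k x y) : SameVec T k y x := fun j hj => (h j hj).symm

theorem trans (h : SameVec T k x y) (h' : SameVec T k y z) : SameVec T k x z :=
  fun j hj => (h j hj).trans (h' j hj)

theorem mono (h : SameVec T k x y) {j : ℕ} (hj : j ≤ k) : SameVec T j x y :=
  fun i hi => h i (hi.trans_le hj)

theorem succ (h : SameVec T k x y) (h' : x ∈ T k ↔ y ∈ T k) : SameVec T (k + 1) x y :=
  fun j hj => by
    rcases Nat.lt_succ_iff_lt_or_eq.1 hj with h1 | rfl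
    exacts [h j h1, h']

end SameVec

/-! ### Counts, ties and order during one phase -/

namespace IsSorted

variable {T : ℕ → Finset α} {N : ℕ} {w : ℕ → α} {I : List α} (h : IsSorted T N w I)
include h

theorem inj {k i j : ℕ} (hk : k < N) (hi : i < #(T k)) (hj : j < #(T k))
    (e : w (phaseStart T k + i) = w (phaseStart T k + j)) : i = j := by
  rcases lt_trichotomy i j with h1 | h1 | h1
  · exact absurd e (h.sorted k hk i j h1 hj).ne
  · exact h1
  · exact absurd e.symm (h.sorted k hk j i h1 hi).ne

theorem exists_pos {k : ℕ} (hk : k < N) {x : α} (hx : x ∈ T k) :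
    ∃ i < #(T k), w (phaseStart T k + i) = x := by
  have := surj_on_of_inj_on_of_card_le (s := range #(T k)) (t := T k)
    (fun i _ => w (phaseStart T k + i)) (fun i hi => h.mem k hk i (mem_range.1 hi))
    (fun i j hi hj e => h.inj hk (mem_range.1 hi) (mem_range.1 hj) e) (by simp) x hx
  obtain ⟨i, hi, e⟩ := this
  exact ⟨i, mem_range.1 hi, e.symm⟩

theorem ne_of_notMem {k : ℕ} (hk : k < N) {x : α} (hx : x ∉ T k) {p : ℕ}
    (h1 : phaseStart T k ≤ p) (h2 : p < phaseStart T (k + 1)) : w p ≠ x := by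
  obtain ⟨i, rfl⟩ := Nat.exists_eq_add_of_le h1
  rw [phaseStart_succ] at h2
  rintro rfl
  exact hx (h.mem k hk i (by omega))

theorem ne_of_pos {k i p : ℕ} (hk : k < N) (hi : i < #(T k)) (h1 : phaseStart T k ≤ p)
    (h2 : p < phaseStart T (k + 1)) (hp : p ≠ phaseStart T k + i) :
    w p ≠ w (phaseStart T k + i) := by
  obtain ⟨j, rfl⟩ := Nat.exists_eq_add_of_le h1
  rw [phaseStart_succ] at h2
  intro e
  exact hp (by rw [h.inj hk (by omega) hi e])

theorem cnt_mid {k i : ℕ} (hk : k < N) (hi : i < #(T k)) {j : ℕ} (hj : j ≤ #(T k)) :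
    cnt w (phaseStart T k + j) (w (phaseStart T k + i)) =
      cnt w (phaseStart T k) (w (phaseStart T k + i)) + if i < j then 1 else 0 := by
  have hs := phaseStart_succ T k
  split_ifs with hij
  · rw [cnt_untouched (u := phaseStart T k + i + 1) (by omega) fun p h1 h2 =>
      h.ne_of_pos hk hi (by omega) (by omega) (by omega), cnt_succ_self,
      cnt_untouched (u := phaseStart T k) (by omega) fun p h1 h2 =>
      h.ne_of_pos hk hi (by omega) (by omega) (by omega)]
  · exact cnt_untouched (u := phaseStart T k) (by omega) fun p h1 h2 =>
      h.ne_of_pos hk hi (by omega) (by omega) (by omega)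

theorem cnt_eq {k : ℕ} (hk : k ≤ N) (x : α) : cnt w (phaseStart T k) x = mult T k x := by
  induction k with
  | zero => simp [phaseStart, mult, cnt]
  | succ k ih =>
    rw [mult_succ, ← ih (by omega)]
    split_ifs with hx
    · obtain ⟨i, hi, rfl⟩ := h.exists_pos hk hx
      rw [phaseStart_succ, h.cnt_mid hk hi le_rfl, if_pos hi]
    · exact cnt_untouched (phaseStart_mono T k.le_succ) fun p h1 h2 => h.ne_of_notMem hk hx h1 h2

theorem bef_pos {k i j : ℕ} (hk : k < N) (hi : i < #(T k)) (hj : j < #(T k)) :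
    Bef w I (phaseStart T k) (w (phaseStart T k + i)) (w (phaseStart T k + j)) ↔ i < j := by
  refine ⟨fun hb => ?_, fun hij => h.sorted k hk i j hij hj⟩
  by_contra hc
  rcases (not_lt.1 hc).eq_or_lt with rfl | hlt
  · exact Bef.irrefl _ _ _ _ hb
  · exact hb.asymm (h.sorted k hk j i hlt hi)

variable (hT : IsPhases T N)
include hT

/-- The letters of a phase start it with equal counts, so those already chosen in it are one ahead
of the current letter. For the others nothing has changed since the start of the phase. -/
theorem tie_mid {k i : ℕ} (hk : k < N) (hi : i < #(T k)) {z : α} :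
    Tie w (phaseStart T k + i) (w (phaseStart T k + i)) z ↔
      (∀ j < i, w (phaseStart T k + j) ≠ z) ∧ Tie w (phaseStart T k) (w (phaseStart T k + i)) z := by
  have hs := phaseStart_succ T k
  have hx : ∀ p, phaseStart T k ≤ p → p < phaseStart T k + i → w p ≠ w (phaseStart T k + i) :=
    fun p h1 h2 => h.ne_of_pos hk hi h1 (by omega) (by omega)
  have hz : (∀ j < i, w (phaseStart T k + j) ≠ z) →
      ∀ p, phaseStart T k ≤ p → p < phaseStart T k + i → w p ≠ z := fun hz p h1 h2 => by
    obtain ⟨j, rfl⟩ := Nat.exists_eq_add_of_le h1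
    exact hz j (by omega)
  refine ⟨fun ht => ?_, fun ⟨h1, h2⟩ => h2.of_untouched (by omega) hx (hz h1)⟩
  have hne : ∀ j < i, w (phaseStart T k + j) ≠ z := by
    rintro j hj rfl
    have c1 := h.cnt_mid hk hi (j := i) hi.le
    have c2 := h.cnt_mid hk (i := j) (by omega) (j := i) hi.le
    rw [if_neg (lt_irrefl _)] at c1
    rw [if_pos hj] at c2
    have c3 := hT.level k hk _ (h.mem k hk i hi) _ (h.mem k hk j (by omega))
    rw [← h.cnt_eq hk.le, ← h.cnt_eq hk.le] at c3
    have := ht.cnt_eq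
    omega
  exact ⟨hne, ht.to_untouched (by omega) hx (hz hne)⟩

/-- Tied letters of the same phase that are still to come are behind the current letter by
sortedness, so only tied letters outside the phase can pull it forward. -/
theorem bef_mid {k i : ℕ} (hk : k < N) (hi : i < #(T k)) {y : α}
    (hy : ∀ j ≤ i, w (phaseStart T k + j) ≠ y) :
    Bef w I (phaseStart T k + i + 1) (w (phaseStart T k + i)) y ↔
      Bef w I (phaseStart T k) (w (phaseStart T k + i)) y ∨
        ∃ z ∉ T k, Tie w (phaseStart T k) (w (phaseStart T k + i)) z ∧
          (z = y ∨ Bef w I (phaseStart T k) z y) := by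
  rw [Bef.succ_self h.isOrd rfl (hy i le_rfl)]
  have hs := phaseStart_succ T k
  have hunt : ∀ z, (∀ j < i, w (phaseStart T k + j) ≠ z) →
      (Bef w I (phaseStart T k + i) z y ↔ Bef w I (phaseStart T k) z y) := fun z hz => by
    refine Bef.untouched h.isOrd (by omega) (fun p h1 h2 => ?_) fun p h1 h2 => ?_ <;>
    obtain ⟨j, rfl⟩ := Nat.exists_eq_add_of_le h1
    · exact hz j (by omega)
    · exact hy j (by omega)
  constructor
  · rintro ⟨z, hz, hzy⟩
    obtain ⟨h1, h2⟩ := (h.tie_mid hT hk hi).1 hz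
    rw [hunt z h1] at hzy
    by_cases hzT : z ∈ T k
    · left
      obtain ⟨j, hj, rfl⟩ := h.exists_pos hk hzT
      have hij : i ≤ j := by
        by_contra hc
        exact h1 j (by omega) rfl
      rcases hij.eq_or_lt with rfl | hij
      · exact hzy.resolve_left (hy i le_rfl)
      · have := h.sorted k hk i j hij hj
        rcases hzy with rfl | hzy
        exacts [this, this.trans hzy]
    · exact Or.inr ⟨z, hzT, h2, hzy⟩
  · rintro (hb | ⟨z, hz, h1, h2⟩)
    · refine ⟨_, Tie.refl _ _, Or.inr ((hunt _ fun j hj => ?_).2 hb)⟩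
      exact h.ne_of_pos hk hi (by omega) (by omega) (by omega)
    · have hne : ∀ j < i, w (phaseStart T k + j) ≠ z := by
        rintro j hj rfl
        exact hz (h.mem k hk j (by omega))
      exact ⟨z, (h.tie_mid hT hk hi).2 ⟨hne, h1⟩, by rwa [hunt z hne]⟩

theorem bef_of_notMem {k : ℕ} (hk : k < N) {x y : α} (hx : x ∉ T k) (hy : y ∉ T k) :
    Bef w I (phaseStart T (k + 1)) x y ↔ Bef w I (phaseStart T k) x y :=
  Bef.untouched h.isOrd (phaseStart_mono T k.le_succ) (fun _ => h.ne_of_notMem hk hx)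
    fun _ => h.ne_of_notMem hk hy

theorem bef_of_mem_notMem {k : ℕ} (hk : k < N) {x y : α} (hx : x ∈ T k) (hy : y ∉ T k) :
    Bef w I (phaseStart T (k + 1)) x y ↔ Bef w I (phaseStart T k) x y ∨
      ∃ z ∉ T k, Tie w (phaseStart T k) x z ∧ (z = y ∨ Bef w I (phaseStart T k) z y) := by
  obtain ⟨i, hi, rfl⟩ := h.exists_pos hk hx
  have hs := phaseStart_succ T k
  rw [← h.bef_mid hT hk hi]
  · exact Bef.untouched h.isOrd (by omega)
      (fun p h1 h2 => h.ne_of_pos hk hi (by omega) h2 (by omega))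
      fun p h1 h2 => h.ne_of_notMem hk hy (by omega) h2
  · rintro j hj rfl
    exact hy (h.mem k hk j (by omega))

/-- The later letter `y` overtakes `x` only by jumping in front of a tied letter that is itself in
front of `x`; tied letters of the phase never are. -/
theorem bef_of_mem_mem {k : ℕ} (hk : k < N) {x y : α} (hx : x ∈ T k) (hy : y ∈ T k)
    (hxy : Bef w I (phaseStart T k) x y) :
    Bef w I (phaseStart T (k + 1)) x y ↔
      ∀ z ∉ T k, Tie w (phaseStart T k) y z → Bef w I (phaseStart T (k + 1)) x z := by
  obtain ⟨a, ha, rfl⟩ := h.exists_pos hk hx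
  obtain ⟨b, hb, rfl⟩ := h.exists_pos hk hy
  have hab : a < b := (h.bef_pos hk ha hb).1 hxy
  have hs := phaseStart_succ T k
  have hx' : ∀ p, phaseStart T k + a + 1 ≤ p → p < phaseStart T (k + 1) →
      w p ≠ w (phaseStart T k + a) := fun p h1 h2 => h.ne_of_pos hk ha (by omega) h2 (by omega)
  have hend : ∀ z ∉ T k, (Bef w I (phaseStart T (k + 1)) (w (phaseStart T k + a)) z ↔
      Bef w I (phaseStart T k + b) (w (phaseStart T k + a)) z) := fun z hz =>
    Bef.untouched h.isOrd (by omega) (fun p h1 h2 => hx' p (by omega) h2)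
      fun p h1 h2 => h.ne_of_notMem hk hz (by omega) h2
  rw [Bef.untouched h.isOrd (u := phaseStart T k + b + 1) (by omega)
    (fun p h1 h2 => hx' p (by omega) h2)
    (fun p h1 h2 => h.ne_of_pos hk hb (by omega) h2 (by omega)),
    Bef.succ_self' h.isOrd rfl hxy.ne.symm]
  constructor
  · intro hz z hzT ht
    rw [hend z hzT]
    refine hz z ((h.tie_mid hT hk hb).2 ⟨?_, ht⟩)
    rintro j hj rfl
    exact hzT (h.mem k hk j (by omega))
  · intro hz z ht
    obtain ⟨h1, h2⟩ := (h.tie_mid hT hk hb).1 ht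
    by_cases hzT : z ∈ T k
    · obtain ⟨j, hj, rfl⟩ := h.exists_pos hk hzT
      have hbj : b ≤ j := by
        by_contra hc
        exact h1 j (by omega) rfl
      rw [Bef.untouched h.isOrd (u := phaseStart T k + a + 1) (by omega)
        (fun p h1 h2 => hx' p (by omega) (by omega))
        (fun p h1 h2 => h.ne_of_pos hk hj (by omega) (by omega) (by omega)),
        h.bef_mid hT hk ha fun i hi => h.ne_of_pos hk hj (by omega) (by omega) (by omega)]
      exact Or.inl (h.sorted k hk a j (by omega) hj)
    · exact (hend z hzT).1 (hz z hzT h2)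

end IsSorted

end WreathComplex

namespace WreathComplex

variable {α : Type*} [DecidableEq α]

/-! ### Words with the same phases -/

/-- In the orders at the start of phase `k`, letters which have occurred in the same phases are
tied, and their relative order is the initial one. -/
structure Coherent (T : ℕ → Finset α) (k : ℕ) (w : ℕ → α) (I : List α) : Prop where
  tie : ∀ x y, SameVec T k x y → Tie w (phaseStart T k) x y
  bef : ∀ x y, SameVec T k x y → (Bef w I (phaseStart T k) x y ↔ Bef w I 0 x y)

/-- At the start of phase `k`, the two words have the same ties, and the same order of letters up
to the order of the letters that have occurred in the same phases. -/
structure Agree (T : ℕ → Finset α) (k : ℕ) (w : ℕ → α) (I : List α) (w' : ℕ → α) (I' : List α) :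
    Prop where
  tie : ∀ x y, Tie w (phaseStart T k) x y ↔ Tie w' (phaseStart T k) x y
  bef : ∀ x x' y y', SameVec T k x x' → SameVec T k y y' → ¬ SameVec T k x y →
    (Bef w I (phaseStart T k) x y ↔ Bef w' I' (phaseStart T k) x' y')

/-- After phase `j` there are `q` phases with the single letter `x`, then `q` phases with the single
letter `y`, and then a phase that starts with `y`, which has been chosen less often than `x`
before. Moreover, `z` is another letter of phase `j` that has occurred in the same phases
as `x` before. -/
structure Pattern (T : ℕ → Finset α) (w : ℕ → α) (I : List α) (j q : ℕ) (x y z : α) : Prop where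
  pos : 1 ≤ q
  mem_left : x ∈ T j
  mem_right : z ∈ T j
  ne : z ≠ x
  sameVec : SameVec T j z x
  left : ∀ i, j < i → i ≤ j + q → T i = {x}
  right : ∀ i, j + q < i → i ≤ j + 2 * q → T i = {y}
  mem : y ∈ T (j + 2 * q + 1)
  first : ∀ z ∈ T (j + 2 * q + 1), z ≠ y → Bef w I (phaseStart T (j + 2 * q + 1)) y z
  mult_add_one : mult T (j + 1) y + 1 = mult T (j + 1) x

/-- No pattern that is completed before phase `k` separates its letters against the initial
order. -/
def NoBad (T : ℕ → Finset α) (k : ℕ) (w : ℕ → α) (I : List α) : Prop :=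
  ∀ j q x y z, Pattern T w I j q x y z → j + 2 * q + 1 < k → ¬ Bef w I 0 z x

theorem NoBad.mono {T : ℕ → Finset α} {k : ℕ} {w : ℕ → α} {I : List α} (h : NoBad T k w I)
    {k' : ℕ} (hk : k' ≤ k) : NoBad T k' w I :=
  fun j q x y z hp hj => h j q x y z hp (hj.trans_le hk)

theorem Agree.symm {T : ℕ → Finset α} {k : ℕ} {w w' : ℕ → α} {I I' : List α}
    (h : Agree T k w I w' I') : Agree T k w' I' w I :=
  ⟨fun x y => (h.tie x y).symm, fun x x' y y' hx hy hxy =>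
    (h.bef x' x y' y hx.symm hy.symm fun h' => hxy (hx.trans (h'.trans hy.symm))).symm⟩

section

variable {T : ℕ → Finset α} {N k : ℕ} {w w' : ℕ → α} {I I' : List α}
  (hT : IsPhases T N) (h : IsSorted T N w I) (h' : IsSorted T N w' I')
include hT h

/-- The single-letter phases spell out the two runs required by `Separates`. The last copy of `y` is
the first entry of the phase that completes the pattern, and coherence provides the initial tie. -/
theorem Pattern.bef {j q : ℕ} {x y z : α} (hp : Pattern T w I j q x y z)
    (hc : Coherent T (j + 1) w I) (hN : j + 2 * q + 1 < N) {u : ℕ}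
    (hu : phaseStart T (j + 2 * q + 2) ≤ u) : Bef w I u x z := by
  have hpos := hp.pos
  have hx : ∀ i, i ≤ 2 * q → phaseStart T (j + 1 + i) = phaseStart T (j + 1) + i := by
    intro i hi
    induction i with
    | zero => rfl
    | succ i ih =>
      have : #(T (j + 1 + i)) = 1 := by
        rcases Nat.lt_or_ge i q with h1 | h1
        · rw [hp.left _ (by omega) (by omega), card_singleton]
        · rw [hp.right _ (by omega) (by omega), card_singleton]
      rw [← add_assoc, phaseStart_succ, ih (by omega), this, add_assoc]
  have hletter : ∀ i, j + i + 1 < N → 0 < #(T (j + 1 + i)) := fun i hi =>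
    card_pos.2 (hT.nonempty _ (by omega))
  have hsep : Separates w (phaseStart T (j + 1)) q x z y := by
    have hsv : SameVec T (j + 1) x z :=
      hp.sameVec.symm.succ (iff_of_true hp.mem_left hp.mem_right)
    have ht := hc.tie x z hsv
    have hcz := ht.cnt_eq
    have hm := hp.mult_add_one
    rw [← h.cnt_eq (by omega), ← h.cnt_eq (by omega)] at hm
    refine ⟨ht, hp.ne.symm, hpos, fun p h1 h2 => ?_, fun p h1 h2 => ?_, ?_, ?_, hm⟩
    · obtain ⟨i, rfl⟩ := Nat.exists_eq_add_of_le h1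
      have := h.mem (j + 1 + i) (by omega) 0 (hletter i (by omega))
      rw [hx i (by omega), hp.left _ (by omega) (by omega), mem_singleton] at this
      exact this
    · obtain ⟨i, rfl⟩ := Nat.exists_eq_add_of_le (by omega : phaseStart T (j + 1) ≤ p)
      rcases Nat.lt_or_ge i (2 * q) with h3 | h3
      · have := h.mem (j + 1 + i) (by omega) 0 (hletter i (by omega))
        rw [hx i (by omega), hp.right _ (by omega) (by omega), mem_singleton] at this
        exact this
      · obtain rfl : i = 2 * q := by omega
        have hN' : j + 2 * q + 1 < N := hN
        have e : j + 1 + 2 * q = j + 2 * q + 1 := by omega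
        have hs := hx (2 * q) le_rfl
        rw [e] at hs
        rw [← hs]
        by_contra hne
        have h0 := hletter (2 * q) (by omega)
        rw [e] at h0
        have hb := hp.first _ (h.mem _ hN 0 h0) hne
        obtain ⟨b, hb1, hb2⟩ := h.exists_pos hN hp.mem
        rw [← hb2, Nat.add_zero] at hb
        have := (h.bef_pos hN hb1 h0).1 hb
        omega
    · rintro rfl
      omega
    · rintro rfl
      omega
  refine hsep.bef h.isOrd ?_
  have e : j + 1 + 2 * q = j + 2 * q + 1 := by omega
  have hs := hx (2 * q) le_rfl
  rw [e] at hs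
  have h0 : 0 < #(T (j + 2 * q + 1)) := card_pos.2 (hT.nonempty _ hN)
  rw [show j + 2 * q + 2 = j + 2 * q + 1 + 1 from rfl, phaseStart_succ] at hu
  omega

include h'

/-- Equivalent letters of a phase are listed consecutively, so they form a block with segments of
length one. -/
theorem sameVec_tie_step (hk : k < N) (hA : Agree T k w I w' I') (hc : Coherent T k w I)
    {x y : α} (hxy : SameVec T (k + 1) x y) : Tie w (phaseStart T (k + 1)) x y := by
  by_cases hx : x ∈ T k
  · have hy := (hxy k k.lt_succ_self).1 hx
    obtain ⟨a, ha, rfl⟩ := h.exists_pos hk hx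
    obtain ⟨b, hb, rfl⟩ := h.exists_pos hk hy
    have hs := phaseStart_succ T k
    have key : ∀ a b, a < b → b < #(T k) → SameVec T (k + 1) (w (phaseStart T k + a))
        (w (phaseStart T k + b)) → Tie w (phaseStart T (k + 1)) (w (phaseStart T k + a))
        (w (phaseStart T k + b)) := by
      intro a b hab hb hxy
      have hxy' := hxy.mono k.le_succ
      -- An inequivalent letter in between would be behind one and in front of the other, but
      -- `Agree` gives it the same position relative to both.
      have hsv : ∀ c, a ≤ c → c ≤ b → SameVec T k (w (phaseStart T k + a))
          (w (phaseStart T k + c)) := fun c h1 h2 => by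
        rcases h1.eq_or_lt with rfl | h1
        · exact SameVec.refl _ _ _
        rcases h2.eq_or_lt with rfl | h2
        · exact hxy'
        by_contra hne
        have e1 := hA.bef _ _ _ _ (SameVec.refl T k _) (SameVec.refl T k _) hne
        have e2 := hA.bef _ _ _ _ hxy'.symm (SameVec.refl T k _)
          fun h3 => hne (hxy'.trans h3)
        have h3 := e2.2 (e1.1 (h.sorted k hk a c h1 (by omega)))
        exact h3.asymm (h.sorted k hk c b h2 hb)
      have hT1 : TBlk w (phaseStart T k + a) 1 (b + 1 - a) fun i => w (phaseStart T k + (a + i)) := by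
        refine ⟨⟨one_pos, fun i hi j hj => ?_, fun i hi j hj e => ?_⟩, fun i hi j hj => ?_⟩
        · congr 1
          omega
        · have := h.inj hk (by omega) (by omega) e
          omega
        · refine Tie.of_untouched (u := phaseStart T k) (by omega) (fun p h1 h2 => ?_)
            (fun p h1 h2 => ?_) (hc.tie _ _ ((hsv _ (by omega) (by omega)).symm.trans
            (hsv _ (by omega) (by omega))))
          · exact h.ne_of_pos hk (by omega) h1 (by omega) (by omega)
          · exact h.ne_of_pos hk (by omega) h1 (by omega) (by omega)
      have := hT1.tie_end (i := 0) (j := b - a) (by omega) (by omega)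
      simp only [add_zero] at this
      rw [show a + (b - a) = b by omega] at this
      exact this.of_untouched (by omega)
        (fun p h1 h2 => h.ne_of_pos hk (by omega) (by omega) h2 (by omega))
        (fun p h1 h2 => h.ne_of_pos hk (by omega) (by omega) h2 (by omega))
    rcases lt_trichotomy a b with hab | rfl | hab
    · exact key a b hab hb hxy
    · exact Tie.refl _ _
    · exact (key b a hab ha hxy.symm).symm
  · have hy := fun hy => hx ((hxy k k.lt_succ_self).2 hy)
    exact (hc.tie x y (hxy.mono k.le_succ)).of_untouched (phaseStart_mono T k.le_succ)
      (fun p => h.ne_of_notMem hk hx) (fun p => h.ne_of_notMem hk hy)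

/-- The front letter `x` is tied with everything that `y` is tied with, so it has already moved in
front of every letter outside the phase that `y` jumps over. -/
theorem sameVec_bef_step (hk : k < N) (hc : Coherent T k w I)
    {x y : α} (hxy : SameVec T (k + 1) x y) :
    Bef w I (phaseStart T (k + 1)) x y ↔ Bef w I 0 x y := by
  have hxy' := hxy.mono k.le_succ
  rw [← hc.bef x y hxy']
  by_cases hx : x ∈ T k
  · have hy := (hxy k k.lt_succ_self).1 hx
    have key : ∀ x y, x ∈ T k → y ∈ T k → SameVec T k x y → Bef w I (phaseStart T k) x y →
        Bef w I (phaseStart T (k + 1)) x y := fun x y hx hy hxy hb => by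
      rw [h.bef_of_mem_mem hT hk hx hy hb]
      intro z hz ht
      rw [h.bef_of_mem_notMem hT hk hx hz]
      exact Or.inr ⟨z, hz, (hc.tie x y hxy).trans ht, Or.inl rfl⟩
    refine ⟨fun hb => ?_, key x y hx hy hxy'⟩
    rw [← Bef.not_iff w h.isOrd _ hb.ne.symm]
    exact fun hb' => hb.asymm (key y x hy hx hxy'.symm hb')
  · exact h.bef_of_notMem hT hk hx fun hy => hx ((hxy k k.lt_succ_self).2 hy)

theorem bef_step_mixed (hk : k < N) (hA : Agree T k w I w' I') (hc' : Coherent T k w' I') {x x' y y' : α} (hx : x ∈ T k) (hy : y ∉ T k)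
    (hxx : SameVec T (k + 1) x x') (hyy : SameVec T (k + 1) y y')
    (hb : Bef w I (phaseStart T (k + 1)) x y) : Bef w' I' (phaseStart T (k + 1)) x' y' := by
  have hx' := (hxx k k.lt_succ_self).1 hx
  have hy' := fun h => hy ((hyy k k.lt_succ_self).2 h)
  have hxx' := hxx.mono k.le_succ
  have hyy' := hyy.mono k.le_succ
  rw [h'.bef_of_mem_notMem hT hk hx' hy']
  rw [h.bef_of_mem_notMem hT hk hx hy] at hb
  by_cases hxy : SameVec T k x y
  · exact Or.inr ⟨y', hy', hc'.tie _ _ (hxx'.symm.trans (hxy.trans hyy')), Or.inl rfl⟩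
  rcases hb with hb | ⟨z, hz, ht, hzy⟩
  · exact Or.inl ((hA.bef x x' y y' hxx' hyy' hxy).1 hb)
  · have htz : Tie w' (phaseStart T k) x' z := (hc'.tie _ _ hxx'.symm).trans ((hA.tie _ _).1 ht)
    by_cases hzy' : SameVec T k z y
    · exact Or.inr ⟨y', hy', htz.trans (hc'.tie _ _ (hzy'.trans hyy')), Or.inl rfl⟩
    · refine Or.inr ⟨z, hz, htz, Or.inr ?_⟩
      refine (hA.bef z z y y' (SameVec.refl _ _ _) hyy' hzy').1 (hzy.resolve_left ?_)
      rintro rfl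
      exact hzy' (SameVec.refl _ _ _)

/-- The order after a phase is expressed through ties and order at its start by `bef_of_mem_notMem`
and `bef_of_mem_mem`. These data agree, and ties do not distinguish equivalent letters. -/
theorem bef_step (hk : k < N) (hA : Agree T k w I w' I') (hc : Coherent T k w I)
    (hc' : Coherent T k w' I') {x x' y y' : α} (hxx : SameVec T (k + 1) x x')
    (hyy : SameVec T (k + 1) y y') (hxy : ¬ SameVec T (k + 1) x y) :
    Bef w I (phaseStart T (k + 1)) x y ↔ Bef w' I' (phaseStart T (k + 1)) x' y' := by
  have hxx' := hxx.mono k.le_succ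
  have hyy' := hyy.mono k.le_succ
  have hne : x ≠ y := fun e => hxy (e ▸ SameVec.refl _ _ _)
  have hne' : x' ≠ y' := fun e => hxy (hxx.trans (e ▸ hyy.symm))
  have mixed : ∀ {x x' y y' : α}, SameVec T (k + 1) x x' → SameVec T (k + 1) y y' → x ∈ T k →
      y ∉ T k → (Bef w I (phaseStart T (k + 1)) x y ↔
        Bef w' I' (phaseStart T (k + 1)) x' y') := by
    intro x x' y y' hxx hyy hx hy
    exact ⟨bef_step_mixed hT h h' hk hA hc' hx hy hxx hyy,
      bef_step_mixed hT h' h hk hA.symm hc ((hxx k k.lt_succ_self).1 hx)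
        (fun h => hy ((hyy k k.lt_succ_self).2 h)) hxx.symm hyy.symm⟩
  have both : ∀ {x x' y y' : α}, SameVec T (k + 1) x x' → SameVec T (k + 1) y y' →
      ¬ SameVec T k x y → x ∈ T k → y ∈ T k → Bef w I (phaseStart T k) x y →
      (Bef w I (phaseStart T (k + 1)) x y ↔ Bef w' I' (phaseStart T (k + 1)) x' y') := by
    intro x x' y y' hxx hyy hxy hx hy hb
    have hb' := (hA.bef x x' y y' (hxx.mono k.le_succ) (hyy.mono k.le_succ) hxy).1 hb
    rw [h.bef_of_mem_mem hT hk hx hy hb, h'.bef_of_mem_mem hT hk ((hxx k k.lt_succ_self).1 hx)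
      ((hyy k k.lt_succ_self).1 hy) hb']
    refine forall_congr' fun z => forall_congr' fun hz => ?_
    have ht : Tie w (phaseStart T k) y z ↔ Tie w' (phaseStart T k) y' z := by
      have := hc'.tie _ _ (hyy.mono k.le_succ)
      rw [hA.tie]
      exact ⟨this.symm.trans, this.trans⟩
    rw [ht, mixed hxx (SameVec.refl _ _ z) hx hz]
  by_cases hx : x ∈ T k <;> by_cases hy : y ∈ T k
  · have hxy' : ¬ SameVec T k x y := fun h => hxy (h.succ (iff_of_true hx hy))
    rcases Bef.total w h.isOrd (phaseStart T k) hne with hb | hb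
    · exact both hxx hyy hxy' hx hy hb
    · rw [← Bef.not_iff w h.isOrd _ hne.symm, ← Bef.not_iff w' h'.isOrd _ hne'.symm,
        both hyy hxx (fun h => hxy' h.symm) hy hx hb]
  · exact mixed hxx hyy hx hy
  · rw [← Bef.not_iff w h.isOrd _ hne.symm, ← Bef.not_iff w' h'.isOrd _ hne'.symm,
      mixed hyy hxx hy hx]
  · have hxy' : ¬ SameVec T k x y := fun h => hxy (h.succ (iff_of_false hx hy))
    rw [h.bef_of_notMem hT hk hx hy, h'.bef_of_notMem hT hk
      (fun h => hx ((hxx k k.lt_succ_self).2 h)) (fun h => hy ((hyy k k.lt_succ_self).2 h)),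
      hA.bef x x' y y' hxx' hyy' hxy']

end

end WreathComplex

namespace WreathComplex

variable {α : Type*} [DecidableEq α]

/-! ### Carrying ties over to another sorted word -/

section

variable {T : ℕ → Finset α} {N k : ℕ} {w w' : ℕ → α} {I I' : List α}
  (hT : IsPhases T N) (h : IsSorted T N w I) (h' : IsSorted T N w' I')
include hT h h'

/-- The block is the stretch of `w` from `R 0` in phase `j` to `R (t - 1)` in phase `k`. The
corresponding stretch of `w'` differs from it only by letters equivalent to one of the two ends. Its
letters are again distinct and tied at its start, so it is a block as well, possibly of another
length. -/
theorem tie_step_one (hk : k < N) (hA : ∀ j ≤ k, Agree T j w I w' I')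
    (hc : ∀ j ≤ k, Coherent T j w I) {v t b : ℕ} {R : ℕ → α} (hR : TBlk w v 1 t R) (ht : 2 ≤ t)
    (hb : b < #(T k)) (he : phaseStart T k + b + 1 = v + t)
    (hx : R 0 ∉ T k ∨ (Bef w I (phaseStart T k) (R 0) (R (t - 1)) ∧
      ¬ SameVec T k (R 0) (R (t - 1)))) :
    Tie w' (phaseStart T (k + 1)) (R 0) (R (t - 1)) := by
  have hsk := phaseStart_succ T k
  obtain ⟨j, hj, a, ha, rfl⟩ := exists_phase T (k := k + 1) (p := v) (by omega)
  have hjk : j ≤ k := by omega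
  have hsj := phaseStart_succ T j
  have hwR : ∀ i < t, w (phaseStart T j + a + i) = R i := fun i hi => by
    have := hR.apply i hi 0 one_pos
    simpa using this
  have hx0 : w (phaseStart T j + a) = R 0 := hwR 0 (by omega)
  have hy0 : w (phaseStart T k + b) = R (t - 1) := by
    rw [← hwR (t - 1) (by omega)]
    congr 1
    omega
  have hxT : R 0 ∈ T j := hx0 ▸ h.mem j (by omega) a ha
  have hyT : R (t - 1) ∈ T k := hy0 ▸ h.mem k hk b hb
  -- the letters of the block in the first word
  have G : ∀ i c, j ≤ i → i ≤ k → c < #(T i) → phaseStart T j + a ≤ phaseStart T i + c →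
      phaseStart T i + c ≤ phaseStart T k + b →
      Tie w (phaseStart T j) (R 0) (w (phaseStart T i + c)) ∧
      ∀ i', j ≤ i' → i' < i → w (phaseStart T i + c) ∉ T i' := by
    intro i c hji hik hc h1 h2
    obtain ⟨r, hr⟩ := Nat.exists_eq_add_of_le h1
    have hrt : r < t := by omega
    have hz : w (phaseStart T i + c) = R r := by rw [hr, hwR r hrt]
    have hnot : ∀ i', j ≤ i' → i' < i → w (phaseStart T i + c) ∉ T i' := by
      intro i' h3 h4 h5
      obtain ⟨c', hc', e⟩ := h.exists_pos (by omega) h5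
      have h6 := phaseStart_succ T i'
      have h7 := phaseStart_mono T (Nat.succ_le_of_lt h4)
      simp only [Nat.succ_eq_add_one] at h7
      rcases le_or_gt (phaseStart T j + a) (phaseStart T i' + c') with h8 | h8
      · obtain ⟨r', hr'⟩ := Nat.exists_eq_add_of_le h8
        rw [hr', hwR r' (by omega), hz] at e
        have := hR.inj _ (by omega) _ hrt e
        omega
      · obtain rfl : i' = j := by
          by_contra hne
          have := phaseStart_mono T (show j + 1 ≤ i' by omega)
          omega
        have c1 := h.cnt_mid (k := i') (by omega) hc' (j := a) ha.le
        have c2 := h.cnt_mid (k := i') (by omega) ha (j := a) ha.le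
        rw [if_pos (by omega), e, hz] at c1
        rw [if_neg (by omega), hx0] at c2
        have c3 := (hR.tie r hrt 0 (by omega)).cnt_eq
        have c4 := hT.level i' (by omega) _ (hz ▸ h5) _ hxT
        rw [← h.cnt_eq (by omega), ← h.cnt_eq (by omega)] at c4
        omega
    refine ⟨?_, hnot⟩
    have := hR.tie 0 (by omega) r hrt
    rw [hz]
    refine this.to_untouched (by omega) (fun p h3 h4 => ?_) fun p h3 h4 => ?_
    · rw [← hx0]
      exact h.ne_of_pos (by omega) ha h3 (by omega) (by omega)
    · rw [← hz]
      rcases hji.eq_or_lt with rfl | hlt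
      · exact h.ne_of_pos (by omega) hc h3 (by omega) (by omega)
      · exact h.ne_of_notMem (by omega) (hnot j le_rfl hlt) h3 (by omega)
  obtain ⟨a', ha', hx'⟩ := h'.exists_pos (by omega) hxT
  obtain ⟨b', hb', hy'⟩ := h'.exists_pos hk hyT
  have hGy := G k b hjk le_rfl hb (by omega) le_rfl
  rw [hy0] at hGy
  have hxk : j = k → Bef w I (phaseStart T k) (R 0) (R (t - 1)) ∧
      ¬ SameVec T k (R 0) (R (t - 1)) := fun e => hx.resolve_left (by subst e; simpa using hxT)
  have hlt : phaseStart T j + a' < phaseStart T k + b' := by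
    rcases hjk.eq_or_lt with rfl | hlt
    · obtain ⟨h1, h2⟩ := hxk rfl
      have h3 := ((hA j le_rfl).bef _ _ _ _ (SameVec.refl _ _ _) (SameVec.refl _ _ _) h2).1 h1
      rw [← hx', ← hy'] at h3
      have := (h'.bef_pos hk ha' hb').1 h3
      omega
    · have := phaseStart_mono T (show j + 1 ≤ k by omega)
      omega
  -- positions in the first word
  have posw : ∀ i ≤ k, ∀ z ∈ T i, ∃ c < #(T i), w (phaseStart T i + c) = z :=
    fun i hi z hz => h.exists_pos (by omega) hz
  have afterx : ∀ c < #(T j), Bef w I (phaseStart T j) (R 0) (w (phaseStart T j + c)) →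
      a < c := fun c hc hb => by
    rw [← hx0] at hb
    exact (h.bef_pos (by omega) ha hc).1 hb
  have beforey : ∀ c < #(T k), Bef w I (phaseStart T k) (w (phaseStart T k + c)) (R (t - 1)) →
      c < b := fun c hc hb' => by
    rw [← hy0] at hb'
    exact (h.bef_pos (by omega) hc hb).1 hb'
  -- A letter of the second stretch is an end letter, or equivalent to one in the phase of that end,
  -- or by `Agree` it lies within the first stretch too.
  have G' : ∀ i c, j ≤ i → i ≤ k → c < #(T i) → phaseStart T j + a' ≤ phaseStart T i + c →
      phaseStart T i + c ≤ phaseStart T k + b' →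
      Tie w (phaseStart T j) (R 0) (w' (phaseStart T i + c)) ∧
      ∀ i', j ≤ i' → i' < i → w' (phaseStart T i + c) ∉ T i' := by
    intro i c hji hik hci h1 h2
    have hzT := h'.mem i (by omega) c hci
    by_cases hzy : w' (phaseStart T i + c) = R (t - 1)
    · rw [hzy]
      refine ⟨hGy.1, fun i' h3 h4 => hGy.2 i' h3 (by omega)⟩
    by_cases hzx : w' (phaseStart T i + c) = R 0
    · rw [hzx] at hzT ⊢
      refine ⟨Tie.refl _ _, fun i' h3 h4 h5 => ?_⟩
      rcases hik.eq_or_lt with rfl | hik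
      · rcases hx with hx | ⟨hx1, hx2⟩
        · exact hx hzT
        · obtain ⟨d, hd, hd'⟩ := posw i le_rfl _ hzT
          rw [← hd'] at hx1
          have hdb := beforey d hd hx1
          have := (G i d hji le_rfl hd (by
            have := phaseStart_mono T (show j + 1 ≤ i by omega)
            omega) (by omega)).2 i' h3 h4
          exact this (hd' ▸ h5)
      · obtain ⟨d, hd, hd'⟩ := posw i hik.le _ hzT
        have e1 := phaseStart_mono T (show j + 1 ≤ i by omega)
        have e2 := phaseStart_mono T (show i + 1 ≤ k by omega)
        have e3 := phaseStart_succ T i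
        have := (G i d hji hik.le hd (by omega) (by omega)).2 i' h3 h4
        exact this (hd' ▸ h5)
    have hax : i = j → Bef w' I' (phaseStart T j) (R 0) (w' (phaseStart T i + c)) := fun e => by
      subst e
      have hac : a' ≠ c := by
        rintro rfl
        exact hzx hx'
      rw [← hx']
      exact h'.sorted i (by omega) a' c (by omega) hci
    have hby : i = k → Bef w' I' (phaseStart T k) (w' (phaseStart T i + c)) (R (t - 1)) :=
      fun e => by
        subst e
        have hcb : c ≠ b' := by
          rintro rfl
          exact hzy hy'
        rw [← hy']
        exact h'.sorted i (by omega) c b' (by omega) hb'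
    generalize w' (phaseStart T i + c) = z at *
    by_cases hVx : i = j ∧ SameVec T j (R 0) z
    · exact ⟨(hc j hjk).tie _ _ hVx.2, fun i' h3 h4 => by omega⟩
    by_cases hVy : i = k ∧ SameVec T k z (R (t - 1))
    · obtain ⟨rfl, hV⟩ := hVy
      refine ⟨hGy.1.trans ((hc j hjk).tie _ _ (hV.symm.mono hjk)), fun i' h3 h4 h5 => ?_⟩
      exact hGy.2 i' h3 h4 ((hV i' h4).1 h5)
    obtain ⟨d, hd, rfl⟩ := posw i hik z hzT
    refine G i d hji hik hd ?_ ?_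
    · rcases hji.eq_or_lt with rfl | hji
      · have := ((hA j hjk).bef _ _ _ _ (SameVec.refl _ _ _) (SameVec.refl _ _ _)
          fun hV => hVx ⟨rfl, hV⟩).2 (hax rfl)
        have := afterx d hd this
        omega
      · have := phaseStart_mono T (show j + 1 ≤ i by omega)
        omega
    · rcases hik.eq_or_lt with rfl | hik
      · have := ((hA i le_rfl).bef _ _ _ _ (SameVec.refl _ _ _) (SameVec.refl _ _ _)
          fun hV => hVy ⟨rfl, hV⟩).2 (hby rfl)
        have := beforey d hd this
        omega
      · have := phaseStart_mono T (show i + 1 ≤ k by omega)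
        have := phaseStart_succ T i
        omega
  have locate : ∀ p, phaseStart T j + a' ≤ p → p ≤ phaseStart T k + b' →
      ∃ i c, j ≤ i ∧ i ≤ k ∧ c < #(T i) ∧ p = phaseStart T i + c := fun p h1 h2 => by
    obtain ⟨i, hi, c, hc, rfl⟩ := exists_phase T (k := k + 1) (p := p) (by omega)
    refine ⟨i, c, ?_, by omega, hc, rfl⟩
    by_contra hne
    have := phaseStart_mono T (show i + 1 ≤ j by omega)
    have := phaseStart_succ T i
    omega
  have hinj : ∀ p p', phaseStart T j + a' ≤ p → p < p' → p' ≤ phaseStart T k + b' →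
      w' p ≠ w' p' := by
    intro p p' h1 h2 h3 e
    obtain ⟨i, c, h4, h5, h6, rfl⟩ := locate p h1 (by omega)
    obtain ⟨i', c', g4, g5, g6, rfl⟩ := locate p' (by omega) h3
    rcases lt_trichotomy i i' with h7 | rfl | h7
    · exact (G' i' c' g4 g5 g6 (by omega) h3).2 i h4 h7 (e ▸ h'.mem i (by omega) c h6)
    · have := h'.inj (by omega) h6 g6 e
      omega
    · have := phaseStart_mono T (show i' + 1 ≤ i by omega)
      have := phaseStart_succ T i'
      omega
  have htie : ∀ p, phaseStart T j + a' ≤ p → p ≤ phaseStart T k + b' →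
      Tie w' (phaseStart T j + a') (R 0) (w' p) := by
    intro p h1 h2
    obtain ⟨i, c, h4, h5, h6, rfl⟩ := locate p h1 h2
    obtain ⟨g1, g2⟩ := G' i c h4 h5 h6 h1 h2
    refine (((hA j hjk).tie _ _).1 g1).of_untouched (by omega) (fun p h3 h4 => ?_)
      fun p h3 h7 => ?_
    · rw [← hx']
      exact h'.ne_of_pos (by omega) ha' h3 (by omega) (by omega)
    · rcases h4.eq_or_lt with rfl | hlt
      · exact h'.ne_of_pos (by omega) h6 h3 (by omega) (by omega)
      · exact h'.ne_of_notMem (by omega) (g2 j le_rfl hlt) h3 (by omega)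
  have hB : TBlk w' (phaseStart T j + a') 1
      (phaseStart T k + b' + 1 - (phaseStart T j + a'))
      fun i => w' (phaseStart T j + a' + i) := by
    refine ⟨⟨one_pos, fun i hi r hr => ?_, fun i hi r hr e => ?_⟩, fun i hi r hr => ?_⟩
    · congr 1
      omega
    · rcases lt_trichotomy i r with h1 | h1 | h1
      · exact absurd e (hinj _ _ (by omega) (by omega) (by omega))
      · exact h1
      · exact absurd e.symm (hinj _ _ (by omega) (by omega) (by omega))
    · exact (htie _ (by omega) (by omega)).symm.trans (htie _ (by omega) (by omega))
  have hend := hB.tie_end (i := 0)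
    (j := phaseStart T k + b' - (phaseStart T j + a')) (by omega) (by omega)
  simp only [add_zero] at hend
  rw [Nat.add_sub_cancel' hlt.le, hx', hy'] at hend
  refine hend.of_untouched (by omega) (fun p h1 h2 => ?_) fun p h1 h2 => ?_
  · by_cases hxT' : R 0 ∈ T k
    · obtain ⟨d, hd, hd'⟩ := h'.exists_pos hk hxT'
      obtain ⟨h3, h4⟩ := hx.resolve_left fun hn => hn hxT'
      have h5 := ((hA k le_rfl).bef _ _ _ _ (SameVec.refl _ _ _) (SameVec.refl _ _ _) h4).1 h3
      rw [← hd', ← hy'] at h5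
      have := (h'.bef_pos hk hd hb').1 h5
      rw [← hd']
      exact h'.ne_of_pos hk hd (by omega) h2 (by omega)
    · exact h'.ne_of_notMem hk hxT' (by omega) h2
  · rw [← hy']
    exact h'.ne_of_pos hk hb' (by omega) h2 (by omega)

/-- A letter occurs only once in a phase, so a block with longer segments runs through single-letter
phases, from the last letter of phase `j` to the first letter of phase `k`. Unless an equivalent
letter could take the place of `R 0`, which would be a bad pattern, the same block occurs literally
in `w'`. -/
theorem tie_step_two (hk : k < N) (hA : ∀ j ≤ k, Agree T j w I w' I')
    (hc : ∀ j ≤ k, Coherent T j w I) (hbad : NoBad T (k + 1) w I) {v s t b : ℕ} {R : ℕ → α}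
    (hR : TBlk w v s t R) (hs : 2 ≤ s) (ht : 2 ≤ t)
    (hb : b < #(T k)) (he : phaseStart T k + b + 1 = v + t * s) (hx : R 0 ∉ T k) :
    Tie w' (phaseStart T (k + 1)) (R 0) (R (t - 1)) := by
  have hsk := phaseStart_succ T k
  have hst : 2 * s ≤ t * s := Nat.mul_le_mul_right s ht
  have het : (t - 1) * s + s = t * s := by
    rw [← Nat.succ_mul]; congr 1; omega
  -- equal consecutive letters belong to different phases
  have hcons : ∀ p, p + 1 < phaseStart T (k + 1) → w p = w (p + 1) →
      ∃ i ≤ k, p + 1 = phaseStart T i := by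
    intro p hp e
    obtain ⟨i, hi, c, hc, e'⟩ := exists_phase T hp
    refine ⟨i, by omega, ?_⟩
    by_contra hne
    obtain ⟨c, rfl⟩ : ∃ d, c = d + 1 := ⟨c - 1, by omega⟩
    have e2 : p = phaseStart T i + c := by omega
    rw [e', e2] at e
    have := h.inj (by omega) (by omega) hc e
    omega
  have hlast : ∀ p, v + (t - 1) * s ≤ p → p < v + t * s → w p = R (t - 1) := fun p =>
    hR.last_run (by omega)
  have hfirst : ∀ p, v ≤ p → p < v + s → w p = R 0 := fun p h1 h2 =>
    hR.seg (by omega) (by omega) (by omega)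
  -- The last two entries of the block are equal, so a phase starts between them.
  have hb0 : b = 0 := by
    obtain ⟨i, hi, e⟩ := hcons (phaseStart T k + b - 1) (by omega) (by
      rw [hlast _ (by omega) (by omega), hlast _ (by omega) (by omega)])
    rw [Nat.sub_add_cancel (by omega)] at e
    rcases hi.eq_or_lt with rfl | hi
    · omega
    · have h1 := phaseStart_succ T i
      have h2 := phaseStart_mono T (show i + 1 ≤ k by omega)
      have h3 : 0 < #(T i) := card_pos.2 (hT.nonempty i (by omega))
      omega
  subst hb0
  -- The first two entries are equal as well, so the block begins with the last entry of phase `j`.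
  obtain ⟨j, hj, hvj⟩ : ∃ j < k, v + 1 = phaseStart T (j + 1) := by
    obtain ⟨i, hi, e⟩ := hcons v (by omega) (by
      rw [hfirst _ (by omega) (by omega), hfirst _ (by omega) (by omega)])
    rcases i with _ | i
    · simp [phaseStart] at e
    · exact ⟨i, by omega, e⟩
  have hsj := phaseStart_succ T j
  have hTj : 0 < #(T j) := card_pos.2 (hT.nonempty j (by omega))
  have hv : v = phaseStart T j + (#(T j) - 1) := by omega
  -- the phases in between have one letter each
  have hone : ∀ i, j < i → i < k → #(T i) = 1 := by
    intro i h1 h2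
    have h3 : 0 < #(T i) := card_pos.2 (hT.nonempty i (by omega))
    by_contra hne
    have h4 := phaseStart_succ T i
    have h5 := phaseStart_mono T (show j + 1 ≤ i by omega)
    have h6 := phaseStart_mono T (show i + 1 ≤ k by omega)
    obtain ⟨g, hg, g1, g2⟩ := hR.exists_seg (p := phaseStart T i) (by omega) (by omega)
    obtain ⟨g', hg', g1', g2'⟩ := hR.exists_seg (p := phaseStart T i + 1) (by omega) (by omega)
    have e1 := hR.seg hg g1 g2
    have e2 := hR.seg hg' g1' g2'
    have hgg : g ≠ g' := by
      rintro rfl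
      have := h.inj (k := i) (i := 0) (j := 1) (by omega) (by omega) (by omega)
        (by rw [Nat.add_zero, e1, e2])
      omega
    have hgs : phaseStart T i + 1 = v + g * s + s := by
      by_contra hne'
      have := hR.seg hg (p := phaseStart T i + 1) (by omega) (by omega)
      exact hgg (hR.inj _ hg _ hg' (this.symm.trans e2))
    have m1 := h.mem i (by omega) 0 (by omega)
    have m2 := h.mem i (by omega) 1 (by omega)
    rw [Nat.add_zero, e1] at m1
    rw [e2] at m2
    -- A second letter in phase `i` would start a new segment. At the start of the phase the first
    -- letter already has `s - 1` extra copies and the second has none, so their counts differ.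
    have c1 := hT.level i (by omega) _ m1 _ m2
    rw [← h.cnt_eq (by omega), ← h.cnt_eq (by omega)] at c1
    have hg'g : g < g' := by
      by_contra hle
      have : (g' + 1) * s ≤ g * s := Nat.mul_le_mul_right s (by omega)
      rw [Nat.succ_mul] at this
      omega
    have c2 := (hR.tie g hg g' hg').cnt_eq
    have c3 := hR.cnt_seg hg (k := g) hg.le
    rw [if_neg (lt_irrefl _)] at c3
    have c4 : cnt w (v + g * s + (s - 1)) (R g) = _ := cnt_run fun p h1 h2 =>
      hR.seg hg h1 (by omega)
    have c5 := cnt_untouched (w := w) (r := R g') (show v ≤ phaseStart T i by omega)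
      fun p h7 h8 => hR.ne_before hg' h7 (by
        have : (g + 1) * s ≤ g' * s := Nat.mul_le_mul_right s (by omega)
        rw [Nat.succ_mul] at this
        omega)
    rw [show v + g * s + (s - 1) = phaseStart T i by omega] at c4
    omega
  have hstart : ∀ r, j + 1 + r ≤ k → phaseStart T (j + 1 + r) = v + 1 + r := by
    intro r hr
    induction r with
    | zero => exact hvj.symm
    | succ r ih =>
      rw [← add_assoc, phaseStart_succ, ih (by omega), hone _ (by omega) (by omega)]
      rfl
  have hkj : k = j + 1 + (k - (j + 1)) := by omega
  have hUk : phaseStart T k = v + 1 + (k - (j + 1)) := by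
    rw [hkj, hstart _ (by omega)]
    omega
  have hsingle : ∀ r, j + 1 + r < k → T (j + 1 + r) = {w (v + 1 + r)} := by
    intro r hr
    obtain ⟨z, hz⟩ := card_eq_one.1 (hone (j + 1 + r) (by omega) hr)
    have := h.mem (j + 1 + r) (by omega) 0 (by rw [hz]; simp)
    rw [hstart r hr.le, hz, mem_singleton, Nat.add_zero] at this
    rw [hz, this]
  have hyT : R (t - 1) ∈ T k := by
    have := h.mem k hk 0 hb
    rwa [hlast _ (by omega) (by omega)] at this
  have hyk : w (phaseStart T k) = R (t - 1) := hlast _ (by omega) (by omega)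
  have hxj : w v = R 0 := hfirst _ le_rfl (by omega)
  have hxT : R 0 ∈ T j := by
    have := h.mem j (by omega) (#(T j) - 1) (by omega)
    rwa [← hv, hxj] at this
  -- no letter of the first phase has occurred in the same phases as the first letter of the block
  have hnosame : ∀ z ∈ T j, z ≠ R 0 → ¬ SameVec T j z (R 0) := by
    intro z hz hzx hV
    have hfirstk : ∀ k' ≤ k, 0 < #(T k') → ∀ z ∈ T k', z ≠ w (phaseStart T k') →
        Bef w I (phaseStart T k') (w (phaseStart T k')) z := by
      intro k' hk' h0 z hz hne
      obtain ⟨c, hc, rfl⟩ := h.exists_pos (by omega) hz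
      have hc0 : c ≠ 0 := by
        rintro rfl
        exact hne rfl
      exact h.sorted k' (by omega) 0 c (by omega) hc
    have hw1 : ∀ r, s ≤ r → r < 2 * s → w (v + r) = R 1 := fun r h1 h2 =>
      hR.seg (i := 1) (by omega) (by omega) (by omega)
    have hk' : j + 2 * (s - 1) + 1 = j + 1 + (2 * s - 2) := by omega
    have hUk' : phaseStart T (j + 2 * (s - 1) + 1) = v + (2 * s - 1) := by
      rw [hk', hstart _ (by omega)]
      omega
    have hwk' : w (phaseStart T (j + 2 * (s - 1) + 1)) = R 1 := by
      rw [hUk', hw1 _ (by omega) (by omega)]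
    have hTk' : 0 < #(T (j + 2 * (s - 1) + 1)) := card_pos.2 (hT.nonempty _ (by omega))
    -- The first copy of `R 0` belongs to phase `j` and the last copy of `R 1` opens phase `j + 2 *
    -- (s - 1) + 1`; the remaining `s - 1` copies of each are phases of their own.
    have hpat : Pattern T w I j (s - 1) (R 0) (R 1) z := by
      refine ⟨by omega, hxT, hz, hzx, hV, fun i h1 h2 => ?_, fun i h1 h2 => ?_, ?_, ?_, ?_⟩
      · rw [show i = j + 1 + (i - (j + 1)) by omega, hsingle _ (by omega),
          hfirst _ (by omega) (by omega)]
      · rw [show i = j + 1 + (i - (j + 1)) by omega, hsingle _ (by omega),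
          show v + 1 + (i - (j + 1)) = v + (i - j) by omega, hw1 _ (by omega) (by omega)]
      · rw [← hwk']
        exact h.mem (j + 2 * (s - 1) + 1) (by omega) 0 hTk'
      · intro z hz hne
        rw [← hwk'] at hne ⊢
        exact hfirstk _ (by omega) hTk' z hz hne
      · rw [← h.cnt_eq (by omega), ← h.cnt_eq (by omega), ← hvj]
        have c1 := (hR.tie 0 (by omega) 1 (by omega)).cnt_eq
        have c2 := cnt_succ_self w v
        have hne : w v ≠ R 1 := fun e => by
          have := hR.inj _ (by omega) _ (by omega) (hxj.symm.trans e)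
          omega
        rw [hxj] at c2
        rw [cnt_succ_ne hne]
        omega
    refine hbad j (s - 1) _ _ _ hpat (by omega) ?_
    rw [← (hc j (by omega)).bef _ _ hV]
    obtain ⟨c, hc, rfl⟩ := h.exists_pos (by omega) hz
    have hcl : c ≠ #(T j) - 1 := by
      rintro rfl
      exact hzx (by rw [← hv, hxj])
    have := h.sorted j (by omega) c (#(T j) - 1) (by omega) (by omega)
    rwa [← hv, hxj] at this
  -- the letters of the second word
  have hw'v : w' v = R 0 := by
    by_contra hne
    have hm := h'.mem j (by omega) (#(T j) - 1) (by omega)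
    rw [← hv] at hm
    obtain ⟨c, hc, hc'⟩ := h'.exists_pos (by omega) hxT
    have hcl : c ≠ #(T j) - 1 := by
      rintro rfl
      exact hne (by rw [hv, hc'])
    have h1 := h'.sorted j (by omega) c (#(T j) - 1) (by omega) (by omega)
    rw [← hv, hc'] at h1
    have h2 := ((hA j (by omega)).bef _ _ _ _ (SameVec.refl _ _ _) (SameVec.refl _ _ _)
      fun hV => hnosame _ hm hne hV.symm).2 h1
    obtain ⟨d, hd, hd'⟩ := h.exists_pos (by omega) hm
    have hxj' := hxj
    rw [hv] at hxj'
    rw [← hxj', ← hd', h.bef_pos (by omega) (by omega) hd] at h2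
    omega
  have hw'mid : ∀ r, j + 1 + r < k → w' (v + 1 + r) = w (v + 1 + r) := by
    intro r hr
    have := h'.mem (j + 1 + r) (by omega) 0 (by rw [hsingle r hr]; simp)
    rw [Nat.add_zero, hstart r hr.le, hsingle r hr, mem_singleton] at this
    exact this
  have hw'k : w' (phaseStart T k) = R (t - 1) := by
    by_contra hne
    have hm := h'.mem k hk 0 hb
    rw [Nat.add_zero] at hm
    obtain ⟨c, hc, hc'⟩ := h'.exists_pos hk hyT
    have hcl : c ≠ 0 := by
      rintro rfl
      exact hne hc'
    have h1 := h'.sorted k hk 0 c (by omega) hc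
    rw [Nat.add_zero, hc'] at h1
    -- The phase before is `R (t - 1)` alone, so no other letter is equivalent to it.
    have hV : ¬ SameVec T k (w' (phaseStart T k)) (R (t - 1)) := by
      intro hV
      have h2 := hsingle (k - 1 - (j + 1)) (by omega)
      rw [hlast _ (by omega) (by omega)] at h2
      rw [show j + 1 + (k - 1 - (j + 1)) = k - 1 by omega] at h2
      have h3 := (hV (k - 1) (by omega)).2 (by rw [h2]; simp)
      rw [h2, mem_singleton] at h3
      exact hne h3
    have h2 := ((hA k le_rfl).bef _ _ _ _ (SameVec.refl _ _ _) (SameVec.refl _ _ _) hV).2 h1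
    obtain ⟨d, hd, hd'⟩ := h.exists_pos hk hm
    have := (h.bef_pos hk hd hb).1 (by rw [hd', Nat.add_zero, hyk]; exact h2)
    omega
  have hww : ∀ p, v ≤ p → p < v + t * s → w' p = w p := by
    intro p h1 h2
    rcases h1.eq_or_lt with rfl | h1
    · rw [hw'v, hxj]
    obtain ⟨r, rfl⟩ := Nat.exists_eq_add_of_le (Nat.succ_le_of_lt h1)
    simp only [Nat.succ_eq_add_one] at h2 ⊢
    rcases Nat.lt_or_ge (j + 1 + r) k with h3 | h3
    · exact hw'mid r h3
    · rw [show v + 1 + r = phaseStart T k by omega, hw'k, hyk]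
  have hRT : ∀ i < t, ∀ p, phaseStart T j ≤ p → p < v → w p ≠ R i := by
    intro i hi p h1 h2 e
    obtain ⟨c, rfl⟩ := Nat.exists_eq_add_of_le h1
    have c1 := h.cnt_mid (k := j) (by omega) (i := c) (by omega) (j := #(T j) - 1) (by omega)
    have c2 := h.cnt_mid (k := j) (by omega) (i := #(T j) - 1) (by omega) (j := #(T j) - 1)
      (by omega)
    rw [if_pos (by omega), ← hv, e] at c1
    rw [if_neg (by omega), ← hv, hxj] at c2
    have c3 := (hR.tie i hi 0 (by omega)).cnt_eq
    have c4 := hT.level j (by omega) _ (e ▸ h.mem j (by omega) c (by omega)) _ hxT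
    rw [← h.cnt_eq (by omega), ← h.cnt_eq (by omega)] at c4
    omega
  have hRT' : ∀ i < t, ∀ p, phaseStart T j ≤ p → p < v → w' p ≠ R i := by
    intro i hi p h1 h2 e
    obtain ⟨c, rfl⟩ := Nat.exists_eq_add_of_le h1
    have hm := h'.mem j (by omega) c (by omega)
    obtain ⟨d, hd, hd'⟩ := h.exists_pos (by omega) hm
    have hdl : d = #(T j) - 1 := by
      by_contra hne
      exact hRT i hi (phaseStart T j + d) (by omega) (by omega) (hd'.trans e)
    subst hdl
    rw [← hv, ← hww v le_rfl (by omega), hv] at hd'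
    have := h'.inj (by omega) (by omega) (by omega) hd'
    omega
  have hB : TBlk w' v s t R := by
    refine ⟨⟨by omega, fun i hi r hr => ?_, hR.inj⟩, fun i hi r hr => ?_⟩
    · have := Blk.mul_le (s := s) hi
      rw [hww _ (by omega) (by omega), hR.apply i hi r hr]
    · refine Tie.of_untouched (u := phaseStart T j) (by omega) (hRT' i hi) (hRT' r hr) ?_
      rw [← (hA j (by omega)).tie]
      exact (hR.tie i hi r hr).to_untouched (by omega) (hRT i hi) (hRT r hr)
  refine (hB.tie_end (i := 0) (j := t - 1) (by omega) (by omega)).of_untouched (by omega)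
    (fun p h1 h2 => h'.ne_of_notMem hk hx (by omega) h2) fun p h1 h2 => ?_
  rw [← hw'k]
  exact h'.ne_of_pos hk hb (by omega) h2 (by omega)

/-- The condition on `x` makes `y` the later of the two choices, so the tie stems from a block from
`x` to `y`. With segments of length at least two, `x` cannot be in phase `k`, since `y` would then
occur in it twice. -/
theorem tie_step_aux (hk : k < N) (hA : ∀ j ≤ k, Agree T j w I w' I')
    (hc : ∀ j ≤ k, Coherent T j w I) (hbad : NoBad T (k + 1) w I) {x y : α} (hy : y ∈ T k)
    (hx : x ∉ T k ∨ (Bef w I (phaseStart T k) x y ∧ ¬ SameVec T k x y))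
    (ht : Tie w (phaseStart T (k + 1)) x y) : Tie w' (phaseStart T (k + 1)) x y := by
  have hxy : x ≠ y := by
    rintro rfl
    rcases hx with hx | hx
    exacts [hx hy, hx.1.ne rfl]
  have hsk := phaseStart_succ T k
  obtain ⟨b, hb, rfl⟩ := h.exists_pos hk hy
  have ht' : Tie w (phaseStart T k + b + 1) x (w (phaseStart T k + b)) := by
    refine ht.to_untouched (by omega) (fun p h1 h2 => ?_)
      fun p h1 h2 => h.ne_of_pos hk hb (by omega) h2 (by omega)
    by_cases hxT : x ∈ T k
    · obtain ⟨a, ha, rfl⟩ := h.exists_pos hk hxT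
      have := (h.bef_pos hk ha hb).1 (hx.resolve_left fun hn => hn hxT).1
      exact h.ne_of_pos hk ha (by omega) h2 (by omega)
    · exact h.ne_of_notMem hk hxT (by omega) h2
  obtain ⟨v, s, t, R, hR, h2t, he, rfl, hR1⟩ := Tie.exists_block hxy rfl ht'
  rw [← hR1] at hx ⊢
  have hs := hR.pos
  rcases Nat.lt_or_ge s 2 with hs2 | hs2
  · obtain rfl : s = 1 := by omega
    exact tie_step_one hT h h' hk hA hc hR h2t hb (by omega) hx
  · have hxT : R 0 ∉ T k := by
      intro hxT
      have hlt := (hx.resolve_left fun hn => hn hxT).1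
      obtain ⟨a, ha, ha'⟩ := h.exists_pos hk hxT
      rw [hR1, ← ha', h.bef_pos hk ha hb] at hlt
      have e2 : 2 * s ≤ t * s := Nat.mul_le_mul_right s h2t
      have het : (t - 1) * s + s = t * s := by
        rw [← Nat.succ_mul]; congr 1; omega
      have := hR.last_run (p := phaseStart T k + b - 1) (by omega) (by omega) (by omega)
      rw [hR1, show phaseStart T k + b - 1 = phaseStart T k + (b - 1) by omega] at this
      have := h.inj hk (by omega) hb this
      omega
    exact tie_step_two hT h h' hk hA hc hbad hR hs2 h2t hb he hxT

theorem tie_step (hk : k < N) (hA : ∀ j ≤ k, Agree T j w I w' I')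
    (hc : ∀ j ≤ k, Coherent T j w I) (hc' : Coherent T k w' I')
    (hbad : NoBad T (k + 1) w I) {x y : α}
    (ht : Tie w (phaseStart T (k + 1)) x y) : Tie w' (phaseStart T (k + 1)) x y := by
  by_cases hx : x ∈ T k <;> by_cases hy : y ∈ T k
  · by_cases hxy : SameVec T k x y
    · exact sameVec_tie_step hT h' h hk (hA k le_rfl).symm hc' (hxy.succ (iff_of_true hx hy))
    · have hne : x ≠ y := fun e => hxy (e ▸ SameVec.refl _ _ _)
      rcases Bef.total w h.isOrd (phaseStart T k) hne with hb | hb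
      · exact tie_step_aux hT h h' hk hA hc hbad hy (Or.inr ⟨hb, hxy⟩) ht
      · exact (tie_step_aux hT h h' hk hA hc hbad hx (Or.inr ⟨hb, fun h => hxy h.symm⟩)
          ht.symm).symm
  · exact (tie_step_aux hT h h' hk hA hc hbad hx (Or.inl hy) ht.symm).symm
  · exact tie_step_aux hT h h' hk hA hc hbad hy (Or.inl hx) ht
  · have hle := phaseStart_mono T k.le_succ
    refine Tie.of_untouched hle (fun p => h'.ne_of_notMem hk hx) (fun p => h'.ne_of_notMem hk hy) ?_
    rw [← (hA k le_rfl).tie]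
    exact ht.to_untouched hle (fun p => h.ne_of_notMem hk hx) fun p => h.ne_of_notMem hk hy

/-- Sorted words with the same phases agree as long as no pattern contradicts their initial
orders. -/
theorem agree_of_noBad (hk : k ≤ N) (hbad : NoBad T k w I) (hbad' : NoBad T k w' I') :
    Agree T k w I w' I' ∧ Coherent T k w I ∧ Coherent T k w' I' := by
  induction k using Nat.strong_induction_on with
  | _ k ih =>
  rcases k with _ | k
  · have h0 : ∀ x y, SameVec T 0 x y := fun x y j hj => absurd hj (Nat.not_lt_zero j)
    have hU : phaseStart T 0 = 0 := rfl
    rw [← and_assoc]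
    refine ⟨⟨⟨fun x y => ?_, fun x x' y y' _ _ hn => absurd (h0 x y) hn⟩, ⟨fun x y _ => ?_, ?_⟩⟩,
      ⟨fun x y _ => ?_, ?_⟩⟩
    · exact iff_of_true (Tie.zero x y) (Tie.zero x y)
    · exact Tie.zero x y
    · exact fun x y _ => Iff.rfl
    · exact Tie.zero x y
    · exact fun x y _ => Iff.rfl
  · have H := fun j (hj : j ≤ k) => ih j (by omega) (by omega) (hbad.mono (by omega))
      (hbad'.mono (by omega))
    have hA := fun j (hj : j ≤ k) => (H j hj).1
    have hc := fun j (hj : j ≤ k) => (H j hj).2.1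
    have hc' := fun j (hj : j ≤ k) => (H j hj).2.2
    refine ⟨⟨fun x y => ⟨tie_step hT h h' hk hA hc (hc' k le_rfl) hbad, ?_⟩, ?_⟩,
      ⟨fun x y hxy => ?_, fun x y hxy => ?_⟩, ⟨fun x y hxy => ?_, fun x y hxy => ?_⟩⟩
    · exact tie_step hT h' h hk (fun j hj => (hA j hj).symm) hc' (hc k le_rfl) hbad'
    · exact fun x x' y y' => bef_step hT h h' hk (hA k le_rfl) (hc k le_rfl) (hc' k le_rfl)
    · exact sameVec_tie_step hT h h' hk (hA k le_rfl) (hc k le_rfl) hxy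
    · exact sameVec_bef_step hT h h' hk (hc k le_rfl) hxy
    · exact sameVec_tie_step hT h' h hk (hA k le_rfl).symm (hc' k le_rfl) hxy
    · exact sameVec_bef_step hT h' h hk (hc' k le_rfl) hxy

end

end WreathComplex

namespace WreathComplex

variable {α : Type*} [DecidableEq α]

/-! ### Existence and uniqueness of sorted words with a fixed order -/

theorem exists_isSorted [Nonempty α] (T : ℕ → Finset α) (N : ℕ) {I : List α} (hI : IsOrd I) :
    ∃ w, IsSorted T N w I := by
  induction N with
  | zero => exact ⟨fun _ => Classical.arbitrary α, hI, by simp, by simp⟩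
  | succ N ih =>
    obtain ⟨w, h⟩ := ih
    set E := evL w I (phaseStart T N) with hE
    have hEo : IsOrd E := evL_isOrd w hI _
    set L := E.filter (· ∈ T N) with hL
    have hLlen : L.length = #(T N) := by
      rw [← List.toFinset_card_of_nodup (hEo.nodup.filter _)]
      congr 1
      ext x
      simp [hEo.mem x]
    have hEs : E.Pairwise fun x y => E.idxOf x < E.idxOf y := by
      rw [List.pairwise_iff_getElem]
      intro i j hi hj hij
      rwa [hEo.nodup.idxOf_getElem, hEo.nodup.idxOf_getElem]
    have hLs : L.Pairwise fun x y => E.idxOf x < E.idxOf y := hEs.filter _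
    rw [List.pairwise_iff_getElem] at hLs
    set w' : ℕ → α := fun p => if p < phaseStart T N then w p else
      L.getD (p - phaseStart T N) (Classical.arbitrary α) with hw'
    have hlt : ∀ p < phaseStart T N, w' p = w p := fun p hp => if_pos hp
    have hge : ∀ i, ∀ hi : i < L.length, w' (phaseStart T N + i) = L[i] := fun i hi => by
      simp [hw', hi]
    refine ⟨w', hI, fun k hk i hi => ?_, fun k hk i j hij hj => ?_⟩
    · rcases Nat.lt_succ_iff_lt_or_eq.1 hk with hk | rfl
      · have := phaseStart_mono T (show k + 1 ≤ N from hk)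
        rw [phaseStart_succ] at this
        rw [hlt _ (by omega)]
        exact h.mem k hk i hi
      · rw [hge i (by omega)]
        have := List.getElem_mem (l := L) (n := i) (by omega)
        simpa using (List.mem_filter.1 this).2
    · rcases Nat.lt_succ_iff_lt_or_eq.1 hk with hk | rfl
      · have := phaseStart_mono T (show k + 1 ≤ N from hk)
        rw [phaseStart_succ] at this
        rw [hlt _ (by omega), hlt _ (by omega), Bef, evL_congr fun p hp => hlt p (by omega)]
        exact h.sorted k hk i j hij hj
      · rw [hge i (by omega), hge j (by omega), Bef, evL_congr hlt]
        exact hLs i j (by omega) (by omega) hij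

/-! ### Fixed points of the evolution -/

section

variable {T : ℕ → Finset α} {N : ℕ} {w w' : ℕ → α} {I I' : List α}
  (hT : IsPhases T N) (h : IsSorted T N w I) (h' : IsSorted T N w' I')
include hT h

/-- A pattern puts `x` in front of `z` at the end, hence also at the beginning. The coherence needed
to see this concerns earlier phases only, so induction applies. -/
theorem noBad_of_fixed (hfix : evL w I (phaseStart T N) = I) : NoBad T N w I := by
  suffices H : ∀ k ≤ N, NoBad T k w I from H N le_rfl
  intro k
  induction k with
  | zero => exact fun _ j q x y z _ hj => absurd hj (Nat.not_lt_zero _)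
  | succ k ih =>
    intro hk j q x y z hp hj hb
    have hbad := (ih (by omega)).mono (k' := j + 1) (by omega)
    have hc := (agree_of_noBad hT h h (by omega) hbad hbad).2.1
    have := hp.bef hT h hc (by omega) (phaseStart_mono T (show j + 2 * q + 2 ≤ N by omega))
    rw [Bef, hfix] at this
    exact lt_asymm this hb

include h'

/-- A pattern of `w'` depends on the order only at the start of its completing phase, where both
words still agree. So it is a pattern of `w` too, and the final order of `w`, which is `I'`, already
has its letters the right way round. -/
theorem NoBad.succ_of_evL (hI' : I' = evL w I (phaseStart T N)) {k : ℕ} (hk : k < N)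
    (hbad : NoBad T k w I) : NoBad T (k + 1) w' I' := by
  suffices H : ∀ a ≤ k + 1, NoBad T a w' I' from H _ le_rfl
  intro a
  induction a with
  | zero => exact fun _ j q x y z _ hj => absurd hj (Nat.not_lt_zero _)
  | succ a ih =>
    intro ha j q x y z hp hj hb
    have ih := ih (by omega)
    have hA := (agree_of_noBad hT h h' (k := j + 2 * q + 1) (by omega) (hbad.mono (by omega))
      (ih.mono (by omega))).1
    have hc := (agree_of_noBad hT h h' (k := j + 1) (by omega) (hbad.mono (by omega))
      (ih.mono (by omega))).2.1
    have hpos := hp.pos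
    -- Only the clause `first` involves the word. No other letter is equivalent to `y`, which was
    -- alone in the phase before, so `Agree` transfers it.
    have hp' : Pattern T w I j q x y z := by
      refine { hp with first := fun z' hz' hne => ?_ }
      refine (hA.bef y y z' z' (.refl _ _ _) (.refl _ _ _) fun hV => hne ?_).2 (hp.first z' hz' hne)
      have := hV (j + 2 * q) (by omega)
      rw [hp.right _ (by omega) le_rfl, mem_singleton, mem_singleton] at this
      exact this.1 rfl
    have := hp'.bef hT h hc (by omega) (phaseStart_mono T (show j + 2 * q + 2 ≤ N by omega))
    subst hI'
    exact this.asymm hb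

/-- Equivalent letters end in their initial order by coherence; inequivalent ones end as in `w`,
whose final order is `I'`. -/
theorem evL_fixed_of_noBad (hI' : I' = evL w I (phaseStart T N)) (hbad : NoBad T N w I)
    (hbad' : NoBad T N w' I') : evL w' I' (phaseStart T N) = I' := by
  obtain ⟨hA, -, hc'⟩ := agree_of_noBad hT h h' le_rfl hbad hbad'
  refine (evL_isOrd w' h'.isOrd _).ext h'.isOrd fun x y hxy => ?_
  by_cases hV : SameVec T N x y
  · exact (hc'.bef x y hV).1 hxy
  · have := (hA.bef x x y y (.refl _ _ _) (.refl _ _ _) hV).2 hxy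
    rwa [Bef, ← hI'] at this

end

/-- Each restart from the final order secures one more phase. When all phases are secured, one
further restart gives a fixed point. -/
theorem exists_isSorted_fixed [Nonempty α] {T : ℕ → Finset α} {N : ℕ} (hT : IsPhases T N)
    {I : List α} (hI : IsOrd I) : ∃ w J, IsSorted T N w J ∧ evL w J (phaseStart T N) = J := by
  have H : ∀ k ≤ N, ∃ w J, IsSorted T N w J ∧ NoBad T k w J := by
    intro k
    induction k with
    | zero =>
      obtain ⟨w, hw⟩ := exists_isSorted T N hI
      exact fun _ => ⟨w, I, hw, fun j q x y z _ hj => absurd hj (Nat.not_lt_zero _)⟩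
    | succ k ih =>
      intro hk
      obtain ⟨w, J, h, hb⟩ := ih (by omega)
      obtain ⟨w', h'⟩ := exists_isSorted T N (evL_isOrd w h.isOrd (phaseStart T N))
      exact ⟨w', _, h', hb.succ_of_evL hT h h' rfl hk⟩
  obtain ⟨w, J, h, hb⟩ := H N le_rfl
  obtain ⟨w', h'⟩ := exists_isSorted T N (evL_isOrd w h.isOrd (phaseStart T N))
  refine ⟨w', _, h', evL_fixed_of_noBad hT h h' rfl hb ?_⟩
  rcases N with _ | N
  · exact fun j q x y z _ hj => absurd hj (Nat.not_lt_zero _)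
  · exact NoBad.succ_of_evL hT h h' rfl N.lt_succ_self (hb.mono N.le_succ)

theorem IsOrd.length_eq {L L' : List α} (hL : IsOrd L) (hL' : IsOrd L') : L.length = L'.length :=
  ((List.perm_ext_iff_of_nodup hL.nodup hL'.nodup).2 fun x =>
    iff_of_true (hL.mem x) (hL'.mem x)).length_eq

/-- If two orders agree on inequivalent elements, then elements in the same place are
equivalent. -/
theorem IsOrd.rel_of_idxOf_eq {L L' : List α} (hL : IsOrd L) (hL' : IsOrd L') {V : α → α → Prop}
    (hsymm : ∀ x y, V x y → V y x) (htrans : ∀ x y z, V x y → V y z → V x z)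
    (H : ∀ x y, ¬ V x y → (L.idxOf x < L.idxOf y ↔ L'.idxOf x < L'.idxOf y)) {x x' : α}
    (e : L.idxOf x = L'.idxOf x') (hrefl : V x x) : V x x' := by
  by_contra hV
  have key : ∀ {L L' : List α}, IsOrd L → IsOrd L' →
      (∀ x y, ¬ V x y → (L.idxOf x < L.idxOf y ↔ L'.idxOf x < L'.idxOf y)) → ∀ x x',
      L.idxOf x = L'.idxOf x' → ¬ V x x' → ¬ L.idxOf x < L.idxOf x' := by
    intro L L' hL hL' H x x' e hV hlt
    have hmem : ∀ {L : List α}, IsOrd L → ∀ i z, z ∈ (L.take i).toFinset ↔ L.idxOf z < i := by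
      intro L hL i z
      rw [List.mem_toFinset, List.mem_take_iff_getElem]
      constructor
      · rintro ⟨j, hj, rfl⟩
        rw [hL.nodup.idxOf_getElem]
        omega
      · intro hz
        have := List.idxOf_lt_length_iff.2 (hL.mem z)
        exact ⟨L.idxOf z, by omega, List.getElem_idxOf this⟩
    have hcard : ∀ {L : List α}, IsOrd L → ∀ i, #(L.take i).toFinset = min i L.length := by
      intro L hL i
      rw [List.toFinset_card_of_nodup (hL.nodup.sublist (List.take_sublist _ _)),
        List.length_take]
    have hlt' := (H x x' hV).1 hlt
    -- Equally many letters precede `x` in `L` and `x'` in `L'`, but `x` itself is only among the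
    -- latter, so some `z` is only among the former.
    obtain ⟨z, hz, hz'⟩ : ∃ z, L.idxOf z < L.idxOf x ∧ ¬ L'.idxOf z < L'.idxOf x' := by
      by_contra! hc
      have := eq_of_subset_of_card_le (s := (L.take (L.idxOf x)).toFinset)
        (t := (L'.take (L.idxOf x)).toFinset)
        (fun z hz => by
          rw [hmem hL] at hz
          rw [hmem hL', e]
          exact hc z hz)
        (by rw [hcard hL, hcard hL', hL.length_eq hL'])
      have hx : x ∈ (L'.take (L.idxOf x)).toFinset := by
        rw [hmem hL', e]
        exact hlt'
      rw [← this, hmem hL] at hx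
      exact lt_irrefl _ hx
    by_cases hzx : V z x
    · exact hz' ((H z x' fun h => hV (htrans _ _ _ (hsymm _ _ hzx) h)).1 (hz.trans hlt))
    · exact hz' (((H z x hzx).1 hz).trans hlt')
  have hne : x ≠ x' := fun h => hV (h ▸ hrefl)
  rcases lt_or_gt_of_ne fun h => hne ((List.idxOf_inj (hL.mem x)).1 h) with h1 | h1
  · exact key hL hL' H x x' e hV h1
  · exact key hL' hL (fun x y h => (H x y h).symm) x' x e.symm (fun h => hV (hsymm _ _ h))
      ((H x' x fun h => hV (hsymm _ _ h)).1 h1)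

theorem IsOrd.exists_equiv {L L' : List α} (hL : IsOrd L) (hL' : IsOrd L') :
    ∃ f : α ≃ α, L.map f = L' ∧ ∀ x, L'.idxOf (f x) = L.idxOf x := by
  have hlen := hL.length_eq hL'
  set f : α ≃ α := ((hL.nodup.getEquivOfForallMemList L hL.mem).symm.trans
    (finCongr hlen)).trans (hL'.nodup.getEquivOfForallMemList L' hL'.mem) with hf
  have hget : ∀ i, ∀ hi : i < L.length, f L[i] = L'[i] := by
    intro i hi
    have : (hL.nodup.getEquivOfForallMemList L hL.mem).symm L[i] = ⟨i, hi⟩ := by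
      rw [Equiv.symm_apply_eq]
      rfl
    simp only [hf, Equiv.trans_apply, this]
    rfl
  have hmap : L.map f = L' :=
    List.ext_getElem (by simpa using hlen) fun i h1 h2 => by
      rw [List.getElem_map]
      exact hget i _
  refine ⟨f, hmap, fun x => ?_⟩
  have := List.idxOf_lt_length_iff.2 (hL.mem x)
  have h2 := hget (L.idxOf x) this
  rw [List.getElem_idxOf] at h2
  rw [h2, hL'.nodup.idxOf_getElem]

theorem Bef.map (f : α ≃ α) {w : ℕ → α} {I : List α} {u : ℕ} {x y : α} :
    Bef (fun p => f (w p)) (I.map f) u (f x) (f y) ↔ Bef w I u x y := by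
  have : ∀ (L : List α) x, (L.map f).idxOf (f x) = L.idxOf x := by
    intro L x
    induction L with
    | nil => rfl
    | cons a L ih =>
      by_cases h : a = x
      · simp [h]
      · simp [List.idxOf_cons_ne _ h, List.idxOf_cons_ne _ fun h' => h (f.injective h'), ih]
  rw [Bef, Bef, evL_map, this, this]

theorem IsSorted.map {T : ℕ → Finset α} {N : ℕ} {w : ℕ → α} {I : List α} (h : IsSorted T N w I)
    {f : α ≃ α} (hf : ∀ k < N, ∀ x, x ∈ T k → f x ∈ T k) :
    IsSorted T N (fun p => f (w p)) (I.map f) where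
  isOrd := ⟨h.isOrd.nodup.map f.injective, fun x =>
    List.mem_map.2 ⟨f.symm x, h.isOrd.mem _, f.apply_symm_apply x⟩⟩
  mem k hk i hi := hf k hk _ (h.mem k hk i hi)
  sorted k hk i j hij hj := (Bef.map f).2 (h.sorted k hk i j hij hj)

/-- A sorted word is determined by its phases and its initial order. -/
theorem IsSorted.ext {T : ℕ → Finset α} {N : ℕ} {w w' : ℕ → α} {I : List α}
    (h : IsSorted T N w I) (h' : IsSorted T N w' I) : ∀ p < phaseStart T N, w p = w' p := by
  suffices H : ∀ k ≤ N, ∀ p < phaseStart T k, w p = w' p from H N le_rfl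
  intro k
  induction k with
  | zero => exact fun _ p hp => absurd hp (Nat.not_lt_zero p)
  | succ k ih =>
    intro hk p hp
    have ih := ih (by omega)
    rcases lt_or_ge p (phaseStart T k) with hp' | hp'
    · exact ih p hp'
    have key : ∀ {w w' : ℕ → α}, IsSorted T N w I → IsSorted T N w' I →
        (∀ p < phaseStart T k, w p = w' p) → ∀ i < #(T k), ∀ j < #(T k),
        w (phaseStart T k + i) = w' (phaseStart T k + j) → i ≤ j := by
      intro w w' h h' hw i
      induction i with
      | zero => exact fun _ j _ _ => Nat.zero_le j
      | succ i ih =>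
        intro hi j hj e
        obtain ⟨j', hj', e'⟩ := h'.exists_pos hk (h.mem k hk i (by omega))
        have h1 := ih (by omega) j' hj' e'.symm
        have h2 := h.sorted k hk i (i + 1) (by omega) hi
        rw [Bef, evL_congr hw, e, ← e'] at h2
        have := (h'.bef_pos hk hj' hj).1 h2
        omega
    obtain ⟨i, rfl⟩ := Nat.exists_eq_add_of_le hp'
    rw [phaseStart_succ] at hp
    have hi : i < #(T k) := by omega
    obtain ⟨j, hj, e⟩ := h'.exists_pos hk (h.mem k hk i hi)
    rw [← e, le_antisymm (key h h' ih i hi j hj e.symm)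
      (key h' h (fun p hp => (ih p hp).symm) j hj i hi e)]

/-- The two fixed orders differ only within classes, so the order-preserving bijection keeps each
class. It carries `w` to a sorted word with initial order `I'`, and that word is unique. -/
theorem exists_equiv_of_fixed {T : ℕ → Finset α} {N : ℕ} {w w' : ℕ → α} {I I' : List α}
    (hT : IsPhases T N) (h : IsSorted T N w I) (h' : IsSorted T N w' I')
    (hfix : evL w I (phaseStart T N) = I) (hfix' : evL w' I' (phaseStart T N) = I') :
    ∃ f : α ≃ α, (∀ k < N, ∀ x, x ∈ T k ↔ f x ∈ T k) ∧ ∀ p < phaseStart T N, w' p = f (w p) := by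
  have hA := (agree_of_noBad hT h h' le_rfl (noBad_of_fixed hT h hfix)
    (noBad_of_fixed hT h' hfix')).1
  obtain ⟨f, hf, hfi⟩ := h.isOrd.exists_equiv h'.isOrd
  have hV : ∀ x, SameVec T N x (f x) := fun x => by
    refine h.isOrd.rel_of_idxOf_eq h'.isOrd (fun _ _ h => h.symm) (fun _ _ _ h h' => h.trans h')
      (fun x y hxy => ?_) (hfi x).symm (.refl _ _ _)
    have := hA.bef x x y y (.refl _ _ _) (.refl _ _ _) hxy
    rwa [Bef, Bef, hfix, hfix'] at this
  refine ⟨f, fun k hk x => hV x k hk, fun p hp => ?_⟩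
  have h2 := h.map (f := f) fun k hk x hx => (hV x k hk).1 hx
  rw [hf] at h2
  exact h'.ext h2 p hp

end WreathComplex

namespace WreathComplex

variable {α : Type*} [DecidableEq α]

/-! ### The phases that belong to a chain of row counts -/

theorem exists_cnt_eq {w : ℕ → α} {u i : ℕ} {r : α} (h0 : 1 ≤ i) (hi : i ≤ cnt w u r) :
    ∃ p < u, w p = r ∧ cnt w (p + 1) r = i := by
  induction u with
  | zero => rw [cnt_zero] at hi; omega
  | succ u ih =>
    by_cases h : i ≤ cnt w u r
    · obtain ⟨p, hp, hp'⟩ := ih h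
      exact ⟨p, by omega, hp'⟩
    · by_cases hr : w u = r
      · have := cnt_succ_self w u
        rw [hr] at this
        exact ⟨u, by omega, hr, by omega⟩
      · rw [cnt_succ_ne hr] at hi
        omega

theorem sum_cnt [Fintype α] (w : ℕ → α) (u : ℕ) : ∑ r, cnt w u r = u := by
  induction u with
  | zero => simp [cnt_zero]
  | succ u ih =>
    have : ∀ r, cnt w (u + 1) r = cnt w u r + if w u = r then 1 else 0 := fun r => by
      split_ifs with h
      · rw [← h, cnt_succ_self]
      · rw [cnt_succ_ne h, add_zero]
    simp [this, sum_add_distrib, ih]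

theorem le_iff_cnt_lt {w : ℕ → α} {s p : ℕ} :
    s ≤ p ↔ cnt w s (w p) < cnt w (p + 1) (w p) := by
  constructor
  · intro h
    have := cnt_mono w h (w p)
    rw [cnt_succ_self]
    omega
  · intro h
    by_contra hc
    exact h.not_ge (cnt_mono w (by omega) _)

theorem phaseStart_eq_sum [Fintype α] (T : ℕ → Finset α) (k : ℕ) :
    phaseStart T k = ∑ r, mult T k r := by
  simp only [phaseStart, mult, card_filter]
  rw [sum_comm]
  refine sum_congr rfl fun j _ => ?_
  rw [← card_filter]
  simp

theorem card_filter_lt_lt {K : Finset ℕ} {a b : ℕ} (ha : a ∈ K) :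
    #{q ∈ K | q < a} < #{q ∈ K | q < b} ↔ a < b := by
  constructor
  · intro h
    by_contra hc
    refine h.not_ge (card_le_card fun q hq => ?_)
    rw [mem_filter] at hq ⊢
    exact ⟨hq.1, by omega⟩
  · intro h
    refine card_lt_card ⟨fun q hq => ?_, fun hs => ?_⟩
    · rw [mem_filter] at hq ⊢
      exact ⟨hq.1, by omega⟩
    · have := hs (mem_filter.2 ⟨ha, h⟩)
      simp at this

section cells

variable [Fintype α] (w₀ : ℕ → α) (S : Finset ℕ) (l : ℕ)

/-- Ranks of `S` at which the row `r` has been chosen less than `i` times, according to `w₀`. -/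
noncomputable def cellBlock (r : α) (i : ℕ) : ℕ := #{s ∈ S | cnt w₀ s r < i}

/-- The sort key of the `i`-th choice of the row `r`. -/
noncomputable def cellKey (r : α) (i : ℕ) : ℕ := cellBlock w₀ S r i * (l + 1) + i

/-- The set of all sort keys. -/
noncomputable def cellKeys : Finset ℕ := ((univ : Finset α) ×ˢ Icc 1 l).image fun c => cellKey w₀ S l c.1 c.2

/-- The number of sort keys less than that of the `i`-th choice of the row `r`. -/
noncomputable def cellPhase (r : α) (i : ℕ) : ℕ := #{q ∈ cellKeys w₀ S l | q < cellKey w₀ S l r i}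

open Classical in
/-- The rows that are to be chosen in phase `k`. -/
noncomputable def cellRows (k : ℕ) : Finset α := {r | ∃ i ∈ Icc 1 l, cellPhase w₀ S l r i = k}

variable {w₀ S l}

theorem cellKey_mem {r : α} {i : ℕ} (hi : i ∈ Icc 1 l) : cellKey w₀ S l r i ∈ cellKeys w₀ S l :=
  mem_image.2 ⟨(r, i), mem_product.2 ⟨mem_univ _, hi⟩, rfl⟩

theorem cellPhase_lt_iff {r r' : α} {i i' : ℕ} (hi : i ∈ Icc 1 l) :
    cellPhase w₀ S l r i < cellPhase w₀ S l r' i' ↔ cellKey w₀ S l r i < cellKey w₀ S l r' i' :=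
  card_filter_lt_lt (cellKey_mem hi)

theorem cellPhase_eq_iff {r r' : α} {i i' : ℕ} (hi : i ∈ Icc 1 l) (hi' : i' ∈ Icc 1 l) :
    cellPhase w₀ S l r i = cellPhase w₀ S l r' i' ↔ cellKey w₀ S l r i = cellKey w₀ S l r' i' := by
  have h1 := cellPhase_lt_iff (w₀ := w₀) (S := S) (r := r) (r' := r') (i' := i') hi
  have h2 := cellPhase_lt_iff (w₀ := w₀) (S := S) (r := r') (r' := r) (i' := i) hi'
  omega

theorem cellPhase_mono {r : α} {i i' : ℕ} (hi : i ∈ Icc 1 l) (h : i < i') :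
    cellPhase w₀ S l r i < cellPhase w₀ S l r i' := by
  rw [cellPhase_lt_iff hi]
  have : cellBlock w₀ S r i ≤ cellBlock w₀ S r i' :=
    card_le_card fun s hs => by
      rw [mem_filter] at hs ⊢
      exact ⟨hs.1, by omega⟩
  exact add_lt_add_of_le_of_lt (Nat.mul_le_mul_right _ this) h

theorem cellKey_inj {r r' : α} {i i' : ℕ} (hi : i ∈ Icc 1 l) (hi' : i' ∈ Icc 1 l)
    (h : cellKey w₀ S l r i = cellKey w₀ S l r' i') : i = i' := by
  rw [mem_Icc] at hi hi'
  have := congrArg (· % (l + 1)) h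
  simp only [cellKey] at this
  rwa [mul_comm, Nat.mul_add_mod, mul_comm, Nat.mul_add_mod, Nat.mod_eq_of_lt (by omega),
    Nat.mod_eq_of_lt (by omega)] at this

theorem cellPhase_inj {r r' : α} {i i' : ℕ} (hi : i ∈ Icc 1 l) (hi' : i' ∈ Icc 1 l)
    (h : cellPhase w₀ S l r i = cellPhase w₀ S l r' i') : i = i' :=
  cellKey_inj hi hi' ((cellPhase_eq_iff hi hi').1 h)

theorem cellPhase_lt_card {r : α} {i : ℕ} (hi : i ∈ Icc 1 l) :
    cellPhase w₀ S l r i < #(cellKeys w₀ S l) := by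
  refine card_lt_card ⟨filter_subset _ _, fun h => ?_⟩
  have := h (cellKey_mem (w₀ := w₀) (S := S) (r := r) hi)
  simp at this

theorem exists_cellPhase {k : ℕ} (hk : k < #(cellKeys w₀ S l)) :
    ∃ r, ∃ i ∈ Icc 1 l, cellPhase w₀ S l r i = k := by
  have := surj_on_of_inj_on_of_card_le (s := cellKeys w₀ S l) (t := range #(cellKeys w₀ S l))
    (fun q _ => #{q' ∈ cellKeys w₀ S l | q' < q})
    (fun q hq => by
      obtain ⟨c, hc, rfl⟩ := mem_image.1 hq
      exact mem_range.2 (cellPhase_lt_card (mem_product.1 hc).2))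
    (fun a b ha hb e => by
      have h1 := card_filter_lt_lt (b := b) ha
      have h2 := card_filter_lt_lt (b := a) hb
      omega)
    (by simp) k (mem_range.2 hk)
  obtain ⟨q, hq, rfl⟩ := this
  obtain ⟨c, hc, rfl⟩ := mem_image.1 hq
  exact ⟨c.1, c.2, (mem_product.1 hc).2, rfl⟩

theorem mem_cellRows {r : α} {k : ℕ} :
    r ∈ cellRows w₀ S l k ↔ ∃ i ∈ Icc 1 l, cellPhase w₀ S l r i = k := by simp [cellRows]

theorem mult_cellRows (k : ℕ) (r : α) :
    mult (cellRows w₀ S l) k r = #{i ∈ Icc 1 l | cellPhase w₀ S l r i < k} := by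
  rw [mult, ← card_image_of_injOn (s := {i ∈ Icc 1 l | cellPhase w₀ S l r i < k})
    (f := cellPhase w₀ S l r) fun i hi i' hi' e =>
      cellPhase_inj (mem_filter.1 hi).1 (mem_filter.1 hi').1 e]
  congr 1
  ext j
  simp only [mem_filter, mem_range, mem_cellRows, mem_image]
  constructor
  · rintro ⟨hj, i, hi, rfl⟩
    exact ⟨i, ⟨hi, hj⟩, rfl⟩
  · rintro ⟨i, ⟨hi, hj⟩, rfl⟩
    exact ⟨hj, i, hi, rfl⟩

theorem mult_cellPhase {r : α} {i : ℕ} (hi : i ∈ Icc 1 l) :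
    mult (cellRows w₀ S l) (cellPhase w₀ S l r i) r + 1 = i := by
  have : ({i' ∈ Icc 1 l | cellPhase w₀ S l r i' < cellPhase w₀ S l r i} : Finset ℕ) =
      Icc 1 (i - 1) := by
    ext i'
    rw [mem_filter]
    rw [mem_Icc] at hi
    constructor
    · rintro ⟨h1, h2⟩
      have h3 : i' < i := by
        by_contra hc
        rcases (not_lt.1 hc).eq_or_lt with rfl | h
        · exact lt_irrefl _ h2
        · exact lt_asymm h2 (cellPhase_mono (mem_Icc.2 hi) h)
      rw [mem_Icc] at h1 ⊢
      omega
    · intro h1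
      rw [mem_Icc] at h1
      have : i' ∈ Icc 1 l := mem_Icc.2 (by omega)
      exact ⟨this, cellPhase_mono this (by omega)⟩
  rw [mult_cellRows, this, Nat.card_Icc]
  rw [mem_Icc] at hi
  omega

theorem isPhases_cellRows : IsPhases (cellRows w₀ S l) #(cellKeys w₀ S l) where
  nonempty k hk := by
    obtain ⟨r, hr⟩ := exists_cellPhase hk
    exact ⟨r, mem_cellRows.2 hr⟩
  level k _ x hx y hy := by
    obtain ⟨i, hi, h1⟩ := mem_cellRows.1 hx
    obtain ⟨i', hi', h2⟩ := mem_cellRows.1 hy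
    obtain rfl := cellPhase_inj hi hi' (h1.trans h2.symm)
    have e1 := mult_cellPhase (w₀ := w₀) (S := S) (r := x) hi
    have e2 := mult_cellPhase (w₀ := w₀) (S := S) (r := y) hi
    rw [h1] at e1
    rw [h2] at e2
    omega

theorem mult_numPhases (r : α) : mult (cellRows w₀ S l) #(cellKeys w₀ S l) r = l := by
  rw [mult_cellRows, filter_true_of_mem fun i hi => cellPhase_lt_card hi, Nat.card_Icc]
  omega

theorem phaseStart_numPhases {n : ℕ} (h₀ : ∀ r, cnt w₀ n r = l) :
    phaseStart (cellRows w₀ S l) #(cellKeys w₀ S l) = n := by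
  rw [phaseStart_eq_sum, ← sum_cnt w₀ n]
  exact sum_congr rfl fun r _ => by rw [mult_numPhases, h₀]

/-- The ranks of `S` are beginnings of phases. -/
theorem exists_phaseStart_eq {s : ℕ} (hs : s ∈ S) (hl : ∀ r, cnt w₀ s r ≤ l) :
    ∃ k ≤ #(cellKeys w₀ S l), phaseStart (cellRows w₀ S l) k = s ∧
      ∀ r, mult (cellRows w₀ S l) k r = cnt w₀ s r := by
  -- Threshold between the keys before and after rank `s`: as `i ≤ l`, comparing a key with `B` only
  -- compares block numbers.
  set B := #{s' ∈ S | s' ≤ s} * (l + 1) with hB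
  have hkey : ∀ r, ∀ i ∈ Icc 1 l, cellKey w₀ S l r i < B ↔ i ≤ cnt w₀ s r := by
    intro r i hi
    rw [mem_Icc] at hi
    have h1 : cellKey w₀ S l r i < B ↔ cellBlock w₀ S r i < #{s' ∈ S | s' ≤ s} := by
      rw [cellKey, hB]
      constructor
      · intro h
        by_contra hc
        have := Nat.mul_le_mul_right (l + 1) (not_lt.1 hc)
        omega
      · intro h
        have := Nat.mul_le_mul_right (l + 1) (Nat.succ_le_of_lt h)
        rw [Nat.succ_mul] at this
        omega
    rw [h1]
    constructor
    · intro h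
      by_contra hc
      refine h.not_ge (card_le_card fun s' hs' => ?_)
      rw [mem_filter] at hs' ⊢
      have := cnt_mono w₀ hs'.2 r
      exact ⟨hs'.1, by omega⟩
    · intro h
      refine card_lt_card ⟨fun s' hs' => ?_, fun hsub => ?_⟩
      · rw [mem_filter] at hs' ⊢
        refine ⟨hs'.1, ?_⟩
        by_contra hc
        have := cnt_mono w₀ (not_le.1 hc).le r
        omega
      · have := hsub (mem_filter.2 ⟨hs, le_rfl⟩)
        rw [mem_filter] at this
        omega
  have hm : ∀ r, mult (cellRows w₀ S l) #{q ∈ cellKeys w₀ S l | q < B} r = cnt w₀ s r := by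
    intro r
    have : ({i ∈ Icc 1 l | cellPhase w₀ S l r i < #{q ∈ cellKeys w₀ S l | q < B}} : Finset ℕ) =
        Icc 1 (cnt w₀ s r) := by
      ext i
      rw [mem_filter]
      have hl := hl r
      constructor
      · rintro ⟨hi, h⟩
        rw [cellPhase, card_filter_lt_lt (cellKey_mem hi), hkey r i hi] at h
        rw [mem_Icc] at hi ⊢
        omega
      · intro hi
        rw [mem_Icc] at hi
        have hi' : i ∈ Icc 1 l := mem_Icc.2 (by omega)
        rw [cellPhase, card_filter_lt_lt (cellKey_mem hi'), hkey r i hi']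
        exact ⟨hi', hi.2⟩
    rw [mult_cellRows, this, Nat.card_Icc]
    omega
  refine ⟨_, card_le_card (filter_subset _ _), ?_, hm⟩
  rw [phaseStart_eq_sum, ← sum_cnt w₀ s]
  exact sum_congr rfl fun r _ => hm r

/-- The rank `u + 1` is a descent of the word `w`, in the orders that evolve from `J`. -/
def Desc (w : ℕ → α) (J : List α) (u : ℕ) : Prop :=
  cnt w (u + 2) (w (u + 1)) < cnt w (u + 1) (w u) ∨
    cnt w (u + 1) (w u) = cnt w (u + 2) (w (u + 1)) ∧ Bef w J u (w (u + 1)) (w u)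

variable {n : ℕ} {w : ℕ → α} {J : List α}

/-- A rank of `S` is at most `p` exactly when the choice made at `p` is still to come there, so the
block number of a cell tells between which ranks of `S` it is chosen. -/
theorem cellBlock_eq (hS : ∀ s ∈ S, ∀ r, cnt w s r = cnt w₀ s r) (p : ℕ) :
    cellBlock w₀ S (w p) (cnt w (p + 1) (w p)) = #{s ∈ S | s ≤ p} := by
  unfold cellBlock
  congr 1
  ext s
  rw [mem_filter, mem_filter]
  refine and_congr_right fun hs => ?_
  rw [← hS s hs, le_iff_cnt_lt (w := w)]

theorem cnt_mem_Icc (hn : ∀ r, cnt w n r = l) {p : ℕ} (hp : p < n) :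
    cnt w (p + 1) (w p) ∈ Icc 1 l := by
  have := cnt_mono w (show p + 1 ≤ n from hp) (w p)
  rw [hn] at this
  rw [mem_Icc]
  refine ⟨?_, this⟩
  rw [cnt_succ_self]
  omega

theorem card_filter_le_succ (p : ℕ) :
    (p + 1 ∉ S ∧ #{s ∈ S | s ≤ p + 1} = #{s ∈ S | s ≤ p}) ∨
      (p + 1 ∈ S ∧ #{s ∈ S | s ≤ p} < #{s ∈ S | s ≤ p + 1}) := by
  by_cases h : p + 1 ∈ S
  · refine Or.inr ⟨h, card_lt_card ⟨fun s hs => ?_, fun hsub => ?_⟩⟩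
    · rw [mem_filter] at hs ⊢
      exact ⟨hs.1, by omega⟩
    · have := hsub (mem_filter.2 ⟨h, le_rfl⟩)
      rw [mem_filter] at this
      omega
  · refine Or.inl ⟨h, ?_⟩
    congr 1
    refine filter_congr fun s hs => ?_
    have : s ≠ p + 1 := fun e => h (e ▸ hs)
    omega

/-- A word without descents outside `S` lists the phases in their order. -/
theorem lt_phaseStart_iff (hn : ∀ r, cnt w n r = l)
    (hS : ∀ s ∈ S, ∀ r, cnt w s r = cnt w₀ s r)
    (hD : ∀ u, u + 1 < n → u + 1 ∉ S → cnt w (u + 1) (w u) ≤ cnt w (u + 2) (w (u + 1))) {p : ℕ}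
    (hp : p < n) (k : ℕ) : p < phaseStart (cellRows w₀ S l) k ↔
      cellPhase w₀ S l (w p) (cnt w (p + 1) (w p)) < k := by
  -- Off `S` the block number stays and the label does not drop. At a rank of `S` the block number
  -- grows, and the factor `l + 1` outweighs any drop of the label.
  have hstep : ∀ p, p + 1 < n → cellPhase w₀ S l (w p) (cnt w (p + 1) (w p)) ≤
      cellPhase w₀ S l (w (p + 1)) (cnt w (p + 1 + 1) (w (p + 1))) := by
    intro p hp
    have h1 := cnt_mem_Icc hn (show p < n by omega)
    have h2 := cnt_mem_Icc hn hp
    rw [← not_lt, cellPhase_lt_iff h2, not_lt, cellKey, cellKey, cellBlock_eq hS, cellBlock_eq hS]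
    rcases card_filter_le_succ (S := S) p with ⟨h, e⟩ | ⟨h, e⟩
    · rw [e]
      exact Nat.add_le_add_left (hD p hp h) _
    · have := Nat.mul_le_mul_right (l + 1) (Nat.succ_le_of_lt e)
      rw [Nat.succ_mul] at this
      rw [mem_Icc] at h1
      omega
  have hmono : ∀ p q, p ≤ q → q < n → cellPhase w₀ S l (w p) (cnt w (p + 1) (w p)) ≤
      cellPhase w₀ S l (w q) (cnt w (q + 1) (w q)) := by
    intro p q hpq
    induction q, hpq using Nat.le_induction with
    | base => exact fun _ => le_rfl
    | succ q _ ih => exact fun hq => (ih (by omega)).trans (hstep q hq)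
  -- the ranks at which phase `k` has not yet begun form an initial segment
  obtain ⟨v, hv, hvk⟩ : ∃ v ≤ n, ∀ p < n,
      p < v ↔ cellPhase w₀ S l (w p) (cnt w (p + 1) (w p)) < k := by
    by_cases h : ∃ p < n, ¬ cellPhase w₀ S l (w p) (cnt w (p + 1) (w p)) < k
    · classical
      refine ⟨Nat.find h, (Nat.find_spec h).1.le, fun p hp => ⟨fun hlt => ?_, fun hlt => ?_⟩⟩
      · by_contra hc
        exact Nat.find_min h hlt ⟨hp, hc⟩
      · by_contra hc
        exact (Nat.find_spec h).2 ((hmono _ _ (not_lt.1 hc) hp).trans_lt hlt)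
    · push Not at h
      exact ⟨n, le_rfl, fun p hp => iff_of_true hp (h p hp)⟩
  have hcnt : ∀ r, mult (cellRows w₀ S l) k r = cnt w v r := by
    intro r
    have hl : cnt w v r ≤ l := hn r ▸ cnt_mono w hv r
    have : ({i ∈ Icc 1 l | cellPhase w₀ S l r i < k} : Finset ℕ) = Icc 1 (cnt w v r) := by
      ext i
      rw [mem_filter]
      have key : i ∈ Icc 1 l → (cellPhase w₀ S l r i < k ↔ i ≤ cnt w v r) := by
        intro hi
        rw [mem_Icc] at hi
        obtain ⟨p, hp, rfl, rfl⟩ := exists_cnt_eq (w := w) (u := n) hi.1 (hn r ▸ hi.2)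
        rw [← hvk p hp]
        constructor
        · exact fun h => cnt_mono w h _
        · intro h
          by_contra hc
          have := cnt_mono w (not_lt.1 hc) (w p)
          rw [cnt_succ_self] at h
          omega
      constructor
      · rintro ⟨hi, h⟩
        exact mem_Icc.2 ⟨(mem_Icc.1 hi).1, (key hi).1 h⟩
      · intro hi
        rw [mem_Icc] at hi
        have hi' : i ∈ Icc 1 l := mem_Icc.2 (by omega)
        exact ⟨hi', (key hi').2 hi.2⟩
    rw [mult_cellRows, this, Nat.card_Icc]
    omega
  have : phaseStart (cellRows w₀ S l) k = v := by
    rw [phaseStart_eq_sum, ← sum_cnt w v]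
    exact sum_congr rfl fun r _ => hcnt r
  rw [this, hvk p hp]

/-- By `lt_phaseStart_iff` the phases occupy their proper positions. Within a phase the labels are
equal, so only the order decides, and the absence of descents sorts neighbours. -/
theorem isSorted_of_desc (h₀ : ∀ r, cnt w₀ n r = l) (hn : ∀ r, cnt w n r = l)
    (hS : ∀ s ∈ S, ∀ r, cnt w s r = cnt w₀ s r) (hJ : IsOrd J)
    (hD : ∀ u, u + 1 < n → Desc w J u → u + 1 ∈ S) :
    IsSorted (cellRows w₀ S l) #(cellKeys w₀ S l) w J := by
  have hlt := fun {p} (hp : p < n) k => lt_phaseStart_iff hn hS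
    (fun u hu hu' => by
      by_contra hc
      exact hu' (hD u hu (Or.inl (not_le.1 hc)))) hp k
  have hphase : ∀ k < #(cellKeys w₀ S l), ∀ i < #(cellRows w₀ S l k),
      phaseStart (cellRows w₀ S l) k + i < n ∧
      cellPhase w₀ S l (w (phaseStart (cellRows w₀ S l) k + i))
        (cnt w (phaseStart (cellRows w₀ S l) k + i + 1)
          (w (phaseStart (cellRows w₀ S l) k + i))) = k := by
    intro k hk i hi
    have h1 := phaseStart_mono (cellRows w₀ S l) (show k + 1 ≤ #(cellKeys w₀ S l) from hk)
    rw [phaseStart_succ, phaseStart_numPhases h₀] at h1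
    have hn' : phaseStart (cellRows w₀ S l) k + i < n := by omega
    refine ⟨hn', ?_⟩
    have h2 := hlt hn' k
    have h3 := hlt hn' (k + 1)
    rw [phaseStart_succ] at h3
    omega
  have hmem : ∀ k < #(cellKeys w₀ S l), ∀ i < #(cellRows w₀ S l k),
      w (phaseStart (cellRows w₀ S l) k + i) ∈ cellRows w₀ S l k := fun k hk i hi =>
    mem_cellRows.2 ⟨_, cnt_mem_Icc hn (hphase k hk i hi).1, (hphase k hk i hi).2⟩
  have hcnt : ∀ k < #(cellKeys w₀ S l), ∀ i < #(cellRows w₀ S l k), ∀ j < #(cellRows w₀ S l k),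
      cnt w (phaseStart (cellRows w₀ S l) k + i + 1)
          (w (phaseStart (cellRows w₀ S l) k + i)) =
        cnt w (phaseStart (cellRows w₀ S l) k + j + 1)
          (w (phaseStart (cellRows w₀ S l) k + j)) := fun k hk i hi j hj =>
    cellPhase_inj (cnt_mem_Icc hn (hphase k hk i hi).1) (cnt_mem_Icc hn (hphase k hk j hj).1)
      ((hphase k hk i hi).2.trans (hphase k hk j hj).2.symm)
  have hne : ∀ k < #(cellKeys w₀ S l), ∀ i j, i < j → j < #(cellRows w₀ S l k) →
      w (phaseStart (cellRows w₀ S l) k + i) ≠ w (phaseStart (cellRows w₀ S l) k + j) := by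
    intro k hk i j hij hj e
    have h1 := hcnt k hk i (by omega) j hj
    rw [e, cnt_succ_self] at h1
    have := cnt_mono w (show phaseStart (cellRows w₀ S l) k + i + 1 ≤
      phaseStart (cellRows w₀ S l) k + j by omega) (w (phaseStart (cellRows w₀ S l) k + j))
    omega
  refine ⟨hJ, hmem, fun k hk i j hij => ?_⟩
  have hstep : ∀ i, i + 1 < #(cellRows w₀ S l k) → Bef w J (phaseStart (cellRows w₀ S l) k)
      (w (phaseStart (cellRows w₀ S l) k + i))
      (w (phaseStart (cellRows w₀ S l) k + (i + 1))) := by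
    intro i hi
    rw [← Bef.untouched hJ (u' := phaseStart (cellRows w₀ S l) k + i) (by omega)
      (fun p h1 h2 => ?_) fun p h1 h2 => ?_]
    · have hn1 := (hphase k hk i (by omega)).1
      have hn2 := (hphase k hk (i + 1) hi).1
      -- Both choices have the same key, while a rank of `S` between them would raise the block
      -- number.
      have hS' : phaseStart (cellRows w₀ S l) k + i + 1 ∉ S := by
        intro hs
        have h1 := (hphase k hk i (by omega)).2.trans (hphase k hk (i + 1) hi).2.symm
        rw [cellPhase_eq_iff (cnt_mem_Icc hn hn1) (cnt_mem_Icc hn hn2), cellKey, cellKey,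
          cellBlock_eq hS, cellBlock_eq hS, hcnt k hk i (by omega) (i + 1) hi] at h1
        have h2 := Nat.eq_of_mul_eq_mul_right (Nat.succ_pos l) (Nat.add_right_cancel h1)
        rcases card_filter_le_succ (S := S) (phaseStart (cellRows w₀ S l) k + i) with
          ⟨h, -⟩ | ⟨-, h⟩
        · exact h hs
        · rw [← add_assoc] at h2
          omega
      have hd := mt (hD _ (by omega)) hS'
      rw [← Bef.not_iff w hJ _ (hne k hk i (i + 1) (by omega) hi).symm]
      exact fun hb => hd (Or.inr ⟨hcnt k hk i (by omega) (i + 1) hi, hb⟩)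
    · obtain ⟨a, rfl⟩ := Nat.exists_eq_add_of_le h1
      exact hne k hk a i (by omega) (by omega)
    · obtain ⟨a, rfl⟩ := Nat.exists_eq_add_of_le h1
      exact hne k hk a (i + 1) (by omega) hi
  induction j, hij using Nat.le_induction with
  | base => exact hstep i
  | succ j _ ih => exact fun hj => (ih (by omega)).trans (hstep j hj)

variable (h : IsSorted (cellRows w₀ S l) #(cellKeys w₀ S l) w J)
include h

theorem IsSorted.cnt_end (h₀ : ∀ r, cnt w₀ n r = l) (r : α) : cnt w n r = l := by
  rw [← phaseStart_numPhases (S := S) h₀, h.cnt_eq le_rfl, mult_numPhases]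

theorem IsSorted.cnt_of_mem (h₀ : ∀ r, cnt w₀ n r = l) {s : ℕ} (hs : s ∈ S) (hsn : s ≤ n) (r : α) :
    cnt w s r = cnt w₀ s r := by
  obtain ⟨k, hk, rfl, hm⟩ := exists_phaseStart_eq (w₀ := w₀) (l := l) hs fun r =>
    h₀ r ▸ cnt_mono w₀ hsn r
  rw [h.cnt_eq hk, hm]

/-- Off `S` the block number does not change, so a descent of labels would lower the key, against
the order of phases. Equal labels mean the same phase, where the order at its start still holds for
two letters not yet chosen in it. -/
theorem IsSorted.mem_of_desc (h₀ : ∀ r, cnt w₀ n r = l) (hSn : ∀ s ∈ S, s ≤ n) {u : ℕ}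
    (hu : u + 1 < n) (hd : Desc w J u) : u + 1 ∈ S := by
  by_contra hS
  have hn := h.cnt_end h₀
  have hcell : ∀ k < #(cellKeys w₀ S l), ∀ i < #(cellRows w₀ S l k),
      cellPhase w₀ S l (w (phaseStart (cellRows w₀ S l) k + i))
        (cnt w (phaseStart (cellRows w₀ S l) k + i + 1)
          (w (phaseStart (cellRows w₀ S l) k + i))) = k := by
    intro k hk i hi
    obtain ⟨c, hc, e⟩ := mem_cellRows.1 (h.mem k hk i hi)
    have h1 := mult_cellPhase (w₀ := w₀) (S := S) (l := l)
      (r := w (phaseStart (cellRows w₀ S l) k + i)) hc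
    rw [e, ← h.cnt_eq hk.le] at h1
    rw [add_assoc, h.cnt_mid hk hi (Nat.succ_le_of_lt hi), if_pos i.lt_succ_self, h1, e]
  have hnum := phaseStart_numPhases (S := S) h₀
  obtain ⟨k, hk, i, hi, rfl⟩ := exists_phase (cellRows w₀ S l)
    (show u < phaseStart _ #(cellKeys w₀ S l) by omega)
  obtain ⟨k', hk', i', hi', e'⟩ := exists_phase (cellRows w₀ S l) (hu.trans_eq hnum.symm)
  have hc := hcell k hk i hi
  have hc' := hcell k' hk' i' hi'
  rw [← e'] at hc'
  have hI := cnt_mem_Icc hn (show phaseStart (cellRows w₀ S l) k + i < n by omega)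
  have hI' := cnt_mem_Icc hn hu
  have hb : cellBlock w₀ S (w (phaseStart (cellRows w₀ S l) k + i + 1))
      (cnt w (phaseStart (cellRows w₀ S l) k + i + 1 + 1)
        (w (phaseStart (cellRows w₀ S l) k + i + 1))) =
      cellBlock w₀ S (w (phaseStart (cellRows w₀ S l) k + i))
      (cnt w (phaseStart (cellRows w₀ S l) k + i + 1)
        (w (phaseStart (cellRows w₀ S l) k + i))) := by
    rw [cellBlock_eq fun s hs => h.cnt_of_mem h₀ hs (hSn s hs),
      cellBlock_eq fun s hs => h.cnt_of_mem h₀ hs (hSn s hs)]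
    rcases card_filter_le_succ (S := S) (phaseStart (cellRows w₀ S l) k + i) with ⟨-, e⟩ | ⟨e, -⟩
    · exact e
    · exact absurd e hS
  have hkk : k ≤ k' := by
    by_contra hlt
    have := phaseStart_mono (cellRows w₀ S l) (show k' + 1 ≤ k by omega)
    rw [phaseStart_succ] at this
    omega
  rcases hd with hd | ⟨hd, hbef⟩
  · have := cellPhase_lt_iff (w₀ := w₀) (S := S) (l := l)
      (r := w (phaseStart (cellRows w₀ S l) k + i + 1))
      (r' := w (phaseStart (cellRows w₀ S l) k + i)) hI' (i' := cnt w
        (phaseStart (cellRows w₀ S l) k + i + 1) (w (phaseStart (cellRows w₀ S l) k + i)))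
    rw [hc, hc', cellKey, cellKey, hb] at this
    have := this.2 (Nat.add_lt_add_left hd _)
    omega
  · have := cellPhase_eq_iff (w₀ := w₀) (S := S) (r := w (phaseStart (cellRows w₀ S l) k + i))
      (r' := w (phaseStart (cellRows w₀ S l) k + i + 1)) hI hI'
    rw [hc, hc', cellKey, cellKey, hb] at this
    obtain rfl := this.2 (congrArg _ hd)
    obtain rfl : i' = i + 1 := by omega
    have h1 := h.sorted k hk i (i + 1) i.lt_succ_self hi'
    rw [← Bef.untouched h.isOrd (u' := phaseStart (cellRows w₀ S l) k + i) (by omega)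
      (fun p h1 h2 => ?_) fun p h1 h2 => ?_] at h1
    · exact h1.asymm hbef
    · exact h.ne_of_pos hk hi h1 (by rw [phaseStart_succ]; omega) (by omega)
    · exact h.ne_of_pos hk hi' h1 (by rw [phaseStart_succ]; omega) (by omega)

end cells

end WreathComplex

namespace WreathComplex

/-! ### Words of finite length -/

theorem exists_extend {n m : ℕ} (hn : 0 < n) (w : Fin n → Fin m) :
    ∃ e : ℕ → Fin m, ∀ p : Fin n, e p = w p :=
  ⟨fun p => if h : p < n then w ⟨p, h⟩ else w ⟨0, hn⟩, fun p => by simp⟩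

theorem isOrd_finRange (m : ℕ) : IsOrd (List.finRange m) :=
  ⟨List.nodup_finRange m, List.mem_finRange⟩

section

variable {n m : ℕ} {w : Fin n → Fin m} {e : ℕ → Fin m} (he : ∀ p : Fin n, e p = w p)
include he

theorem finalOrder_eq_evL : finalOrder w = evL e (List.finRange m) n :=
  evolve_eq_evL he _ le_rfl

theorem isOrd_finalOrder : IsOrd (finalOrder w) := by
  rw [finalOrder_eq_evL he]
  exact evL_isOrd _ (isOrd_finRange m) _

theorem isDescent_iff {u : ℕ} (hu : u + 1 < n) :
    IsDescent w u hu ↔ Desc e (finalOrder w) u := by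
  have h1 : w ⟨u, by omega⟩ = e u := (he _).symm
  have h2 : w ⟨u + 1, hu⟩ = e (u + 1) := (he _).symm
  simp only [IsDescent, rho, Desc, Bef, h1, h2]
  rw [evolve_eq_evL he _ (show u ≤ n by omega), rowCount_eq_cnt he (by omega),
    rowCount_eq_cnt he (by omega)]

theorem mem_descentRanks_iff {k : ℕ} :
    k ∈ descentRanks w ↔ ∃ u, u + 1 < n ∧ k = u + 1 ∧ Desc e (finalOrder w) u := by
  classical
  rw [descentRanks, mem_filter, mem_range]
  constructor
  · rintro ⟨-, u, hu, rfl, hd⟩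
    exact ⟨u, hu, rfl, (isDescent_iff he hu).1 hd⟩
  · rintro ⟨u, hu, rfl, hd⟩
    exact ⟨hu, u, hu, rfl, (isDescent_iff he hu).2 hd⟩

/-- For `J` a fixed point this identifies the wrap-around order with `J`. -/
theorem finalOrder_eq_of_pos (hc : ∀ r, 0 < rowCount w n r) {J : List (Fin m)} (hJ : IsOrd J) :
    finalOrder w = evL e J n := by
  rw [finalOrder_eq_evL he]
  refine evL_init (isOrd_finRange m) hJ fun r => ?_
  rw [← rowCount_eq_cnt he le_rfl]
  exact hc r

end

theorem mem_Ioo_of_mem_descentRanks {n m : ℕ} {w : Fin n → Fin m} {k : ℕ}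
    (hk : k ∈ descentRanks w) : k ∈ Ioo 0 n := by
  classical
  rw [descentRanks, mem_filter] at hk
  obtain ⟨-, u, hu, rfl, -⟩ := hk
  exact mem_Ioo.2 ⟨u.succ_pos, hu⟩

/-- The descents do not depend on the numbering of the rows. -/
theorem descentRanks_perm {n m : ℕ} {w : Fin n → Fin m} (hc : ∀ r, 0 < rowCount w n r)
    (f : Equiv.Perm (Fin m)) : descentRanks (fun p => f (w p)) = descentRanks w := by
  rcases Nat.eq_zero_or_pos n with rfl | hn
  · simp [descentRanks]
  obtain ⟨e, he⟩ := exists_extend hn w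
  set w' : Fin n → Fin m := fun p => f (w p) with hw'
  set e' : ℕ → Fin m := fun p => f (e p) with hee'
  have he' : ∀ p : Fin n, e' p = w' p := fun p => congrArg f (he p)
  have hcnt : ∀ u r, cnt e' u (f r) = cnt e u r := fun u r => by
    simp only [cnt, hee', f.injective.eq_iff]
    congr!
  have hJ := isOrd_finalOrder he
  -- Renaming moves the identity order to another one, which is harmless because all letters get
  -- chosen.
  have hfinal : finalOrder w' = (finalOrder w).map f := by
    have hord : IsOrd ((List.finRange m).map f) :=
      ⟨(List.nodup_finRange m).map f.injective, fun x =>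
        List.mem_map.2 ⟨f.symm x, List.mem_finRange _, f.apply_symm_apply x⟩⟩
    rw [finalOrder_eq_of_pos he' (fun r => ?_) hord, evL_map, finalOrder_eq_evL he]
    rw [rowCount_eq_cnt he' le_rfl, ← f.apply_symm_apply r, hcnt, ← rowCount_eq_cnt he le_rfl]
    exact hc _
  ext k
  rw [mem_descentRanks_iff he, mem_descentRanks_iff he', hfinal]
  refine exists_congr fun u => and_congr_right fun _ => and_congr_right fun _ => ?_
  rw [Desc, Desc, Bef.map f, hcnt, hcnt]

/-! ### Existence and uniqueness of the word for given row counts -/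

section core

variable {l m : ℕ} {w₀ : Fin (l * m) → Fin m} {S : Finset ℕ}
  (h₀ : ∀ r, rowCount w₀ (l * m) r = l) (hS : ∀ s ∈ S, s ≤ l * m)
include h₀ hS

/-- Each chain of row counts is refined by a word whose descents all belong to the chain. -/
theorem exists_word : ∃ w : Fin (l * m) → Fin m, (∀ r, rowCount w (l * m) r = l) ∧
    (∀ s ∈ S, ∀ r, rowCount w s r = rowCount w₀ s r) ∧ descentRanks w ⊆ S := by
  rcases Nat.eq_zero_or_pos (l * m) with hn | hn
  · refine ⟨w₀, h₀, fun _ _ _ => rfl, fun k hk => ?_⟩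
    have := mem_Ioo.1 (mem_Ioo_of_mem_descentRanks hk)
    omega
  obtain ⟨e₀, he₀⟩ := exists_extend hn w₀
  have hl := Nat.pos_of_mul_pos_right hn
  have hm := Nat.pos_of_mul_pos_left hn
  have h₀' : ∀ r, cnt e₀ (l * m) r = l := fun r => by rw [← rowCount_eq_cnt he₀ le_rfl, h₀]
  have : Nonempty (Fin m) := ⟨⟨0, by omega⟩⟩
  obtain ⟨e, J, h, hfix⟩ := exists_isSorted_fixed (isPhases_cellRows (w₀ := e₀) (S := S) (l := l))
    (isOrd_finRange m)
  rw [phaseStart_numPhases h₀'] at hfix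
  have he : ∀ p : Fin (l * m), e p = (fun q : Fin (l * m) => e q) p := fun p => rfl
  have hbal : ∀ r, rowCount (fun q : Fin (l * m) => e q) (l * m) r = l := fun r => by
    rw [rowCount_eq_cnt he le_rfl, h.cnt_end h₀']
  refine ⟨fun q => e q, hbal, fun s hs r => ?_, fun k hk => ?_⟩
  · rw [rowCount_eq_cnt he (hS s hs), rowCount_eq_cnt he₀ (hS s hs), h.cnt_of_mem h₀' hs (hS s hs)]
  -- The final order of the word is `J` itself, so its descents are taken in the orders that sort
  -- it.
  · rw [mem_descentRanks_iff he, finalOrder_eq_of_pos he (fun r => (hbal r).symm ▸ by omega) h.isOrd,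
      hfix] at hk
    obtain ⟨u, hu, rfl, hd⟩ := hk
    exact h.mem_of_desc h₀' hS hu hd

/-- The word is unique up to a permutation of the rows. -/
theorem exists_perm_of_descentRanks_subset {w w' : Fin (l * m) → Fin m}
    (hw : ∀ r, rowCount w (l * m) r = l) (hw' : ∀ r, rowCount w' (l * m) r = l)
    (hSw : ∀ s ∈ S, ∀ r, rowCount w s r = rowCount w₀ s r)
    (hSw' : ∀ s ∈ S, ∀ r, rowCount w' s r = rowCount w₀ s r)
    (hD : descentRanks w ⊆ S) (hD' : descentRanks w' ⊆ S) :
    ∃ f : Equiv.Perm (Fin m), ∀ p, w' p = f (w p) := by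
  rcases Nat.eq_zero_or_pos (l * m) with hn | hn
  · exact ⟨1, fun p => absurd p.2 (by omega)⟩
  obtain ⟨e₀, he₀⟩ := exists_extend hn w₀
  have hl : 0 < l := Nat.pos_of_mul_pos_right hn
  have h₀' : ∀ r, cnt e₀ (l * m) r = l := fun r => by rw [← rowCount_eq_cnt he₀ le_rfl, h₀]
  have key : ∀ {w : Fin (l * m) → Fin m}, (∀ r, rowCount w (l * m) r = l) →
      (∀ s ∈ S, ∀ r, rowCount w s r = rowCount w₀ s r) → descentRanks w ⊆ S →
      ∀ {e : ℕ → Fin m}, (∀ p : Fin (l * m), e p = w p) →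
      IsSorted (cellRows e₀ S l) #(cellKeys e₀ S l) e (finalOrder w) ∧
      evL e (finalOrder w) (l * m) = finalOrder w := by
    intro w hw hSw hD e he
    have hJ := isOrd_finalOrder he
    refine ⟨isSorted_of_desc h₀' (fun r => ?_) (fun s hs r => ?_) hJ fun u hu hd => ?_, ?_⟩
    · rw [← rowCount_eq_cnt he le_rfl, hw]
    · rw [← rowCount_eq_cnt he (hS s hs), ← rowCount_eq_cnt he₀ (hS s hs), hSw s hs]
    · exact hD ((mem_descentRanks_iff he).2 ⟨u, hu, rfl, hd⟩)
    · rw [← finalOrder_eq_of_pos he (fun r => (hw r).symm ▸ hl) hJ]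
  obtain ⟨e, he⟩ := exists_extend hn w
  obtain ⟨e', he'⟩ := exists_extend hn w'
  obtain ⟨h1, h2⟩ := key hw hSw hD he
  obtain ⟨h1', h2'⟩ := key hw' hSw' hD' he'
  have hnum := phaseStart_numPhases (S := S) h₀'
  obtain ⟨f, -, hf⟩ := exists_equiv_of_fixed isPhases_cellRows h1 h1' (by rwa [hnum])
    (by rwa [hnum])
  refine ⟨f, fun p => ?_⟩
  rw [← he, ← he', hf p (by rw [hnum]; exact p.2)]

end core

end WreathComplex

namespace WreathComplex

/-! ### Row counts -/

section

variable {n m : ℕ} (w : Fin n → Fin m)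

theorem rowCount_mono {a b : ℕ} (h : a ≤ b) (r : Fin m) : rowCount w a r ≤ rowCount w b r :=
  card_le_card fun p hp => by
    rw [mem_filter] at hp ⊢
    exact ⟨hp.1, hp.2.1.trans_le h, hp.2.2⟩

theorem rowCount_lt_succ_iff (p : Fin n) (r : Fin m) :
    rowCount w p r < rowCount w (p + 1) r ↔ w p = r := by
  constructor
  · intro h
    by_contra hr
    refine h.not_ge (card_le_card fun q hq => ?_)
    rw [mem_filter] at hq ⊢
    refine ⟨hq.1, lt_of_le_of_ne (by omega) fun e => hr ?_, hq.2.2⟩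
    rw [← Fin.ext e]
    exact hq.2.2
  · intro hr
    refine card_lt_card ⟨fun q hq => ?_, fun h => ?_⟩
    · rw [mem_filter] at hq ⊢
      exact ⟨hq.1, by omega, hq.2.2⟩
    · have := h (mem_filter.2 ⟨mem_univ p, p.1.lt_succ_self, hr⟩)
      simp at this

variable {w}

theorem rowCount_perm (f : Equiv.Perm (Fin m)) (k : ℕ) (r : Fin m) :
    rowCount (fun p => f (w p)) k (f r) = rowCount w k r := by
  simp [rowCount]

theorem eq_of_rowCount_eq {w' : Fin n → Fin m} {f : Fin m → Fin m}
    (h : ∀ k ≤ n, ∀ r, rowCount w' k (f r) = rowCount w k r) (p : Fin n) : w' p = f (w p) := by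
  rw [← rowCount_lt_succ_iff, h _ (by omega), h _ p.2, rowCount_lt_succ_iff]

end

section

variable {l m : ℕ}

/-- A word that contains each row `l` times is the word of a saturated chain. -/
theorem exists_equiv_of_word {w : Fin (l * m) → Fin m} (hw : ∀ r, rowCount w (l * m) r = l) :
    ∃ e : Fin (l * m) ≃ Fin m × Fin l, ∀ p, (e p).1 = w p := by
  have hlt : ∀ p : Fin (l * m), rowCount w p (w p) < l := fun p =>
    ((rowCount_lt_succ_iff w p (w p)).2 rfl).trans_le
      ((rowCount_mono w p.2 (w p)).trans_eq (hw _))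
  -- Each row is filled from left to right.
  let f : Fin (l * m) → Fin m × Fin l := fun p => (w p, ⟨rowCount w p (w p), hlt p⟩)
  have hf : Function.Bijective f := by
    rw [Fintype.bijective_iff_injective_and_card]
    refine ⟨fun p q hpq => ?_, by simp [mul_comm]⟩
    have h1 : w p = w q := congrArg Prod.fst hpq
    have h2 : rowCount w p (w p) = rowCount w q (w q) :=
      congrArg (fun x : Fin m × Fin l => (x.2 : ℕ)) hpq
    have key : ∀ p q : Fin (l * m), w p = w q → p < q →
        rowCount w p (w p) < rowCount w q (w q) := fun p q e hpq => by
      rw [← e]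
      exact ((rowCount_lt_succ_iff w p (w p)).2 rfl).trans_le (rowCount_mono w hpq _)
    rcases lt_trichotomy p q with h | h | h
    · exact absurd h2 (key p q h1 h).ne
    · exact h
    · exact absurd h2.symm (key q p h1.symm h).ne
  exact ⟨Equiv.ofBijective f hf, fun p => rfl⟩

/-! ### Faces of the quotient complex as orbits of faces of saturated chains -/

theorem Face.orbit_smul (g : wreath l m) (a : Face l m) : (g • a).orbit = a.orbit :=
  Face.orbit_eq_iff.2 ⟨g, rfl⟩

/-- The ranks of the elements of a face. -/
def Face.ranks (a : Face l m) : Finset ℕ := a.elems.image card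

theorem Face.ranks_eq_of_orbit_eq {a b : Face l m} (h : a.orbit = b.orbit) :
    a.ranks = b.ranks := by
  obtain ⟨g, rfl⟩ := Face.orbit_eq_iff.1 h
  rw [Face.ranks, Face.ranks, smul_elems, image_image]
  exact image_congr fun u _ => card_image_of_injective _ g.1.injective

variable {e e' : Fin (l * m) ≃ Fin m × Fin l} {S S' : Finset ℕ}

theorem mem_level {k : ℕ} {x : Fin m × Fin l} : x ∈ level e k ↔ (e.symm x : ℕ) < k := by
  simp [level]

theorem mem_chainFace {u : Subsets l m} :
    u ∈ (chainFace e S).elems ↔ ∃ k ∈ S, (0 < k ∧ k < l * m) ∧ level e k = u := by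
  simp [chainFace, and_assoc]

theorem chainFace_range (e : Fin (l * m) ≃ Fin m × Fin l) :
    chainFace e (range (l * m)) = chainFace e (Ioo 0 (l * m)) := by
  apply Face.ext
  ext u
  simp only [mem_chainFace, mem_range, mem_Ioo]
  exact exists_congr fun k => by tauto

theorem ranks_chainFace (hS : S ⊆ Ioo 0 (l * m)) : (chainFace e S).ranks = S := by
  ext k
  simp only [Face.ranks, mem_image, mem_chainFace]
  constructor
  · rintro ⟨u, ⟨k, hk, hk', rfl⟩, rfl⟩
    rwa [card_level e hk'.2.le]
  · intro hk
    have := mem_Ioo.1 (hS hk)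
    exact ⟨_, ⟨k, hk, this, rfl⟩, card_level e this.2.le⟩

theorem chainFace_elems_mono (h : S ⊆ S') : (chainFace e S).elems ⊆ (chainFace e S').elems :=
  fun u hu => by
    obtain ⟨k, hk, hk'⟩ := mem_chainFace.1 hu
    exact mem_chainFace.2 ⟨k, h hk, hk'⟩

theorem orbit_chainFace_mono (h : S ⊆ S') : (chainFace e S).orbit ≤ (chainFace e S').orbit :=
  ⟨_, _, rfl, rfl, chainFace_elems_mono h⟩

/-- The group preserves cardinalities, so the ranks of a face can be read off its orbit. -/
theorem subset_of_orbit_le (hS : S ⊆ Ioo 0 (l * m)) (hS' : S' ⊆ Ioo 0 (l * m))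
    (h : (chainFace e S).orbit ≤ (chainFace e' S').orbit) : S ⊆ S' := by
  obtain ⟨a, b, ha, hb, hab⟩ := h
  rw [← ranks_chainFace (e := e) hS, ← ranks_chainFace (e := e') hS',
    ← Face.ranks_eq_of_orbit_eq ha, ← Face.ranks_eq_of_orbit_eq hb]
  exact image_subset_image hab

theorem exists_of_le_orbit {x : QFace l m} (h : x ≤ (chainFace e S').orbit) :
    ∃ S ⊆ S', x = (chainFace e S).orbit := by
  classical
  obtain ⟨a, b, rfl, hb, hab⟩ := h
  obtain ⟨g, hg⟩ := Face.orbit_eq_iff.1 hb.symm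
  have hsub := smul_elems_subset g hab
  rw [hg] at hsub
  refine ⟨{k ∈ S' | level e k ∈ (g • a).elems}, filter_subset _ _, ?_⟩
  rw [← Face.orbit_smul g a]
  congr 1
  apply Face.ext
  ext u
  rw [mem_chainFace]
  constructor
  · intro hu
    obtain ⟨k, hk, hk', rfl⟩ := mem_chainFace.1 (hsub hu)
    exact ⟨k, mem_filter.2 ⟨hk, hu⟩, hk', rfl⟩
  · rintro ⟨k, hk, -, rfl⟩
    exact (mem_filter.1 hk).2

/-- Each face is part of a saturated chain. -/
theorem exists_chainFace (a : Face l m) :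
    ∃ (e : Fin (l * m) ≃ Fin m × Fin l) (S : Finset ℕ), S ⊆ Ioo 0 (l * m) ∧
      a = chainFace e S := by
  classical
  -- Sorting the entries by the number of chain elements that miss them makes every element of the
  -- chain an initial segment.
  let f : Fin m × Fin l → ℕ := fun x => #{u ∈ a.elems | x ∉ u}
  have hf : ∀ u ∈ a.elems, ∀ x ∈ u, ∀ y ∉ u, f x < f y := by
    intro u hu x hx y hy
    refine card_lt_card ⟨fun v hv => ?_, fun h => ?_⟩
    · rw [mem_filter] at hv ⊢
      refine ⟨hv.1, fun hyv => ?_⟩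
      rcases a.chain.total hu hv.1 with h | h
      · exact hv.2 (h hx)
      · exact hy (h hyv)
    · exact (mem_filter.1 (h (mem_filter.2 ⟨hu, hy⟩))).2 hx
  have e₀ : Fin (l * m) ≃ Fin m × Fin l :=
    Fintype.equivOfCardEq (by simp [mul_comm])
  let e : Fin (l * m) ≃ Fin m × Fin l := (Tuple.sort (f ∘ e₀)).trans e₀
  have hmono : ∀ p q, p ≤ q → f (e p) ≤ f (e q) := fun p q hpq =>
    Tuple.monotone_sort (f ∘ e₀) hpq
  have hcardlt : ∀ u ∈ a.elems, 0 < #u ∧ #u < l * m := by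
    intro u hu
    refine ⟨card_pos.2 (nonempty_iff_ne_empty.2 fun h => a.bot_notMem (h ▸ hu)), ?_⟩
    obtain ⟨x, hx⟩ : ∃ x, x ∉ u := by
      by_contra! h
      exact a.top_notMem (eq_univ_iff_forall.2 h ▸ hu)
    have := card_lt_univ_of_notMem hx
    simpa [mul_comm] using this
  have hlevel : ∀ u ∈ a.elems, level e #u = u := by
    intro u hu
    have hcard := card_level e (hcardlt u hu).2.le
    have hlow : ∀ x ∈ u, ∀ y ∉ u, e.symm x < e.symm y := by
      intro x hx y hy
      by_contra hc
      have := hmono _ _ (not_lt.1 hc)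
      rw [e.apply_symm_apply, e.apply_symm_apply] at this
      exact this.not_gt (hf u hu x hx y hy)
    by_cases h : u ⊆ level e #u
    · exact (eq_of_subset_of_card_le h hcard.le).symm
    · obtain ⟨x, hx, hxl⟩ := not_subset.1 h
      refine eq_of_subset_of_card_le (fun y hy => ?_) hcard.ge
      by_contra hyu
      rw [mem_level] at hy hxl
      have := Fin.lt_def.1 (hlow x hx y hyu)
      omega
  refine ⟨e, a.ranks, fun k hk => ?_, ?_⟩
  · obtain ⟨u, hu, rfl⟩ := mem_image.1 hk
    exact mem_Ioo.2 (hcardlt u hu)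
  · apply Face.ext
    ext u
    rw [mem_chainFace]
    constructor
    · exact fun hu => ⟨#u, mem_image_of_mem _ hu, hcardlt u hu, hlevel u hu⟩
    · rintro ⟨k, hk, -, rfl⟩
      obtain ⟨u, hu, rfl⟩ := mem_image.1 hk
      rwa [hlevel u hu]

theorem rowCount_eq_card_level (e : Fin (l * m) ≃ Fin m × Fin l) (k : ℕ) (r : Fin m) :
    rowCount (fun p => (e p).1) k r = #{x ∈ level e k | x.1 = r} := by
  rw [rowCount, ← card_map e.toEmbedding]
  congr 1
  ext x
  simp [mem_level]

theorem rowCount_eq_card_column (e : Fin (l * m) ≃ Fin m × Fin l) (k : ℕ) (r : Fin m) :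
    rowCount (fun p => (e p).1) k r = #{c : Fin l | (e.symm (r, c) : ℕ) < k} := by
  rw [rowCount_eq_card_level, ← card_map ⟨fun c : Fin l => (r, c), Prod.mk_right_injective r⟩]
  congr 1
  ext ⟨r', c⟩
  simp only [mem_filter, mem_level, mem_map, mem_univ, true_and, Function.Embedding.coeFn_mk,
    Prod.mk.injEq]
  constructor
  · rintro ⟨h, rfl⟩
    exact ⟨c, h, rfl, rfl⟩
  · rintro ⟨c, h, rfl, rfl⟩
    exact ⟨h, rfl⟩

theorem rowCount_end (e : Fin (l * m) ≃ Fin m × Fin l) (r : Fin m) :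
    rowCount (fun p => (e p).1) (l * m) r = l := by
  rw [rowCount_eq_card_column]
  simp

/-- A renumbering of the entries of each row, after which every level of the chain consists of the
first entries of each row. -/
theorem exists_column_perm (e : Fin (l * m) ≃ Fin m × Fin l) :
    ∃ τ : Fin m → Equiv.Perm (Fin l), ∀ k r c,
      (r, c) ∈ level e k ↔ (τ r c : ℕ) < rowCount (fun p => (e p).1) k r := by
  have hlt : ∀ r c k, #{c' : Fin l | (e.symm (r, c') : ℕ) < e.symm (r, c)} <
      #{c' : Fin l | (e.symm (r, c') : ℕ) < k} ↔ (e.symm (r, c) : ℕ) < k := by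
    intro r c k
    constructor
    · intro h
      by_contra hc
      refine h.not_ge (card_le_card fun c' hc' => ?_)
      rw [mem_filter] at hc' ⊢
      exact ⟨hc'.1, by omega⟩
    · intro h
      refine card_lt_card ⟨fun c' hc' => ?_, fun hs => ?_⟩
      · rw [mem_filter] at hc' ⊢
        exact ⟨hc'.1, by omega⟩
      · have := hs (mem_filter.2 ⟨mem_univ c, h⟩)
        simp at this
  have hl : ∀ r c, #{c' : Fin l | (e.symm (r, c') : ℕ) < e.symm (r, c)} < l := by
    intro r c
    have := (hlt r c (l * m)).2 (e.symm (r, c)).2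
    rwa [← rowCount_eq_card_column e (l * m), rowCount_end] at this
  have hinj : ∀ r, Function.Injective fun c =>
      (⟨#{c' : Fin l | (e.symm (r, c') : ℕ) < e.symm (r, c)}, hl r c⟩ : Fin l) := by
    intro r c c' h
    have h' := Fin.mk.inj_iff.1 h
    have h1 := hlt r c (e.symm (r, c'))
    have h2 := hlt r c' (e.symm (r, c))
    have : e.symm (r, c) = e.symm (r, c') := Fin.ext (by omega)
    exact (Prod.mk_inj.1 (e.symm.injective this)).2
  refine ⟨fun r => Equiv.ofBijective _ (Finite.injective_iff_bijective.1 (hinj r)), ?_⟩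
  intro k r c
  rw [mem_level, rowCount_eq_card_column, ← hlt r c k]
  rfl

/-- After a permutation within rows, every level consists of the first entries of each row and is
thus given by its counts. The group element renumbers each row of `e`, moves the rows by `f`, and
undoes the renumbering for `e'`. -/
theorem orbit_eq_of_rowCount_eq (f : Equiv.Perm (Fin m))
    (h : ∀ k ∈ S, ∀ r, rowCount (fun p => (e' p).1) k (f r) = rowCount (fun p => (e p).1) k r) :
    (chainFace e S).orbit = (chainFace e' S).orbit := by
  obtain ⟨τ, hτ⟩ := exists_column_perm e
  obtain ⟨τ', hτ'⟩ := exists_column_perm e'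
  let g : wreath l m := ⟨Equiv.prodShear f fun r => (τ r).trans (τ' (f r)).symm,
    f, fun r => (τ r).trans (τ' (f r)).symm, fun r c => rfl⟩
  have hg : ∀ k ∈ S, (level e k).image g.1 = level e' k := by
    intro k hk
    have hiff : ∀ x, g.1 x ∈ level e' k ↔ x ∈ level e k := by
      rintro ⟨r, c⟩
      rw [hτ, ← h k hk]
      refine (hτ' k _ _).trans ?_
      rw [Equiv.trans_apply, Equiv.apply_symm_apply]
    ext y
    rw [mem_image]
    constructor
    · rintro ⟨x, hx, rfl⟩
      exact (hiff x).2 hx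
    · intro hy
      exact ⟨g.1.symm y, (hiff _).1 (by rwa [Equiv.apply_symm_apply]), Equiv.apply_symm_apply _ _⟩
  refine (Face.orbit_eq_iff.2 ⟨g, ?_⟩).symm
  apply Face.ext
  ext u
  rw [smul_elems, mem_image, mem_chainFace]
  constructor
  · rintro ⟨v, hv, rfl⟩
    obtain ⟨k, hk, hk', rfl⟩ := mem_chainFace.1 hv
    exact ⟨k, hk, hk', (hg k hk).symm⟩
  · rintro ⟨k, hk, hk', rfl⟩
    exact ⟨_, mem_chainFace.2 ⟨k, hk, hk', rfl⟩, hg k hk⟩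

theorem exists_perm_of_orbit_eq (hS : S ⊆ Ioo 0 (l * m))
    (h : (chainFace e S).orbit = (chainFace e' S).orbit) :
    ∃ f : Equiv.Perm (Fin m), ∀ k ∈ S, ∀ r,
      rowCount (fun p => (e' p).1) k (f r) = rowCount (fun p => (e p).1) k r := by
  obtain ⟨⟨g, f, τ, hg⟩, hg'⟩ := Face.orbit_eq_iff.1 h.symm
  refine ⟨f, fun k hk r => ?_⟩
  have hk' := mem_Ioo.1 (hS hk)
  have hmem : (level e k).image g ∈ (chainFace e' S).elems := by
    rw [← hg']
    exact mem_image_of_mem _ (mem_chainFace.2 ⟨k, hk, hk', rfl⟩)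
  obtain ⟨k', -, hk'', hlev⟩ := mem_chainFace.1 hmem
  have hcard := congrArg card hlev
  rw [card_image_of_injective _ g.injective, card_level e hk'.2.le, card_level e' hk''.2.le] at hcard
  subst hcard
  rw [rowCount_eq_card_level, rowCount_eq_card_level, hlev, filter_image,
    card_image_of_injective _ g.injective]
  congr 1
  ext ⟨r', c⟩
  simp [hg]

/-- Chains in the same orbit have the same words up to a permutation of the rows. -/
theorem exists_perm_of_orbit_range_eq
    (h : (chainFace e (range (l * m))).orbit = (chainFace e' (range (l * m))).orbit) :
    ∃ f : Equiv.Perm (Fin m), ∀ p, (e' p).1 = f (e p).1 := by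
  rw [chainFace_range, chainFace_range] at h
  obtain ⟨f, hf⟩ := exists_perm_of_orbit_eq Subset.rfl h
  refine ⟨f, eq_of_rowCount_eq (w := fun p => (e p).1) (w' := fun p => (e' p).1)
    fun k hk r => ?_⟩
  rcases hk.eq_or_lt with rfl | hk
  · rw [rowCount_end, rowCount_end]
  rcases Nat.eq_zero_or_pos k with rfl | hk0
  · simp [rowCount]
  · exact hf k (mem_Ioo.2 ⟨hk0, hk⟩) r

theorem orbit_eq_of_perm (f : Equiv.Perm (Fin m)) (h : ∀ p, (e' p).1 = f (e p).1)
    (S : Finset ℕ) : (chainFace e S).orbit = (chainFace e' S).orbit := by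
  refine orbit_eq_of_rowCount_eq f fun k _ r => ?_
  simp only [h]
  exact rowCount_perm (w := fun p => (e p).1) f k r

theorem descentRanks_eq_of_perm (f : Equiv.Perm (Fin m)) (h : ∀ p, (e' p).1 = f (e p).1) :
    descentRanks (fun p => (e' p).1) = descentRanks fun p => (e p).1 := by
  simp only [h]
  rcases Nat.eq_zero_or_pos (l * m) with h0 | h0
  · have : ∀ w : Fin (l * m) → Fin m, descentRanks w = ∅ := fun w =>
      eq_empty_iff_forall_notMem.2 fun k hk => by
        have := mem_Ioo.1 (mem_Ioo_of_mem_descentRanks hk)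
        omega
    rw [this, this]
  · exact descentRanks_perm (w := fun p => (e p).1)
      (fun r => (rowCount_end e r).symm ▸ Nat.pos_of_mul_pos_right h0) f

theorem descentRanks_subset (w : Fin (l * m) → Fin m) : descentRanks w ⊆ Ioo 0 (l * m) :=
  fun _ => mem_Ioo_of_mem_descentRanks

/-! ### Facets -/

theorem exists_orbit_eq (x : QFace l m) : ∃ (e : Fin (l * m) ≃ Fin m × Fin l) (S : Finset ℕ),
    S ⊆ Ioo 0 (l * m) ∧ x = (chainFace e S).orbit := by
  obtain ⟨a, rfl⟩ := Quotient.exists_rep x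
  obtain ⟨e, S, hS, rfl⟩ := exists_chainFace a
  exact ⟨e, S, hS, rfl⟩

/-- Every face lies in a saturated chain, and the faces of saturated chains with all proper ranks
have the largest possible number of elements. -/
theorem isMax_iff {F : QFace l m} :
    IsMax F ↔ ∃ e : Fin (l * m) ≃ Fin m × Fin l, F = (chainFace e (range (l * m))).orbit := by
  constructor
  · intro hF
    obtain ⟨e, S, hS, rfl⟩ := exists_orbit_eq F
    refine ⟨e, ?_⟩
    rw [chainFace_range]
    exact le_antisymm (orbit_chainFace_mono hS) (hF (orbit_chainFace_mono hS))
  · rintro ⟨e, rfl⟩ y hy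
    rw [chainFace_range] at hy ⊢
    obtain ⟨e', S', hS', rfl⟩ := exists_orbit_eq y
    obtain rfl := hS'.antisymm (subset_of_orbit_le Subset.rfl hS' hy)
    obtain ⟨a, b, ha, hb, hab⟩ := hy
    have h1 : #b.elems ≤ #a.elems := by
      have hcard : ∀ {c d : Face l m}, c.orbit = d.orbit → #c.elems = #d.elems := by
        intro c d h
        obtain ⟨g, rfl⟩ := Face.orbit_eq_iff.1 h
        exact card_smul_elems g d
      have hfull : ∀ e : Fin (l * m) ≃ Fin m × Fin l,
          #(chainFace e (Ioo 0 (l * m))).elems = #(Ioo 0 (l * m)) := by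
        intro e
        refine le_antisymm (card_image_le.trans (card_le_card (filter_subset _ _))) ?_
        conv_lhs => rw [← ranks_chainFace (e := e) Subset.rfl]
        exact card_image_le
      rw [hcard ha, hcard hb, hfull, hfull]
    rw [← hb, ← Face.ext (eq_of_subset_of_card_le hab h1), ha]

/-- Each orbit of saturated chains contains a chain in standard form. -/
theorem exists_isStandard (e : Fin (l * m) ≃ Fin m × Fin l) :
    ∃ (e' : Fin (l * m) ≃ Fin m × Fin l) (f : Equiv.Perm (Fin m)),
      IsStandard (fun p => (e' p).1) ∧ ∀ p, (e' p).1 = f (e p).1 := by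
  -- First position of each row; the rows are renumbered by it. The infimum is attained because `l >
  -- 0` as soon as there is a position `p`.
  let first : Fin m → ℕ := fun r => sInf {q | ∃ h : q < l * m, (e ⟨q, h⟩).1 = r}
  let σ := Tuple.sort first
  refine ⟨e.trans (Equiv.prodCongr σ.symm (Equiv.refl _)), σ.symm, ?_, fun p => rfl⟩
  intro p r hr
  change r < σ.symm (e p).1 at hr
  have hl : 0 < l := Nat.pos_of_mul_pos_right (p.pos)
  have hmem : first (σ r) ∈ {q | ∃ h : q < l * m, (e ⟨q, h⟩).1 = σ r} := by
    refine Nat.sInf_mem ⟨e.symm (σ r, ⟨0, hl⟩), (e.symm (σ r, ⟨0, hl⟩)).2, ?_⟩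
    simp
  obtain ⟨hq, hq'⟩ := hmem
  have hle : first (σ r) ≤ p := by
    refine (Tuple.monotone_sort first hr.le).trans ?_
    change first (σ (σ.symm (e p).1)) ≤ p
    rw [Equiv.apply_symm_apply]
    exact Nat.sInf_le ⟨p.2, rfl⟩
  have heq : σ.symm (e ⟨first (σ r), hq⟩).1 = r := by rw [hq', Equiv.symm_apply_apply]
  refine ⟨⟨first (σ r), hq⟩, lt_of_le_of_ne hle fun h => ?_, heq⟩
  rw [h] at heq
  exact hr.ne' heq

/-- Intervals below a facet are Boolean algebras. -/
theorem nonempty_Icc_orderIso (e : Fin (l * m) ≃ Fin m × Fin l) {D : Finset ℕ}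
    (hD : D ⊆ Ioo 0 (l * m)) : ∃ k : ℕ,
    Nonempty (Set.Icc (chainFace e D).orbit (chainFace e (range (l * m))).orbit ≃o
      Finset (Fin k)) := by
  rw [chainFace_range]
  let R := Ioo 0 (l * m) \ D
  let i : Fin #R ↪o ℕ := R.orderEmbOfFin rfl
  have hi : ∀ a, i a ∈ R := fun a => R.orderEmbOfFin_mem rfl a
  have hiR : ∀ x ∈ R, ∃ a, i a = x := fun x hx => by
    have : x ∈ Set.range i := by
      rw [Finset.range_orderEmbOfFin]
      exact hx
    exact this
  let f : Finset (Fin #R) → Finset ℕ := fun A => D ∪ A.map i.toEmbedding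
  have hf : ∀ A, f A ⊆ Ioo 0 (l * m) := fun A => union_subset hD fun x hx => by
    obtain ⟨a, -, rfl⟩ := mem_map.1 hx
    exact (mem_sdiff.1 (hi a)).1
  have hfle : ∀ A B, f A ⊆ f B ↔ A ⊆ B := by
    intro A B
    constructor
    · intro h a ha
      have := h (mem_union_right _ (mem_map_of_mem i.toEmbedding ha))
      rcases mem_union.1 this with h1 | h1
      · exact absurd h1 (mem_sdiff.1 (hi a)).2
      · obtain ⟨b, hb, e⟩ := mem_map.1 h1
        exact i.injective e ▸ hb
    · exact fun h => union_subset_union_right (map_subset_map.2 h)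
  let F : Finset (Fin #R) ↪o
      Set.Icc (chainFace e D).orbit (chainFace e (Ioo 0 (l * m))).orbit :=
    OrderEmbedding.ofMapLEIff (fun A => ⟨(chainFace e (f A)).orbit,
      orbit_chainFace_mono subset_union_left, orbit_chainFace_mono (hf A)⟩) fun A B =>
      ⟨fun h => (hfle A B).1 (subset_of_orbit_le (hf A) (hf B) h),
        fun h => orbit_chainFace_mono ((hfle A B).2 h)⟩
  refine ⟨#R, ⟨(RelIso.ofSurjective F ?_).symm⟩⟩
  rintro ⟨x, hx, hx'⟩
  obtain ⟨S, hS, rfl⟩ := exists_of_le_orbit hx'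
  have hDS := subset_of_orbit_le hD hS hx
  refine ⟨({a | i a ∈ S} : Finset _), Subtype.ext ?_⟩
  change (chainFace e (f _)).orbit = _
  congr 2
  ext x
  simp only [f, mem_union, mem_map, mem_filter, mem_univ, true_and]
  constructor
  · rintro (h | ⟨a, ha, rfl⟩)
    exacts [hDS h, ha]
  · intro h
    by_cases hxD : x ∈ D
    · exact Or.inl hxD
    · obtain ⟨a, rfl⟩ := hiR x (mem_sdiff.2 ⟨hS h, hxD⟩)
      exact Or.inr ⟨a, h, rfl⟩

end

end WreathComplex

/-! ### The partitioning -/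

open WreathComplex in
theorem theorem5p1 (l m : ℕ) :
    ∃ G : {F : WreathComplex.QFace l m // IsMax F} → WreathComplex.QFace l m,
      (∀ F H, WreathComplex.IsMinimalFace F.1 H ↔ H = G F) ∧
      WreathComplex.IsPartitioning G := by
  choose e he using fun F : {F : QFace l m // IsMax F} => isMax_iff.1 F.2
  have hG : ∀ (F : {F : QFace l m // IsMax F}) (e' : Fin (l * m) ≃ Fin m × Fin l),
      F.1 = (chainFace e' (range (l * m))).orbit →
      (chainFace e' (descentRanks fun p => (e' p).1)).orbit =
        (chainFace (e F) (descentRanks fun p => (e F p).1)).orbit := by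
    intro F e' h
    obtain ⟨f, hf⟩ := exists_perm_of_orbit_range_eq (h.symm.trans (he F))
    rw [descentRanks_eq_of_perm f hf]
    exact orbit_eq_of_perm f hf _
  refine ⟨fun F => (chainFace (e F) (descentRanks fun p => (e F p).1)).orbit,
    fun F H => ⟨?_, ?_⟩, fun F => ?_, fun F => ?_, fun x => ?_⟩
  · rintro ⟨e', -, h, rfl⟩
    exact hG F e' h
  · rintro rfl
    obtain ⟨e', f, hst, hf⟩ := exists_isStandard (e F)
    have h := (he F).trans (orbit_eq_of_perm f hf _)
    exact ⟨e', hst, h, (hG F e' h).symm⟩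
  · rw [he F, chainFace_range]
    exact orbit_chainFace_mono (descentRanks_subset _)
  · have := nonempty_Icc_orderIso (e F) (descentRanks_subset fun p => (e F p).1)
    rwa [← he F] at this
  · obtain ⟨e₀, S, hS, rfl⟩ := exists_orbit_eq x
    have hSn : ∀ s ∈ S, s ≤ l * m := fun s hs => (mem_Ioo.1 (hS hs)).2.le
    have h₀ := rowCount_end e₀
    -- Existence: a word with the row counts of `x` at `S` and descents inside `S` gives a facet
    -- above `x` whose minimal face is below `x`.
    obtain ⟨w, hw, hwS, hwD⟩ := exists_word h₀ hSn
    obtain ⟨e₁, h₁⟩ := exists_equiv_of_word hw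
    obtain rfl : w = fun p => (e₁ p).1 := funext fun p => (h₁ p).symm
    have hx : (chainFace e₁ S).orbit = (chainFace e₀ S).orbit :=
      orbit_eq_of_rowCount_eq 1 fun k hk r => (hwS k hk r).symm
    have hF₁ : IsMax (chainFace e₁ (range (l * m))).orbit := isMax_iff.2 ⟨e₁, rfl⟩
    refine ⟨⟨_, hF₁⟩, ⟨?_, ?_⟩, ?_⟩
    · rw [← hG ⟨_, hF₁⟩ e₁ rfl, ← hx]
      exact orbit_chainFace_mono hwD
    · change _ ≤ (chainFace _ _).orbit
      rw [← hx, chainFace_range]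
      exact orbit_chainFace_mono hS
    · rintro F ⟨hF, hF'⟩
      change _ ≤ F.1 at hF'
      have hDS := subset_of_orbit_le (descentRanks_subset _) hS hF
      rw [he F, chainFace_range] at hF'
      obtain ⟨S', hS', hx'⟩ := exists_of_le_orbit hF'
      obtain rfl : S = S' := (subset_of_orbit_le hS hS' hx'.le).antisymm
        (subset_of_orbit_le hS' hS hx'.ge)
      obtain ⟨f, hf⟩ := exists_perm_of_orbit_eq hS hx'
      have hcnt : ∀ k r, rowCount (fun p => f.symm (e F p).1) k r =
          rowCount (fun p => (e F p).1) k (f r) := fun k r => by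
        conv_lhs => rw [← f.symm_apply_apply r]
        exact rowCount_perm (w := fun p => (e F p).1) f.symm k (f r)
      -- Uniqueness: after renumbering by `f.symm`, the word of `F` has the same counts at `S` as
      -- `e₀`. Renumbering preserves its descents, so it is a permuted copy of the word of `e₁`.
      obtain ⟨π, hπ⟩ := exists_perm_of_descentRanks_subset h₀ hSn hw
        (w' := fun p => f.symm (e F p).1)
        (fun r => by rw [hcnt, rowCount_end]) hwS
        (fun s hs r => by rw [hcnt, hf s hs]) hwD
        (by
          obtain ⟨e₂, h₂⟩ := exists_equiv_of_word (w := fun p => f.symm (e F p).1)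
            fun r => by rw [hcnt, rowCount_end]
          have := descentRanks_eq_of_perm f.symm h₂
          simp only [h₂] at this
          rwa [this])
      refine Subtype.ext ?_
      change F.1 = (chainFace e₁ (range (l * m))).orbit
      rw [he F]
      refine (orbit_eq_of_perm (π.trans f) (fun p => ?_) _).symm
      rw [Equiv.trans_apply, ← hπ, Equiv.apply_symm_apply]
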